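/- **Duality of Lie bialgebroids.** Let $M$ be a finite-dimensional smooth ($C^\infty$, Hausdorff, without boundary) manifold, and let $A$ and $A^*$ be smooth real vector bundles of finite rank over $M$ which are dual to each other through a smooth fibrewise nondegenerate pairing $\langle\cdot,\cdot\rangle : A^*\times_M A\to\mathbb R$. A *Lie algebroid* structure on a vector bundle $A\to M$ consists of a real Lie bracket $[\cdot,\cdot]$ on the space $\Gamma(A)$ of smooth sections and a smooth bundle map $a:A\to TM$ over the identity (the anchor) such that $[X,fY]=f[X,Y]+(a(X)f)\,Y$ and $a([X,Y])=[a(X),a(Y)]$ for all $X,Y\in\Gamma(A)$, $f\in C^\infty(M)$. Suppose that both $A$ and $A^*$ carry Lie algebroid structures, with brackets $[\cdot,\cdot]$, $[\cdot,\cdot]_*$ and anchors $a$, $a_*$. * Identify $\Gamma(\wedge^kA)$ with the $C^\infty(M)$-multilinear alternating $k$-forms on $\Gamma(A^*)$, by $(X_1\wedge\dots\wedge X_k)(\xi_1,\dots,\xi_k)=\det(\langle\xi_j,X_i\rangle)$. The differential $d_*:\Gamma(\wedge^kA)\to\Gamma(\wedge^{k+1}A)$ coming from the structure on $A^*$ is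 $$ (d_*P)(\xi_0,\dots,\xi_k)=\sum_{i}(-1)^i\,a_*(\xi_i)\big(P(\dots\hat\xi_i\dots)\big)+\sum_{i<j}(-1)^{i+j}P([\xi_i,\xi_j]_*,\dots\hat\xi_i\dots\hat\xi_j\dots). $$ * The Schouten bracket on $\Gamma(\wedge^*A)=\bigoplus_k\Gamma(\wedge^kA)$ is the extension of the structure on $A$, that is, the unique $\mathbb R$-bilinear bracket $\Gamma(\wedge^pA)\times\Gamma(\wedge^qA)\to\Gamma(\wedge^{p+q-1}A)$ which restricts to the given bracket on $\Gamma(A)$ and satisfies $[X,f]=a(X)f$ for $X\in\Gamma(A)$, $f\in C^\infty(M)$, the graded skew-symmetry $[P,Q]=-(-1)^{(p-1)(q-1)}[Q,P]$, and the graded Leibniz rule $[P,Q\wedge R]=[P,Q]\wedge R+(-1)^{(p-1)q}\,Q\wedge[P,R]$ for $P\in\Gamma(\wedge^pA)$, $Q\in\Gamma(\wedge^qA)$, $R\in\Gamma(\wedge^*A)$. The pair $(A,A^*)$ is called a *Lie bialgebroid* if $d_*$ is a derivation of this bracket: $$ d_*[P,Q]=[d_*P,Q]+(-1)^{p-1}[P,d_*Q]\qquad\text{for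 all } p,q\ge 0,\ P\in\Gamma(\wedge^pA),\ Q\in\Gamma(\wedge^qA). $$ **Claim.** If $(A,A^*)$ is a Lie bialgebroid, then so is $(A^*,A)$, where $A$ is regarded as the dual bundle of $A^*$ through the same pairing. In other words, the differential $d$ on $\Gamma(\wedge^*A^*)$ coming from the structure on $A$ is then a derivation of the Schouten bracket on $\Gamma(\wedge^*A^*)$ extending the structure on $A^*$. -/

import Mathlib

set_option linter.unusedSectionVars false

/-- A Lie--Rinehart structure on an `R`-module `L`: an `ℝ`-bilinear Lie bracket on `L` together with
an `R`-linear anchor `L → Der_ℝ(R)`, satisfying the Leibniz rule. It is the algebraic structure that a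
Lie algebroid induces on its module of sections (`R` being the ring of smooth functions), and it is
used only to write down the differential and the Schouten bracket. -/
structure LieRinehartStr (R L : Type*) [CommRing R] [Algebra ℝ R] [AddCommGroup L] [Module ℝ L]
    [Module R L] where
  bracket : L →ₗ[ℝ] L →ₗ[ℝ] L
  anchor : L →ₗ[R] Derivation ℝ R R
  bracket_self : ∀ X, bracket X X = 0
  jacobi : ∀ X Y Z, bracket X (bracket Y Z) = bracket (bracket X Y) Z + bracket Y (bracket X Z)
  leibniz : ∀ X (f : R) Y, bracket X (f • Y) = f • bracket X Y + anchor X f • Y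
  anchor_bracket : ∀ X Y (f : R),
    anchor (bracket X Y) f = anchor X (anchor Y f) - anchor Y (anchor X f)

namespace LieRinehartStr

open ExteriorAlgebra

section Twist

variable {R L : Type*} [CommRing R] [AddCommGroup L] [Module R L]

/-- The values on functions and on sections of a map `D : Λ L → Λ L` which satisfies
`D (f w) = f D w + w D f` and `D (X ∧ w) = X ∧ D w + (-1)^{|w|} w ∧ D X`.
The map `D` itself is constructed below, as `twistExt`. -/
structure TwistData (R L : Type*) [CommRing R] [AddCommGroup L] [Module R L] where
  c : R → ExteriorAlgebra R L
  c' : L → ExteriorAlgebra R L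
  c_add : ∀ f g, c (f + g) = c f + c g
  c_mul : ∀ f g, c (f * g) = f • c g + g • c f
  c'_add : ∀ X Y, c' (X + Y) = c' X + c' Y
  c'_smul : ∀ (f : R) X, c' (f • X) = f • c' X + ι R X * c f

theorem TwistData.c_zero (t : TwistData R L) : t.c 0 = 0 := by
  simpa using t.c_add 0 0

theorem TwistData.c_one (t : TwistData R L) : t.c 1 = 0 := by
  simpa using t.c_mul 1 1

/-- The pairs `(w, a)`, with the scalar multiplication `f • (w, a) = (f w, f a + w c(f))`. -/
def Twist (_ : TwistData R L) : Type _ := ExteriorAlgebra R L × ExteriorAlgebra R L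

noncomputable instance (t : TwistData R L) : AddCommGroup (Twist t) :=
  inferInstanceAs (AddCommGroup (ExteriorAlgebra R L × ExteriorAlgebra R L))

noncomputable instance (t : TwistData R L) : Module R (Twist t) where
  smul f x := (f • x.1, f • x.2 + x.1 * t.c f)
  one_smul x := by
    refine Prod.ext (one_smul R x.1) ?_
    change (1 : R) • x.2 + x.1 * t.c 1 = x.2
    rw [t.c_one]; simp
  mul_smul f g x := by
    refine Prod.ext (mul_smul f g x.1) ?_
    change (f * g) • x.2 + x.1 * t.c (f * g) = f • (g • x.2 + x.1 * t.c g) + (g • x.1) * t.c f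
    rw [t.c_mul]
    simp only [mul_add, mul_smul_comm, smul_mul_assoc, smul_add, mul_smul]
    abel
  smul_zero f := by
    refine Prod.ext (smul_zero f) ?_
    change f • (0 : ExteriorAlgebra R L) + 0 * t.c f = 0
    simp
  smul_add f x y := by
    refine Prod.ext (smul_add f x.1 y.1) ?_
    change f • (x.2 + y.2) + (x.1 + y.1) * t.c f = (f • x.2 + x.1 * t.c f) + (f • y.2 + y.1 * t.c f)
    simp only [add_mul, smul_add]
    abel
  add_smul f g x := by
    refine Prod.ext (add_smul f g x.1) ?_
    change (f + g) • x.2 + x.1 * t.c (f + g) = (f • x.2 + x.1 * t.c f) + (g • x.2 + x.1 * t.c g)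
    rw [t.c_add]
    simp only [mul_add, add_smul]
    abel
  zero_smul x := by
    refine Prod.ext (zero_smul R x.1) ?_
    change (0 : R) • x.2 + x.1 * t.c 0 = 0
    rw [t.c_zero]; simp

theorem ι_mul_eq (X : L) (w : ExteriorAlgebra R L) :
    ι R X * w = CliffordAlgebra.involute w * ι R X := by
  induction w using CliffordAlgebra.left_induction with
  | algebraMap r =>
    rw [AlgHom.commutes]
    exact (Algebra.commutes r _).symm
  | add x y hx hy => rw [mul_add, hx, hy, map_add, add_mul]
  | ι_mul w Y h =>
    have h1 : ι R X * ι R Y = - (ι R Y * ι R X) := eq_neg_of_add_eq_zero_left (ι_add_mul_swap X Y)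
    rw [map_mul, CliffordAlgebra.involute_ι]
    change ι R X * (ι R Y * w) = -ι R Y * _ * _
    rw [← mul_assoc, h1, mul_assoc (-ι R Y), ← h, neg_mul, neg_mul, mul_assoc]

/-- The operator `(w, a) ↦ (X ∧ w, X ∧ a + (-1)^{|w|} w ∧ c'(X))`, which is linear for the twisted
scalar multiplication. -/
noncomputable def twistAct (t : TwistData R L) : L →ₗ[R] Twist t →ₗ[R] Twist t :=
  LinearMap.mk₂ R
    (fun X x => (ι R X * x.1, ι R X * x.2 + CliffordAlgebra.involute x.1 * t.c' X))
    (fun X Y x => by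
      refine Prod.ext ?_ ?_
      · change ι R (X + Y) * x.1 = ι R X * x.1 + ι R Y * x.1
        rw [map_add, add_mul]
      · change ι R (X + Y) * x.2 + CliffordAlgebra.involute x.1 * t.c' (X + Y) =
          (ι R X * x.2 + CliffordAlgebra.involute x.1 * t.c' X) +
          (ι R Y * x.2 + CliffordAlgebra.involute x.1 * t.c' Y)
        rw [map_add, t.c'_add, add_mul, mul_add]; abel)
    (fun f X x => by
      refine Prod.ext ?_ ?_
      · change ι R (f • X) * x.1 = f • (ι R X * x.1)
        rw [map_smul, smul_mul_assoc]
      · change ι R (f • X) * x.2 + CliffordAlgebra.involute x.1 * t.c' (f • X) =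
          f • (ι R X * x.2 + CliffordAlgebra.involute x.1 * t.c' X) + (ι R X * x.1) * t.c f
        rw [map_smul, t.c'_smul, mul_add, smul_mul_assoc, mul_smul_comm, smul_add, ι_mul_eq X x.1,
          mul_assoc]
        abel)
    (fun X x y => by
      refine Prod.ext (mul_add _ _ _) ?_
      change ι R X * (x.2 + y.2) + CliffordAlgebra.involute (x.1 + y.1) * t.c' X =
          (ι R X * x.2 + CliffordAlgebra.involute x.1 * t.c' X) +
          (ι R X * y.2 + CliffordAlgebra.involute y.1 * t.c' X)
      rw [map_add, add_mul, mul_add]; abel)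
    (fun f X x => by
      refine Prod.ext (mul_smul_comm _ _ _) ?_
      change ι R X * (f • x.2 + x.1 * t.c f) + CliffordAlgebra.involute (f • x.1) * t.c' X =
          f • (ι R X * x.2 + CliffordAlgebra.involute x.1 * t.c' X) + (ι R X * x.1) * t.c f
      rw [map_smul, smul_mul_assoc, mul_add, mul_smul_comm, smul_add, mul_assoc]
      abel)

theorem twistAct_sq (t : TwistData R L) (X : L) (x : Twist t) :
    twistAct t X (twistAct t X x) = (0 : QuadraticForm R L) X • x := by
  rw [show (0 : QuadraticForm R L) X = 0 from rfl, zero_smul]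
  refine Prod.ext ?_ ?_
  · change ι R X * (ι R X * x.1) = 0
    rw [← mul_assoc, ι_sq_zero, zero_mul]
  · change ι R X * (ι R X * x.2 + CliffordAlgebra.involute x.1 * t.c' X) +
      CliffordAlgebra.involute (ι R X * x.1) * t.c' X = 0
    rw [map_mul, CliffordAlgebra.involute_ι, mul_add, ← mul_assoc, ← mul_assoc, ι_sq_zero]
    change _ + -ι R X * _ * _ = 0
    simp

/-- The base point `(1, 0)`. -/
noncomputable def Twist.base (t : TwistData R L) : Twist t :=
  ((1, 0) : ExteriorAlgebra R L × ExteriorAlgebra R L)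

/-- The map `w ↦ (w, D w)`, obtained by letting the generators act successively on `(1, 0)`. -/
noncomputable def twistFold (t : TwistData R L) : ExteriorAlgebra R L →ₗ[R] Twist t :=
  CliffordAlgebra.foldr (0 : QuadraticForm R L) (twistAct t) (twistAct_sq t) (Twist.base t)

theorem twistFold_algebraMap (t : TwistData R L) (f : R) :
    twistFold t (algebraMap R _ f) = f • Twist.base t :=
  CliffordAlgebra.foldr_algebraMap _ _ _ _ _

theorem twistFold_ι_mul (t : TwistData R L) (X : L) (w : ExteriorAlgebra R L) :
    twistFold t (ι R X * w) = twistAct t X (twistFold t w) :=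
  (CliffordAlgebra.foldr_mul _ _ _ _ _ _).trans (CliffordAlgebra.foldr_ι _ _ _ _ _)

theorem twistFold_fst (t : TwistData R L) (u : ExteriorAlgebra R L) : (twistFold t u).1 = u := by
  induction u using CliffordAlgebra.left_induction with
  | algebraMap r =>
    refine (congrArg Prod.fst (twistFold_algebraMap t r)).trans ?_
    exact (Algebra.algebraMap_eq_smul_one r).symm
  | add x y hx hy =>
    rw [map_add]
    exact congrArg₂ (· + ·) hx hy
  | ι_mul w Y h =>
    exact (congrArg Prod.fst (twistFold_ι_mul t Y w)).trans (congrArg (ι R Y * ·) h)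

/-- The extension `D` of the data `t` to the whole exterior algebra; it is characterised by
`twistExt_algebraMap`, `twistExt_add` and `twistExt_ι_mul` below. -/
noncomputable def twistExt (t : TwistData R L) (u : ExteriorAlgebra R L) : ExteriorAlgebra R L :=
  (twistFold t u).2

theorem twistExt_algebraMap (t : TwistData R L) (f : R) :
    twistExt t (algebraMap R _ f) = t.c f := by
  rw [twistExt, twistFold_algebraMap]
  change f • (0 : ExteriorAlgebra R L) + 1 * t.c f = t.c f
  simp

theorem twistExt_add (t : TwistData R L) (u v : ExteriorAlgebra R L) :
    twistExt t (u + v) = twistExt t u + twistExt t v := by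
  rw [twistExt, map_add]; rfl

theorem twistExt_smul (t : TwistData R L) (f : R) (w : ExteriorAlgebra R L) :
    twistExt t (f • w) = f • twistExt t w + w * t.c f := by
  rw [twistExt, map_smul]
  change f • twistExt t w + (twistFold t w).1 * t.c f = _
  rw [twistFold_fst]

theorem twistExt_ι_mul (t : TwistData R L) (X : L) (w : ExteriorAlgebra R L) :
    twistExt t (ι R X * w) = ι R X * twistExt t w + CliffordAlgebra.involute w * t.c' X := by
  rw [twistExt, twistFold_ι_mul]
  change ι R X * twistExt t w + CliffordAlgebra.involute (twistFold t w).1 * t.c' X = _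
  rw [twistFold_fst]

theorem twistExt_ι (t : TwistData R L) (X : L) : twistExt t (ι R X) = t.c' X := by
  have := twistExt_ι_mul t X 1
  rw [mul_one, map_one, one_mul] at this
  rw [this, ← map_one (algebraMap R (ExteriorAlgebra R L)), twistExt_algebraMap, t.c_one, mul_zero,
    zero_add]

end Twist

section Schouten

variable {R L : Type*} [CommRing R] [Algebra ℝ R] [AddCommGroup L] [Module ℝ L] [Module R L]
  (A : LieRinehartStr R L)

theorem bracket_neg (X Y : L) : A.bracket X Y = - A.bracket Y X := by
  have h := A.bracket_self (X + Y)
  simp only [map_add, LinearMap.add_apply, A.bracket_self, zero_add, add_zero] at h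
  exact eq_neg_of_add_eq_zero_right h

theorem leibniz_left (f : R) (X Y : L) :
    A.bracket (f • X) Y = f • A.bracket X Y - A.anchor Y f • X := by
  rw [A.bracket_neg, A.leibniz, A.bracket_neg X Y, smul_neg]
  abel

/-- The differential of a function: `⟨df, X⟩ = a(X) f`. -/
def d₀ (f : R) : Module.Dual R L where
  toFun X := A.anchor X f
  map_add' X Y := by simp
  map_smul' g X := by simp

theorem d₀_apply (f : R) (X : L) : A.d₀ f X = A.anchor X f := rfl

/-- The Schouten bracket `[f, v] = - i_{df} v` of a function `f` with a multisection `v`. -/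
noncomputable def fnBracket (f : R) (v : ExteriorAlgebra R L) : ExteriorAlgebra R L :=
  - CliffordAlgebra.contractLeft (A.d₀ f) v

/-- The Lie derivative along `X` on generators: `f ↦ a(X) f`, `Y ↦ [X, Y]`. -/
noncomputable def lieTwist (X : L) : TwistData R L where
  c f := algebraMap R _ (A.anchor X f)
  c' Y := ι R (A.bracket X Y)
  c_add f g := by simp
  c_mul f g := by
    rw [Derivation.leibniz, map_add, smul_eq_mul, smul_eq_mul, map_mul, map_mul,
      Algebra.smul_def, Algebra.smul_def]
  c'_add Y Z := by simp
  c'_smul f Y := by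
    rw [A.leibniz, map_add, map_smul, map_smul, ← Algebra.commutes, Algebra.smul_def (A.anchor X f)]

/-- The Schouten bracket `[X, v] = L_X v` of a section `X` with a multisection `v`: the derivation of
the exterior algebra with `L_X f = a(X) f` and `L_X Y = [X, Y]`
(see `lieDeriv_algebraMap` and `lieDeriv_ι_mul`). -/
noncomputable def lieDeriv (X : L) (v : ExteriorAlgebra R L) : ExteriorAlgebra R L :=
  twistExt (A.lieTwist X) v

theorem fnBracket_add (f : R) (v w : ExteriorAlgebra R L) :
    A.fnBracket f (v + w) = A.fnBracket f v + A.fnBracket f w := by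
  rw [fnBracket, map_add]; exact neg_add _ _

theorem fnBracket_ι_mul (f : R) (Y : L) (w : ExteriorAlgebra R L) :
    A.fnBracket f (ι R Y * w) = -(A.anchor Y f • w) - ι R Y * A.fnBracket f w := by
  rw [fnBracket]
  erw [CliffordAlgebra.contractLeft_ι_mul]
  rw [fnBracket, d₀_apply, mul_neg]
  change -(_ - ι R Y * _) = _
  abel

theorem fnBracket_algebraMap (f g : R) :
    A.fnBracket f (algebraMap R _ g) = 0 := by
  rw [fnBracket]
  erw [CliffordAlgebra.contractLeft_algebraMap]
  exact neg_zero

theorem lieDeriv_smul_left (f : R) (X : L) (v : ExteriorAlgebra R L) :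
    A.lieDeriv (f • X) v = f • A.lieDeriv X v + ι R X * A.fnBracket f v := by
  induction v using CliffordAlgebra.left_induction with
  | algebraMap g =>
    erw [lieDeriv, lieDeriv, twistExt_algebraMap, twistExt_algebraMap, fnBracket_algebraMap]
    simp [lieTwist, Algebra.smul_def]
  | add x y hx hy =>
    rw [fnBracket_add, lieDeriv, lieDeriv, twistExt_add, twistExt_add, mul_add, smul_add]
    rw [lieDeriv, lieDeriv] at hx hy
    rw [hx, hy]
    abel
  | ι_mul w Y h =>
    change A.lieDeriv (f • X) (ι R Y * w) = f • A.lieDeriv X (ι R Y * w) +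
      ι R X * A.fnBracket f (ι R Y * w)
    rw [fnBracket_ι_mul, lieDeriv, lieDeriv, twistExt_ι_mul, twistExt_ι_mul]
    rw [lieDeriv, lieDeriv] at h
    rw [h]
    have h1 : ι R X * ι R Y = - (ι R Y * ι R X) := eq_neg_of_add_eq_zero_left (ι_add_mul_swap X Y)
    simp only [lieTwist]
    rw [A.leibniz_left, map_sub, map_smul, map_smul, mul_sub (CliffordAlgebra.involute w),
      mul_smul_comm, mul_smul_comm, mul_sub (ι R X), ← mul_assoc (ι R X), h1, mul_neg,
      mul_smul_comm, ι_mul_eq X w, mul_add, mul_smul_comm, smul_add, neg_mul, mul_assoc]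
    abel

/-- The map `u ↦ [u, v]` on generators: `f ↦ [f, v]`, `X ↦ [X, v]`. -/
noncomputable def schoutenTwist (v : ExteriorAlgebra R L) : TwistData R L where
  c f := A.fnBracket f v
  c' X := A.lieDeriv X v
  c_add f g := by
    have : A.d₀ (f + g) = A.d₀ f + A.d₀ g := by ext X; simp [d₀_apply]
    rw [fnBracket, fnBracket, fnBracket, this, map_add, LinearMap.add_apply]
    exact neg_add _ _
  c_mul f g := by
    have : A.d₀ (f * g) = f • A.d₀ g + g • A.d₀ f := by ext X; simp [d₀_apply]
    rw [fnBracket, fnBracket, fnBracket, this, map_add, LinearMap.add_apply, map_smul, map_smul]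
    rw [LinearMap.smul_apply, LinearMap.smul_apply, neg_add]
    exact congrArg₂ (· + ·) (smul_neg _ _).symm (smul_neg _ _).symm
  c'_add X Y := by
    induction v using CliffordAlgebra.left_induction with
    | algebraMap g =>
      erw [lieDeriv, lieDeriv, lieDeriv, twistExt_algebraMap, twistExt_algebraMap, twistExt_algebraMap]
      simp [lieTwist]
    | add x y hx hy =>
      simp only [lieDeriv, twistExt_add] at hx hy ⊢
      rw [hx, hy]; abel
    | ι_mul w Y h =>
      simp only [lieDeriv] at h ⊢
      erw [twistExt_ι_mul, twistExt_ι_mul, twistExt_ι_mul, h]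
      simp only [lieTwist, map_add, LinearMap.add_apply, mul_add]
      abel
  c'_smul f X := A.lieDeriv_smul_left f X v

/-- The Schouten bracket on the exterior algebra `Λ_R L` of a Lie--Rinehart algebra: the extension
of the bracket and the anchor by `[X, f] = a(X) f`, `[X, Y] = [X, Y]_L` and the graded Leibniz rule
`[X ∧ u, v] = X ∧ [u, v] + (-1)^{|u|} u ∧ [X, v]`. For homogeneous `u`, the last term equals
`(-1)^{|u|(|v|-1)} [X, v] ∧ u`, which is the usual form of the rule. -/
noncomputable def schoutenAlg (u v : ExteriorAlgebra R L) : ExteriorAlgebra R L :=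
  twistExt (A.schoutenTwist v) u


theorem schoutenAlg_add_left (u u' v : ExteriorAlgebra R L) :
    A.schoutenAlg (u + u') v = A.schoutenAlg u v + A.schoutenAlg u' v := twistExt_add _ _ _

theorem schoutenAlg_algebraMap (f : R) (v : ExteriorAlgebra R L) :
    A.schoutenAlg (algebraMap R _ f) v = A.fnBracket f v := twistExt_algebraMap _ _

theorem schoutenAlg_ι_mul (X : L) (u v : ExteriorAlgebra R L) :
    A.schoutenAlg (ι R X * u) v =
      ι R X * A.schoutenAlg u v + CliffordAlgebra.involute u * A.lieDeriv X v := twistExt_ι_mul _ _ _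

theorem schoutenAlg_smul_left (f : R) (u v : ExteriorAlgebra R L) :
    A.schoutenAlg (f • u) v = f • A.schoutenAlg u v + u * A.fnBracket f v := twistExt_smul _ _ _

theorem lieDeriv_algebraMap (X : L) (f : R) :
    A.lieDeriv X (algebraMap R _ f) = algebraMap R _ (A.anchor X f) := twistExt_algebraMap _ _

theorem lieDeriv_ι_mul (X Y : L) (v : ExteriorAlgebra R L) :
    A.lieDeriv X (ι R Y * v) = ι R (A.bracket X Y) * v + ι R Y * A.lieDeriv X v := by
  rw [lieDeriv, twistExt_ι_mul, add_comm, ι_mul_eq (A.bracket X Y)]; rfl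

theorem lieDeriv_smul (X : L) (f : R) (v : ExteriorAlgebra R L) :
    A.lieDeriv X (f • v) = f • A.lieDeriv X v + A.anchor X f • v := by
  rw [lieDeriv, twistExt_smul, Algebra.smul_def (A.anchor X f), Algebra.commutes]; rfl

theorem schoutenAlg_ι_ι (X Y : L) :
    A.schoutenAlg (ι R X) (ι R Y) = ι R (A.bracket X Y) :=
  (twistExt_ι _ _).trans (twistExt_ι _ _)

theorem schoutenAlg_ι_algebraMap (X : L) (f : R) :
    A.schoutenAlg (ι R X) (algebraMap R _ f) = algebraMap R _ (A.anchor X f) :=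
  (twistExt_ι _ _).trans (twistExt_algebraMap _ _)

theorem schoutenAlg_add_right (u v v' : ExteriorAlgebra R L) :
    A.schoutenAlg u (v + v') = A.schoutenAlg u v + A.schoutenAlg u v' := by
  induction u using CliffordAlgebra.left_induction with
  | algebraMap r =>
    exact (A.schoutenAlg_algebraMap _ _).trans ((A.fnBracket_add _ _ _).trans
      (congrArg₂ (· + ·) (A.schoutenAlg_algebraMap _ _).symm (A.schoutenAlg_algebraMap _ _).symm))
  | add x y hx hy =>
    rw [schoutenAlg_add_left, schoutenAlg_add_left, schoutenAlg_add_left, hx, hy]; abel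
  | ι_mul w X h =>
    change A.schoutenAlg (ι R X * w) (v + v') =
      A.schoutenAlg (ι R X * w) v + A.schoutenAlg (ι R X * w) v'
    rw [schoutenAlg_ι_mul, schoutenAlg_ι_mul, schoutenAlg_ι_mul, h, lieDeriv, twistExt_add, mul_add,
      mul_add, ← lieDeriv, ← lieDeriv]
    abel

/-- Locality in the first argument. -/
theorem schoutenAlg_local_left {g : R} {u : ExteriorAlgebra R L} (h : g • u = 0)
    (v : ExteriorAlgebra R L) : (g * g) • A.schoutenAlg u v = 0 := by
  have h1 := A.schoutenAlg_smul_left g u v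
  have h0 : A.schoutenAlg 0 v = 0 := by simpa using A.schoutenAlg_add_left 0 0 v
  rw [h, h0] at h1
  have h2 := congrArg (g • ·) h1.symm
  simp only [smul_add, smul_zero, ← smul_mul_assoc, h, zero_mul, add_zero] at h2
  rw [mul_smul, h2]

/-- Locality in the second argument. -/
theorem schoutenAlg_local_right {g : R} {v : ExteriorAlgebra R L} (h : g • v = 0)
    (u : ExteriorAlgebra R L) : (g * g) • A.schoutenAlg u v = 0 := by
  have hD : ∀ X, (g * g) • A.lieDeriv X v = 0 := fun X => by
    have h1 := A.lieDeriv_smul X g v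
    have h0 : A.lieDeriv X 0 = 0 := by
      have := A.lieDeriv_smul X 0 0
      simpa using this
    rw [h, h0] at h1
    have h2 := congrArg (g • ·) h1.symm
    simp only [smul_add, smul_zero, smul_comm g (A.anchor X g), h, add_zero] at h2
    rw [mul_smul, h2]
  induction u using CliffordAlgebra.left_induction with
  | algebraMap r =>
    change _ • A.schoutenAlg (algebraMap R _ r) v = 0
    rw [schoutenAlg_algebraMap, fnBracket, smul_neg]
    have : g • CliffordAlgebra.contractLeft (A.d₀ r) v = 0 :=
      (map_smul _ g v).symm.trans ((congrArg _ h).trans (map_zero _))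
    rw [mul_smul]
    refine neg_eq_zero.2 ((congrArg (g • ·) this).trans (smul_zero _))
  | add x y hx hy => rw [schoutenAlg_add_left, smul_add, hx, hy, add_zero]
  | ι_mul w X h =>
    change _ • A.schoutenAlg (ι R X * w) v = 0
    rw [schoutenAlg_ι_mul, smul_add, ← mul_smul_comm, h, ← mul_smul_comm, hD, mul_zero, mul_zero,
      add_zero]

end Schouten

section Pairing

variable {R L L' : Type*} [CommRing R] [AddCommGroup L] [Module R L] [AddCommGroup L'] [Module R L']
  (β : L' →ₗ[R] L →ₗ[R] R)

/-- The determinant pairing of `k`-tuples, `(ξ, X) ↦ det ⟨ξ_b, X_a⟩`. -/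
noncomputable def detPairing (k : ℕ) : L' [⋀^Fin k]→ₗ[R] (L [⋀^Fin k]→ₗ[R] R) where
  toFun ξ := Matrix.detRowAlternating.compLinearMap (LinearMap.pi fun b => β (ξ b))
  map_update_add' {hdec} ξ i x y := by
    obtain rfl : hdec = instDecidableEqFin k := Subsingleton.elim _ _
    have key : ∀ z (X : Fin k → L), (Matrix.of fun a b => β (Function.update ξ i z b) (X a)) =
        (Matrix.of fun a b => β (ξ b) (X a)).updateCol i (fun a => β z (X a)) := fun z X => by
      ext a b
      by_cases h : b = i
      · subst h; simp
      · simp [h]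
    ext X
    change Matrix.det (Matrix.of fun a b => β (Function.update ξ i (x + y) b) (X a)) =
      Matrix.det (Matrix.of fun a b => β (Function.update ξ i x b) (X a)) +
      Matrix.det (Matrix.of fun a b => β (Function.update ξ i y b) (X a))
    rw [key, key, key, ← Matrix.det_updateCol_add]
    congr 2
    ext a
    simp
  map_update_smul' {hdec} ξ i f x := by
    obtain rfl : hdec = instDecidableEqFin k := Subsingleton.elim _ _
    have key : ∀ z (X : Fin k → L), (Matrix.of fun a b => β (Function.update ξ i z b) (X a)) =
        (Matrix.of fun a b => β (ξ b) (X a)).updateCol i (fun a => β z (X a)) := fun z X => by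
      ext a b
      by_cases h : b = i
      · subst h; simp
      · simp [h]
    ext X
    change Matrix.det (Matrix.of fun a b => β (Function.update ξ i (f • x) b) (X a)) =
      f • Matrix.det (Matrix.of fun a b => β (Function.update ξ i x b) (X a))
    rw [key, key, smul_eq_mul, ← Matrix.det_updateCol_smul]
    congr 2
    ext a
    simp
  map_eq_zero_of_eq' ξ i j h hij := by
    ext X
    change Matrix.det (Matrix.of fun a b => β (ξ b) (X a)) = 0
    exact Matrix.det_zero_of_column_eq hij (fun a => by simp [h])

theorem detPairing_apply (k : ℕ) (ξ : Fin k → L') (X : Fin k → L) :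
    detPairing β k ξ X = Matrix.det (Matrix.of fun a b => β (ξ b) (X a)) := rfl

/-- The alternating form on `L'` defined by the component of degree `k` of `u ∈ Λ L`:
`(X_1 ∧ ⋯ ∧ X_k)(ξ_1, …, ξ_k) = det ⟨ξ_b, X_a⟩`, while products of `n ≠ k` sections give zero. -/
noncomputable def toForm (k : ℕ) : ExteriorAlgebra R L →ₗ[R] L' [⋀^Fin k]→ₗ[R] R where
  toFun u := ((LinearMap.applyₗ u) ∘ₗ liftAlternating ∘ₗ
    LinearMap.single R (fun n => L [⋀^Fin n]→ₗ[R] R) k).compAlternatingMap (detPairing β k)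
  map_add' u v := by ext ξ; simp
  map_smul' f u := by ext ξ; simp

theorem toForm_apply (k : ℕ) (u : ExteriorAlgebra R L) (ξ : Fin k → L') :
    toForm β k u ξ = liftAlternating (R := R) (Pi.single k (detPairing β k ξ)) u := rfl

theorem toForm_ιMulti (k : ℕ) (X : Fin k → L) (ξ : Fin k → L') :
    toForm β k (ιMulti R k X) ξ = Matrix.det (Matrix.of fun a b => β (ξ b) (X a)) := by
  rw [toForm_apply, liftAlternating_apply_ιMulti, Pi.single_eq_same, detPairing_apply]

theorem toForm_ιMulti_of_ne {k n : ℕ} (h : n ≠ k) (X : Fin n → L) :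
    toForm β k (ιMulti R n X) = 0 := by
  ext ξ
  rw [toForm_apply, liftAlternating_apply_ιMulti, Pi.single_eq_of_ne h]; rfl

/-- A pair of dual frames, up to the factor `g`: a local frame and its dual frame, cut off by a
function. Auxiliary. -/
structure DualFrame (g : R) where
  n : ℕ
  e : Fin n → L
  ε : Fin n → L'
  left : ∀ X, g • X = ∑ i, β (ε i) X • e i
  right : ∀ ξ, g • ξ = ∑ i, β ξ (e i) • ε i

variable {β}

theorem sum_toForm_smul {g : R} (D : DualFrame β g) (k : ℕ) (X : Fin k → L) :
    ∑ i : Fin k → Fin D.n, toForm β k (ιMulti R k X) (D.ε ∘ i) • ιMulti R k (D.e ∘ i) =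
      ((k.factorial : R) * g ^ k) • ιMulti R k X := by
  have h1 : ∀ σ : Equiv.Perm (Fin k), ∑ i : Fin k → Fin D.n,
      (∏ b, β (D.ε (i b)) (X (σ b))) • ιMulti R k (D.e ∘ i) =
      g ^ k • Equiv.Perm.sign σ • ιMulti R k X := fun σ => by
    have h2 : ιMulti R k (fun b => g • X (σ b)) =
        ιMulti R k (fun b => ∑ i, β (D.ε i) (X (σ b)) • D.e i) := by simp_rw [D.left]
    have h3 := (ιMulti R k).toMultilinearMap.map_sum
      (fun b (i : Fin D.n) => β (D.ε i) (X (σ b)) • D.e i)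
    have h4 := (ιMulti R k).toMultilinearMap.map_smul_univ (fun _ => g) (fun b => X (σ b))
    simp only [Finset.prod_const, Finset.card_univ, Fintype.card_fin] at h4
    have h5 := (ιMulti R k).map_perm X σ
    simp only [AlternatingMap.coe_multilinearMap] at h3 h4
    rw [← h5]
    refine Eq.trans ?_ ((h3.symm.trans h2.symm).trans h4)
    refine Finset.sum_congr rfl fun i _ => ?_
    exact ((ιMulti R k).toMultilinearMap.map_smul_univ (fun b => β (D.ε (i b)) (X (σ b)))
      (fun b => D.e (i b))).symm
  simp_rw [toForm_ιMulti, Matrix.det_apply, Finset.sum_smul]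
  rw [Finset.sum_comm]
  have h6 : ∀ σ : Equiv.Perm (Fin k), ∑ i : Fin k → Fin D.n,
      (Equiv.Perm.sign σ • ∏ b, (Matrix.of fun a b => β ((D.ε ∘ i) b) (X a)) (σ b) b) •
        ιMulti R k (D.e ∘ i) = g ^ k • ιMulti R k X := fun σ => by
    have := congrArg (Equiv.Perm.sign σ • ·) (h1 σ)
    simp only [Finset.smul_sum] at this
    rw [smul_comm (Equiv.Perm.sign σ) (g ^ k), smul_smul (Equiv.Perm.sign σ), Int.units_mul_self, one_smul] at this
    rw [← this]
    refine Finset.sum_congr rfl fun i _ => ?_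
    rw [smul_assoc]
    rfl
  rw [Finset.sum_congr rfl fun σ _ => h6 σ, Finset.sum_const, Finset.card_univ, Fintype.card_perm,
    Fintype.card_fin, mul_smul, Nat.cast_smul_eq_nsmul]

theorem altSum_apply {ι : Type*} (s : Finset ι) {k : ℕ} (P : ι → L' [⋀^Fin k]→ₗ[R] R)
    (ξ : Fin k → L') : (∑ i ∈ s, P i) ξ = ∑ i ∈ s, P i ξ :=
  map_sum (⟨⟨fun P => P ξ, rfl⟩, fun _ _ => rfl⟩ : (L' [⋀^Fin k]→ₗ[R] R) →+ R) P s

theorem toForm_sum_smul {g : R} (D : DualFrame β g) (k : ℕ) (P : L' [⋀^Fin k]→ₗ[R] R) :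
    ∑ i : Fin k → Fin D.n, P (D.ε ∘ i) • toForm β k (ιMulti R k (D.e ∘ i)) =
      ((k.factorial : R) * g ^ k) • P := by
  ext ξ
  have h1 : ∀ σ : Equiv.Perm (Fin k), ∑ i : Fin k → Fin D.n,
      (∏ b, β (ξ (σ b)) (D.e (i b))) • P (D.ε ∘ i) =
      g ^ k • Equiv.Perm.sign σ • P ξ := fun σ => by
    have h2 : P (fun b => g • ξ (σ b)) =
        P (fun b => ∑ i, β (ξ (σ b)) (D.e i) • D.ε i) := by simp_rw [D.right]
    have h3 := P.toMultilinearMap.map_sum (fun b (i : Fin D.n) => β (ξ (σ b)) (D.e i) • D.ε i)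
    have h4 := P.toMultilinearMap.map_smul_univ (fun _ => g) (fun b => ξ (σ b))
    simp only [Finset.prod_const, Finset.card_univ, Fintype.card_fin] at h4
    have h5 := P.map_perm ξ σ
    simp only [AlternatingMap.coe_multilinearMap] at h3 h4
    rw [← h5]
    refine Eq.trans ?_ ((h3.symm.trans h2.symm).trans h4)
    refine Finset.sum_congr rfl fun i _ => ?_
    exact (P.toMultilinearMap.map_smul_univ (fun b => β (ξ (σ b)) (D.e (i b)))
      (fun b => D.ε (i b))).symm
  have h0 : (∑ i : Fin k → Fin D.n, P (D.ε ∘ i) • toForm β k (ιMulti R k (D.e ∘ i))) ξ =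
      ∑ i : Fin k → Fin D.n, P (D.ε ∘ i) • Matrix.det
        (Matrix.of fun a b => β (ξ a) (D.e (i b))) := by
    rw [altSum_apply]
    refine Finset.sum_congr rfl fun i _ => ?_
    rw [AlternatingMap.smul_apply, toForm_ιMulti, ← Matrix.det_transpose]
    rfl
  rw [h0]
  simp_rw [Matrix.det_apply, Finset.smul_sum]
  rw [Finset.sum_comm]
  have h6 : ∀ σ : Equiv.Perm (Fin k), ∑ i : Fin k → Fin D.n,
      P (D.ε ∘ i) • Equiv.Perm.sign σ • ∏ b, (Matrix.of fun a b => β (ξ a) (D.e (i b))) (σ b) b =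
        g ^ k • P ξ := fun σ => by
    have := congrArg (Equiv.Perm.sign σ • ·) (h1 σ)
    simp only [Finset.smul_sum] at this
    rw [smul_comm (Equiv.Perm.sign σ) (g ^ k), smul_smul (Equiv.Perm.sign σ), Int.units_mul_self,
      one_smul] at this
    rw [← this]
    refine Finset.sum_congr rfl fun i _ => ?_
    rw [smul_comm, smul_eq_mul, smul_eq_mul, mul_comm]
    rfl
  rw [Finset.sum_congr rfl fun σ _ => h6 σ, Finset.sum_const, Finset.card_univ, Fintype.card_perm,
    Fintype.card_fin, AlternatingMap.smul_apply, mul_smul, Nat.cast_smul_eq_nsmul]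

theorem exists_pow_smul_eq [Algebra ℝ R] {g : R} (D : DualFrame β g) (u : ExteriorAlgebra R L) :
    ∃ N : ℕ, ∀ m, N ≤ m → g ^ m • u = ∑ k ∈ Finset.range (m + 1),
      (algebraMap ℝ R (k.factorial : ℝ)⁻¹ * g ^ (m - k)) •
      ∑ i : Fin k → Fin D.n, toForm β k u (D.ε ∘ i) • ιMulti R k (D.e ∘ i) := by
  have hu : u ∈ Submodule.span R (Set.range fun x : Σ n, (Fin n → L) => ιMulti R x.1 x.2) := by
    rw [ιMulti_span]; trivial
  induction hu using Submodule.span_induction with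
  | mem x hx =>
    obtain ⟨⟨n, X⟩, rfl⟩ := hx
    refine ⟨n, fun m hm => ?_⟩
    rw [Finset.sum_eq_single n]
    · rw [sum_toForm_smul, smul_smul]
      congr 1
      have h1 : algebraMap ℝ R (n.factorial : ℝ)⁻¹ * (n.factorial : R) = 1 := by
        rw [← map_natCast (algebraMap ℝ R), ← map_mul, inv_mul_cancel₀, map_one]
        exact_mod_cast n.factorial_ne_zero
      calc g ^ m = g ^ (m - n) * g ^ n := by rw [← pow_add, Nat.sub_add_cancel hm]
        _ = (algebraMap ℝ R (n.factorial : ℝ)⁻¹ * (n.factorial : R)) *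
          (g ^ (m - n) * g ^ n) := by rw [h1, one_mul]
        _ = _ := by ring
    · intro k _ hk
      simp [toForm_ιMulti_of_ne β (Ne.symm hk)]
    · intro h
      exact absurd (Finset.mem_range.2 (by omega)) h
  | zero => exact ⟨0, fun m _ => by simp⟩
  | add x y _ _ hx hy =>
    obtain ⟨N₁, h₁⟩ := hx
    obtain ⟨N₂, h₂⟩ := hy
    refine ⟨max N₁ N₂, fun m hm => ?_⟩
    rw [smul_add, h₁ m (le_of_max_le_left hm), h₂ m (le_of_max_le_right hm),
      ← Finset.sum_add_distrib]
    refine Finset.sum_congr rfl fun k _ => ?_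
    rw [← smul_add, ← Finset.sum_add_distrib]
    congr 1
    refine Finset.sum_congr rfl fun i _ => ?_
    rw [map_add, AlternatingMap.add_apply, add_smul]
  | smul f x _ hx =>
    obtain ⟨N, h⟩ := hx
    refine ⟨N, fun m hm => ?_⟩
    rw [smul_comm, h m hm, Finset.smul_sum]
    refine Finset.sum_congr rfl fun k _ => ?_
    rw [smul_comm, Finset.smul_sum]
    congr 1
    refine Finset.sum_congr rfl fun i _ => ?_
    rw [map_smul, AlternatingMap.smul_apply, smul_assoc]

theorem exists_pow_smul_eq_zero [Algebra ℝ R] {g h : R} (D : DualFrame β g)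
    {u : ExteriorAlgebra R L} (hu : ∀ k, h • toForm β k u = 0) :
    ∃ N : ℕ, (g ^ N * h) • u = 0 := by
  obtain ⟨N, hN⟩ := exists_pow_smul_eq D u
  refine ⟨N, ?_⟩
  rw [mul_comm, mul_smul, hN N le_rfl, Finset.smul_sum]
  refine Finset.sum_eq_zero fun k _ => ?_
  rw [smul_comm, Finset.smul_sum]
  have : ∀ i : Fin k → Fin D.n,
      h • toForm β k u (D.ε ∘ i) • ιMulti R k (D.e ∘ i) = 0 := fun i => by
    have h2 : h • toForm β k u (D.ε ∘ i) = 0 :=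
      congrArg (fun P : L' [⋀^Fin k]→ₗ[R] R => P (D.ε ∘ i)) (hu k)
    exact (smul_assoc h (toForm β k u (D.ε ∘ i)) (ιMulti R k (D.e ∘ i))).symm.trans
      (by rw [h2, zero_smul])
  simp [this]

theorem exists_representative [Algebra ℝ R] {g : R} (D : DualFrame β g) {k : ℕ}
    (P : L' [⋀^Fin k]→ₗ[R] R) :
    ∃ u : ExteriorAlgebra R L, toForm β k u = g ^ k • P ∧ ∀ n, n ≠ k → toForm β n u = 0 := by
  refine ⟨algebraMap ℝ R (k.factorial : ℝ)⁻¹ • ∑ i : Fin k → Fin D.n,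
    P (D.ε ∘ i) • ιMulti R k (D.e ∘ i), ?_, ?_⟩
  · have h1 : algebraMap ℝ R (k.factorial : ℝ)⁻¹ * (k.factorial : R) = 1 := by
      rw [← map_natCast (algebraMap ℝ R), ← map_mul, inv_mul_cancel₀, map_one]
      exact_mod_cast k.factorial_ne_zero
    rw [map_smul, map_sum]
    simp_rw [map_smul]
    rw [toForm_sum_smul, smul_smul, ← mul_assoc, h1, one_mul]
  · intro n hn
    rw [map_smul, map_sum]
    simp_rw [map_smul, toForm_ιMulti_of_ne β (Ne.symm hn)]
    simp

end Pairing

section Differential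

variable {R L : Type*} [CommRing R] [Algebra ℝ R] [AddCommGroup L] [Module ℝ L] [Module R L]
  [IsScalarTower ℝ R L] (A : LieRinehartStr R L) {k : ℕ}

theorem anchor_real_smul (r : ℝ) (X : L) (f : R) : A.anchor (r • X) f = r • A.anchor X f := by
  rw [← algebraMap_smul R r X, map_smul, Derivation.smul_apply, algebraMap_smul]

/-- An `R`-multilinear alternating form, regarded as an `ℝ`-multilinear one. -/
def realForm (P : L [⋀^Fin k]→ₗ[R] R) : L [⋀^Fin k]→ₗ[ℝ] R where
  toMultilinearMap := P.toMultilinearMap.restrictScalars ℝ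
  map_eq_zero_of_eq' := P.map_eq_zero_of_eq'

theorem realForm_apply (P : L [⋀^Fin k]→ₗ[R] R) (ξ : Fin k → L) : realForm P ξ = P ξ := rfl

/-- `X ↦ (ξ ↦ a(X)(P ξ))`. -/
noncomputable def anchorForm (P : L [⋀^Fin k]→ₗ[R] R) : L →ₗ[ℝ] L [⋀^Fin k]→ₗ[ℝ] R where
  toFun X := (A.anchor X : R →ₗ[ℝ] R).compAlternatingMap (realForm P)
  map_add' X Y := by ext ξ; simp
  map_smul' r X := by ext ξ; simp

theorem anchorForm_apply (P : L [⋀^Fin k]→ₗ[R] R) (X : L) (ξ : Fin k → L) :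
    A.anchorForm P X ξ = A.anchor X (P ξ) := rfl

theorem update_key (f : L →ₗ[ℝ] L) (ξ : Fin k → L) (l : Fin k) :
    (fun m => (if m = l then f else LinearMap.id) (ξ m)) = Function.update ξ l (f (ξ l)) := by
  ext m
  by_cases hm : m = l
  · subst hm; simp
  · simp [hm]

/-- `ξ ↦ ∑ⱼ P(ξ₁, …, f ξⱼ, …, ξₖ)`. -/
noncomputable def slotSum (P : L [⋀^Fin k]→ₗ[R] R) (f : L →ₗ[ℝ] L) : L [⋀^Fin k]→ₗ[ℝ] R where
  toMultilinearMap := ∑ j, (realForm P).toMultilinearMap.compLinearMap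
    (fun i => if i = j then f else LinearMap.id)
  map_eq_zero_of_eq' ξ i j h hij := by
    have hs : (∑ l, (realForm P).toMultilinearMap.compLinearMap
        (fun i => if i = l then f else LinearMap.id)) ξ =
        ∑ l, P (Function.update ξ l (f (ξ l))) := by
      rw [_root_.sum_apply]
      exact Finset.sum_congr rfl fun l _ => congrArg P (update_key f ξ l)
    refine hs.trans ?_
    rw [Fintype.sum_eq_add i j hij]
    · rw [← h]
      have h2 : Function.update ξ j (f (ξ i)) =
          Function.update ξ i (f (ξ i)) ∘ Equiv.swap i j := by
        ext m
        by_cases hm : m = j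
        · subst hm; simp
        · by_cases hm' : m = i
          · subst hm'
            simp [hij, hij.symm, h]
          · simp [hm, hm', Equiv.swap_apply_of_ne_of_ne]
      rw [h2, add_comm, P.map_swap_add _ hij]
    · rintro l ⟨hi, hj⟩
      exact P.map_eq_zero_of_eq _ (i := i) (j := j) (by simp [hi.symm, hj.symm, h]) hij

theorem slotSum_apply (P : L [⋀^Fin k]→ₗ[R] R) (f : L →ₗ[ℝ] L) (ξ : Fin k → L) :
    slotSum P f ξ = ∑ j, P (Function.update ξ j (f (ξ j))) := by
  change (∑ l, (realForm P).toMultilinearMap.compLinearMap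
        (fun i => if i = l then f else LinearMap.id)) ξ = _
  rw [_root_.sum_apply]
  exact Finset.sum_congr rfl fun l _ => congrArg P (update_key f ξ l)

/-- `(X, ξ) ↦ ∑ⱼ P(ξ₁, …, [X, ξⱼ], …, ξₖ)`. -/
noncomputable def bracketForm (P : L [⋀^Fin k]→ₗ[R] R) : L →ₗ[ℝ] L [⋀^Fin k]→ₗ[ℝ] R where
  toFun X := slotSum P (A.bracket X)
  map_add' X Y := by
    ext ξ
    simp only [slotSum_apply, AlternatingMap.add_apply, map_add, LinearMap.add_apply,
      AlternatingMap.map_update_add, Finset.sum_add_distrib]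
  map_smul' r X := by
    ext ξ
    simp only [slotSum_apply, AlternatingMap.smul_apply, map_smul, LinearMap.smul_apply,
      Finset.smul_sum, RingHom.id_apply]
    exact Finset.sum_congr rfl fun j _ => (realForm P).map_update_smul ξ j r _

theorem bracketForm_apply (P : L [⋀^Fin k]→ₗ[R] R) (X : L) (ξ : Fin k → L) :
    A.bracketForm P X ξ = ∑ j, P (Function.update ξ j (A.bracket X (ξ j))) := slotSum_apply _ _ _

/-- The real-multilinear form underlying the differential:
`ξ ↦ ∑ᵢ (-1)^i a(ξᵢ)(P(…ξ̂ᵢ…)) - 1/2 ∑ᵢ (-1)^i ∑ⱼ P(…ξ̂ᵢ…, [ξᵢ, ξⱼ], …)`, with `[ξᵢ, ξⱼ]` in the slot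
of `ξⱼ`. The factor `1/2` is there because the last sum runs over ordered pairs `(i, j)`, `i ≠ j`. -/
noncomputable def differentialReal (P : L [⋀^Fin k]→ₗ[R] R) : L [⋀^Fin (k + 1)]→ₗ[ℝ] R :=
  AlternatingMap.alternatizeUncurryFin (A.anchorForm P) -
    (1 / 2 : ℝ) • AlternatingMap.alternatizeUncurryFin (A.bracketForm P)

theorem differentialReal_apply (P : L [⋀^Fin k]→ₗ[R] R) (ξ : Fin (k + 1) → L) :
    A.differentialReal P ξ =
      ∑ i : Fin (k + 1), (-1 : ℤ) ^ (i : ℕ) • A.anchor (ξ i) (P (i.removeNth ξ)) -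
      (1 / 2 : ℝ) • ∑ i : Fin (k + 1), (-1 : ℤ) ^ (i : ℕ) • ∑ j,
        P (Function.update (i.removeNth ξ) j (A.bracket (ξ i) (i.removeNth ξ j))) := by
  rw [differentialReal, AlternatingMap.sub_apply, AlternatingMap.smul_apply,
    AlternatingMap.alternatizeUncurryFin_apply, AlternatingMap.alternatizeUncurryFin_apply]
  simp only [bracketForm_apply, anchorForm_apply]

theorem bracketForm_smul (P : L [⋀^Fin k]→ₗ[R] R) (f : R) (X : L) (ξ : Fin k → L) :
    A.bracketForm P (f • X) ξ = f • A.bracketForm P X ξ -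
      ∑ j, A.anchor (ξ j) f • P (Function.update ξ j X) := by
  rw [bracketForm_apply, bracketForm_apply, Finset.smul_sum, ← Finset.sum_sub_distrib]
  refine Finset.sum_congr rfl fun j _ => ?_
  rw [leibniz_left, AlternatingMap.map_update_sub, AlternatingMap.map_update_smul,
    AlternatingMap.map_update_smul]

/-- `L_X P` is `R`-linear in each slot; in the first one: -/
theorem bracketForm_cons_smul (P : L [⋀^Fin (k + 1)]→ₗ[R] R) (f : R) (X Y : L) (ξ : Fin k → L) :
    A.bracketForm P X (Fin.cons (f • Y) ξ) = f • A.bracketForm P X (Fin.cons Y ξ) +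
      A.anchor X f • P (Fin.cons Y ξ) := by
  rw [bracketForm_apply, bracketForm_apply, Fin.sum_univ_succ, Fin.sum_univ_succ]
  simp only [Fin.cons_zero, Fin.cons_succ, Fin.update_cons_zero, ← Fin.cons_update]
  have h1 : ∀ (f : R) (Y : L) (ξ : Fin k → L), P (Fin.cons (f • Y) ξ) = f • P (Fin.cons Y ξ) :=
    fun f Y ξ => by simpa using P.map_update_smul (Fin.cons Y ξ) 0 f Y
  have h2 : ∀ (Y Z : L) (ξ : Fin k → L),
      P (Fin.cons (Y + Z) ξ) = P (Fin.cons Y ξ) + P (Fin.cons Z ξ) :=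
    fun Y Z ξ => by simpa using P.map_update_add (Fin.cons Y ξ) 0 Y Z
  rw [A.leibniz, h2, h1, h1, smul_add, Finset.smul_sum]
  simp only [h1]
  abel

theorem differentialReal_cons_smul (P : L [⋀^Fin k]→ₗ[R] R) (f : R) (Y : L) (ξ : Fin k → L) :
    A.differentialReal P (Fin.cons (f • Y) ξ) = f • A.differentialReal P (Fin.cons Y ξ) := by
  have h0 : ∀ Z : L, A.differentialReal P (Fin.cons Z ξ) =
      (A.anchor Z (P ξ) - (1 / 2 : ℝ) • A.bracketForm P Z ξ) +
      ∑ i : Fin k, (-1) ^ ((i : ℕ) + 1) •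
        (A.anchor (ξ i) (P (i.succ.removeNth (Fin.cons Z ξ : Fin (k + 1) → L))) -
        (1 / 2 : ℝ) • A.bracketForm P (ξ i)
          (i.succ.removeNth (Fin.cons Z ξ : Fin (k + 1) → L))) := fun Z => by
    rw [differentialReal, AlternatingMap.sub_apply, AlternatingMap.smul_apply,
      AlternatingMap.alternatizeUncurryFin_apply, AlternatingMap.alternatizeUncurryFin_apply,
      Fin.sum_univ_succ, Fin.sum_univ_succ]
    simp only [anchorForm_apply, Fin.cons_zero, Fin.cons_succ, Fin.removeNth_zero, Fin.tail_cons,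
      Fin.val_zero, pow_zero, one_smul, Fin.val_succ, smul_add, smul_sub, Finset.smul_sum,
      Finset.sum_sub_distrib]
    simp only [smul_comm ((1 : ℝ) / 2) ((-1 : ℤ) ^ _)]
    abel
  rw [h0, h0]
  have h1 : ∀ i : Fin k, ∀ Z : L,
      (A.anchor (ξ i) (P (i.succ.removeNth (Fin.cons (f • Z) ξ : Fin (k + 1) → L))) -
        (1 / 2 : ℝ) • A.bracketForm P (ξ i)
          (i.succ.removeNth (Fin.cons (f • Z) ξ : Fin (k + 1) → L))) =
      f • (A.anchor (ξ i) (P (i.succ.removeNth (Fin.cons Z ξ : Fin (k + 1) → L))) -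
        (1 / 2 : ℝ) • A.bracketForm P (ξ i)
          (i.succ.removeNth (Fin.cons Z ξ : Fin (k + 1) → L))) +
      (1 / 2 : ℝ) • ((-1) ^ (i : ℕ) • A.anchor (ξ i) f • P (Function.update ξ i Z)) := by
    intro i Z
    obtain ⟨m, rfl⟩ : ∃ m, k = m + 1 := ⟨k - 1, by have := i.pos; omega⟩
    have h2 : ∀ Z : L, i.succ.removeNth (Fin.cons Z ξ : Fin (m + 2) → L) =
        Fin.cons Z (i.removeNth ξ) := fun Z => by
      ext j
      refine Fin.cases ?_ (fun j => ?_) j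
      · simp [Fin.removeNth]
      · simp [Fin.removeNth]
    have h3 : Function.update ξ i Z = i.insertNth Z (i.removeNth ξ) := by simp
    have h4 : (-1 : ℤ) ^ (i : ℕ) • P (Function.update ξ i Z) = P (Fin.cons Z (i.removeNth ξ)) := by
      rw [h3]; exact P.neg_one_pow_smul_map_insertNth i Z _
    have h5 : P (Fin.cons (f • Z) (i.removeNth ξ)) = f • P (Fin.cons Z (i.removeNth ξ)) := by
      simpa using P.map_update_smul (Fin.cons Z (i.removeNth ξ)) 0 f Z
    rw [h2, h2, bracketForm_cons_smul, h5, smul_comm ((-1 : ℤ) ^ _) (A.anchor (ξ i) f), h4,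
      smul_eq_mul f (P _), Derivation.leibniz]
    have h6 : ∀ a b : R, (1 / 2 : ℝ) • (f • a + b) = f • (1 / 2 : ℝ) • a + (1 / 2 : ℝ) • b :=
      fun a b => by rw [smul_add, smul_comm]
    rw [h6, smul_sub, smul_eq_mul (P _), smul_eq_mul (A.anchor _ _)]
    have h7 : ∀ x : R, x = (1 / 2 : ℝ) • x + (1 / 2 : ℝ) • x := fun x => by
      rw [← add_smul]; norm_num
    rw [mul_comm (P _) (A.anchor _ _)]
    linear_combination h7 (A.anchor (ξ i) f * P (Fin.cons Z (i.removeNth ξ)))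
  simp only [h1, smul_add, Finset.sum_add_distrib]
  rw [bracketForm_smul, map_smul, Derivation.smul_apply, smul_sub (1 / 2 : ℝ), smul_sub f,
    smul_comm (1 / 2 : ℝ) f, Finset.smul_sum, Finset.smul_sum]
  have h8 : ∀ i : Fin k, (-1 : ℤ) ^ ((i : ℕ) + 1) • (1 / 2 : ℝ) • (-1 : ℤ) ^ (i : ℕ) •
      A.anchor (ξ i) f • P (Function.update ξ i Y) =
      - ((1 / 2 : ℝ) • A.anchor (ξ i) f • P (Function.update ξ i Y)) := fun i => by
    rw [smul_comm (1 / 2 : ℝ), smul_smul, pow_succ, mul_neg_one, neg_mul, ← mul_pow]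
    simp
  simp only [h8, Finset.sum_neg_distrib, smul_comm f ((-1 : ℤ) ^ _)]
  abel

/-- The Lie algebroid differential of an alternating form `P` on `L`, by the Koszul formula
`dP(ξ₀, …, ξₖ) = ∑ᵢ (-1)^i a(ξᵢ)(P(…ξ̂ᵢ…)) + ∑_{i<j} (-1)^{i+j} P([ξᵢ, ξⱼ], …ξ̂ᵢ…ξ̂ⱼ…)`;
see `differential_apply_zero` and `differential_apply_succ`. -/
noncomputable def differential (P : L [⋀^Fin k]→ₗ[R] R) : L [⋀^Fin (k + 1)]→ₗ[R] R where
  toFun := A.differentialReal P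
  map_update_add' {hdec} ξ i X Y := by
    obtain rfl : hdec = instDecidableEqFin _ := Subsingleton.elim _ _
    exact (A.differentialReal P).map_update_add ξ i X Y
  map_update_smul' {hdec} ξ i f X := by
    obtain rfl : hdec = instDecidableEqFin _ := Subsingleton.elim _ _
    have h : ∀ Z : L, Function.update ξ i Z = i.insertNth Z (i.removeNth ξ) := fun Z => by simp
    rw [h, h, AlternatingMap.map_insertNth, AlternatingMap.map_insertNth]
    exact (congrArg _ (A.differentialReal_cons_smul P f X _)).trans (smul_comm _ _ _)
  map_eq_zero_of_eq' := (A.differentialReal P).map_eq_zero_of_eq'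

theorem differential_apply_zero (P : L [⋀^Fin 0]→ₗ[R] R) (ξ : Fin 1 → L) :
    A.differential P ξ = A.anchor (ξ 0) (P ![]) := by
  refine (A.differentialReal_apply P ξ).trans ?_
  simp [Matrix.empty_eq]

theorem differential_apply_succ (P : L [⋀^Fin (k + 1)]→ₗ[R] R) (ξ : Fin (k + 2) → L) :
    A.differential P ξ =
      ∑ i : Fin (k + 2), (-1 : ℤ) ^ (i : ℕ) • A.anchor (ξ i) (P (i.removeNth ξ)) +
      ∑ i : Fin (k + 2), ∑ j : Fin (k + 1), if i ≤ j.castSucc then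
        (-1 : ℤ) ^ (i + j.succ : ℕ) •
          P (Fin.cons (A.bracket (ξ i) (ξ j.succ)) (j.removeNth (i.removeNth ξ))) else 0 := by
  refine (A.differentialReal_apply P ξ).trans ?_
  set t : Fin (k + 2) × Fin (k + 1) → R := fun p => (-1 : ℤ) ^ (p.1 + p.2 : ℕ) •
    P (Fin.cons (A.bracket (ξ p.1) (ξ (p.1.succAbove p.2))) (p.2.removeNth (p.1.removeNth ξ)))
    with ht
  have h1 : ∀ (i : Fin (k + 2)) (j : Fin (k + 1)), (-1 : ℤ) ^ (i : ℕ) •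
      P (Function.update (i.removeNth ξ) j (A.bracket (ξ i) (i.removeNth ξ j))) = t (i, j) := by
    intro i j
    have h : Function.update (i.removeNth ξ) j (A.bracket (ξ i) (i.removeNth ξ j)) =
      j.insertNth (A.bracket (ξ i) (i.removeNth ξ j)) (j.removeNth (i.removeNth ξ)) := by simp
    rw [h, AlternatingMap.map_insertNth, smul_smul, ← pow_add]
    rfl
  simp only [Finset.smul_sum (r := ((-1 : ℤ) ^ _)), h1]
  have h2 : ∀ (i : Fin (k + 2)) (j : Fin (k + 1)),
      t (i.succAbove j, j.predAbove i) = t (i, j) := by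
    intro i j
    simp only [ht]
    rw [Fin.succAbove_succAbove_predAbove, ← Fin.removeNth_removeNth_eq_swap, A.bracket_neg (ξ _) (ξ i),
      Fin.neg_one_pow_succAbove_add_predAbove]
    have h3 : ∀ (Y : L) (ζ : Fin k → L), P (Fin.cons (-Y) ζ) = -P (Fin.cons Y ζ) :=
      fun Y ζ => by simpa using P.map_update_neg (Fin.cons Y ζ) 0 Y
    rw [h3, neg_smul, smul_neg, neg_neg]
  have h4 : ∑ p with p.2.castSucc < p.1, t p = ∑ p with p.1 ≤ p.2.castSucc, t p := by
    refine Finset.sum_bij' (fun p _ => (p.1.succAbove p.2, p.2.predAbove p.1))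
      (fun p _ => (p.1.succAbove p.2, p.2.predAbove p.1)) ?_ ?_ ?_ ?_ ?_
    · rintro ⟨i, j⟩ h
      simp only [Finset.mem_filter, Finset.mem_univ, true_and] at h ⊢
      rw [Fin.succAbove_of_castSucc_lt _ _ h, Fin.predAbove_of_castSucc_lt _ _ h]
      simp only [Fin.lt_def, Fin.le_def, Fin.val_castSucc, Fin.val_pred] at h ⊢
      omega
    · rintro ⟨i, j⟩ h
      simp only [Finset.mem_filter, Finset.mem_univ, true_and] at h ⊢
      rw [Fin.succAbove_of_le_castSucc _ _ h, Fin.predAbove_of_le_castSucc _ _ h]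
      simp only [Fin.lt_def, Fin.le_def, Fin.val_castSucc, Fin.val_succ, Fin.coe_castPred] at h ⊢
      omega
    · rintro ⟨i, j⟩ -
      simp [Fin.succAbove_succAbove_predAbove, Fin.predAbove_predAbove_succAbove]
    · rintro ⟨i, j⟩ -
      simp [Fin.succAbove_succAbove_predAbove, Fin.predAbove_predAbove_succAbove]
    · rintro ⟨i, j⟩ -
      exact (h2 i j).symm
  have h5 : ∑ i, ∑ j, t (i, j) = (2 : ℝ) • ∑ p with p.1 ≤ p.2.castSucc, t p := by
    rw [← Fintype.sum_prod_type, ← Finset.sum_filter_add_sum_filter_not Finset.univ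
      (fun p : Fin (k + 2) × Fin (k + 1) => p.1 ≤ p.2.castSucc)]
    simp only [not_le]
    rw [h4, two_smul]
  rw [h5, smul_smul, sub_eq_add_neg]
  congr 1
  rw [show (1 / 2 * 2 : ℝ) = 1 by norm_num, one_smul, Finset.sum_filter,
    Fintype.sum_prod_type, ← Finset.sum_neg_distrib]
  refine Finset.sum_congr rfl fun i _ => ?_
  rw [← Finset.sum_neg_distrib]
  refine Finset.sum_congr rfl fun j _ => ?_
  split_ifs with h
  · simp only [ht]
    rw [Fin.succAbove_of_le_castSucc _ _ h, Fin.val_succ, ← add_assoc, pow_succ, mul_neg_one,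
      neg_smul]
  · exact neg_zero

end Differential

end LieRinehartStr

open scoped Manifold ContDiff Topology
open Bundle

section Geometry

variable {E : Type*} [NormedAddCommGroup E] [NormedSpace ℝ E]
  {M : Type*} [TopologicalSpace M] [ChartedSpace E M]
  {F : Type*} [NormedAddCommGroup F] [NormedSpace ℝ F]
  {V : M → Type*} [TopologicalSpace (TotalSpace F V)] [∀ x, AddCommGroup (V x)]
  [∀ x, Module ℝ (V x)] [∀ x, TopologicalSpace (V x)] [FiberBundle F V] [VectorBundle ℝ F V]

/-- The product of a smooth section with a smooth function. -/
noncomputable instance sectionSMul :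
    SMul C^∞⟮𝓘(ℝ, E), M; ℝ⟯ Cₛ^∞⟮𝓘(ℝ, E); F, V⟯ where
  smul f s := ⟨fun x => f x • s x, f.contMDiff.smul_section s.contMDiff⟩

theorem section_smul_apply (f : C^∞⟮𝓘(ℝ, E), M; ℝ⟯) (s : Cₛ^∞⟮𝓘(ℝ, E); F, V⟯) (x : M) :
    (f • s) x = f x • s x := rfl

/-- The smooth sections form a module over the ring of smooth functions. -/
noncomputable instance sectionModule :
    Module C^∞⟮𝓘(ℝ, E), M; ℝ⟯ Cₛ^∞⟮𝓘(ℝ, E); F, V⟯ where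
  one_smul s := by ext x; exact one_smul ℝ (s x)
  mul_smul f g s := by ext x; exact mul_smul (f x) (g x) (s x)
  smul_zero f := by ext x; exact smul_zero (f x)
  smul_add f s t := by ext x; exact smul_add (f x) (s x) (t x)
  add_smul f g s := by ext x; exact add_smul (f x) (g x) (s x)
  zero_smul s := by ext x; exact zero_smul ℝ (s x)

instance sectionTower :
    IsScalarTower ℝ C^∞⟮𝓘(ℝ, E), M; ℝ⟯ Cₛ^∞⟮𝓘(ℝ, E); F, V⟯ where
  smul_assoc r f s := by ext x; exact smul_assoc r (f x) (s x)

/-- The function `a(X) f`, where `a : V → TM` is fibrewise linear. -/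
noncomputable def anchorAct (a : ∀ x, V x →ₗ[ℝ] TangentSpace 𝓘(ℝ, E) x)
    (X : Cₛ^∞⟮𝓘(ℝ, E); F, V⟯) (f : M → ℝ) (x : M) : ℝ :=
  mfderiv 𝓘(ℝ, E) 𝓘(ℝ, ℝ) f x (a x (X x))

variable (E F V) in
/-- A Lie algebroid structure on the smooth vector bundle `V` over `M`: a Lie bracket on the real
vector space of smooth sections and a smooth bundle map `anchor : V → TM` over the identity such
that `[X, f Y] = f [X, Y] + (a(X) f) Y` and `a([X, Y]) = [a(X), a(Y)]` (as vector fields acting on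
smooth functions). -/
structure LieAlgebroid [IsManifold 𝓘(ℝ, E) ∞ M] where
  bracket : Cₛ^∞⟮𝓘(ℝ, E); F, V⟯ →ₗ[ℝ] Cₛ^∞⟮𝓘(ℝ, E); F, V⟯ →ₗ[ℝ] Cₛ^∞⟮𝓘(ℝ, E); F, V⟯
  anchor : ∀ x, V x →ₗ[ℝ] TangentSpace 𝓘(ℝ, E) x
  contMDiff_anchor : ContMDiff (𝓘(ℝ, E).prod 𝓘(ℝ, F)) 𝓘(ℝ, E).tangent ∞
    (fun v : TotalSpace F V => (⟨v.proj, anchor v.proj v.2⟩ : TangentBundle 𝓘(ℝ, E) M))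
  bracket_self : ∀ X, bracket X X = 0
  jacobi : ∀ X Y Z, bracket X (bracket Y Z) = bracket (bracket X Y) Z + bracket Y (bracket X Z)
  leibniz : ∀ X (f : C^∞⟮𝓘(ℝ, E), M; ℝ⟯) Y x,
    bracket X (f • Y) x = f x • bracket X Y x + anchorAct anchor X f x • Y x
  anchor_bracket : ∀ X Y (f : C^∞⟮𝓘(ℝ, E), M; ℝ⟯) x, anchorAct anchor (bracket X Y) f x =
    anchorAct anchor X (anchorAct anchor Y f) x - anchorAct anchor Y (anchorAct anchor X f) x

namespace LieAlgebroid
variable [IsManifold 𝓘(ℝ, E) ∞ M] (A : LieAlgebroid E F V)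

theorem contMDiff_anchorAct (X : Cₛ^∞⟮𝓘(ℝ, E); F, V⟯) (f : C^∞⟮𝓘(ℝ, E), M; ℝ⟯) :
    ContMDiff 𝓘(ℝ, E) 𝓘(ℝ, ℝ) ∞ (anchorAct A.anchor X f) := by
  have h1 := A.contMDiff_anchor.comp X.contMDiff
  have h2 := (f.contMDiff.contMDiff_tangentMap (m := ∞) (by simp)).comp h1
  exact (contMDiff_snd_tangentBundle_modelSpace ℝ 𝓘(ℝ, ℝ)).comp h2

theorem mdiff (f : C^∞⟮𝓘(ℝ, E), M; ℝ⟯) (x : M) : MDifferentiableAt 𝓘(ℝ, E) 𝓘(ℝ, ℝ) f x :=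
  f.contMDiff.mdifferentiable (by simp) x

/-- The derivation `f ↦ a(X) f` of the ring of smooth functions, as a function of the section `X`. -/
noncomputable def anchorDeriv :
    Cₛ^∞⟮𝓘(ℝ, E); F, V⟯ →ₗ[C^∞⟮𝓘(ℝ, E), M; ℝ⟯]
      Derivation ℝ C^∞⟮𝓘(ℝ, E), M; ℝ⟯ C^∞⟮𝓘(ℝ, E), M; ℝ⟯ where
  toFun X := Derivation.mk'
    { toFun := fun f => ⟨anchorAct A.anchor X f, A.contMDiff_anchorAct X f⟩
      map_add' := fun f g => by
        ext x
        change mfderiv 𝓘(ℝ, E) 𝓘(ℝ, ℝ) (f + g : M → ℝ) x _ = _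
        rw [mfderiv_add (mdiff f x) (mdiff g x)]
        rfl
      map_smul' := fun r f => by
        ext x
        change mfderiv 𝓘(ℝ, E) 𝓘(ℝ, ℝ) (r • f : M → ℝ) x _ = _
        rw [const_smul_mfderiv (mdiff f x)]
        rfl }
    (fun f g => by
      ext x
      change mfderiv 𝓘(ℝ, E) 𝓘(ℝ, ℝ) (f * g : M → ℝ) x _ = _
      rw [((mdiff f x).hasMFDerivAt.mul (mdiff g x).hasMFDerivAt).mfderiv]
      rfl)
  map_add' X Y := by
    ext f x
    change mfderiv 𝓘(ℝ, E) 𝓘(ℝ, ℝ) f x (A.anchor x (X x + Y x)) = _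
    rw [map_add]
    exact map_add (mfderiv 𝓘(ℝ, E) 𝓘(ℝ, ℝ) f x) _ _
  map_smul' f X := by
    ext g x
    change mfderiv 𝓘(ℝ, E) 𝓘(ℝ, ℝ) g x (A.anchor x (f x • X x)) = _
    rw [map_smul]
    exact map_smul (mfderiv 𝓘(ℝ, E) 𝓘(ℝ, ℝ) g x) _ _

theorem anchorDeriv_apply (X : Cₛ^∞⟮𝓘(ℝ, E); F, V⟯) (f : C^∞⟮𝓘(ℝ, E), M; ℝ⟯) (x : M) :
    A.anchorDeriv X f x = anchorAct A.anchor X f x := rfl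

/-- The Lie--Rinehart structure on the module of smooth sections. -/
noncomputable def toLieRinehart :
    LieRinehartStr C^∞⟮𝓘(ℝ, E), M; ℝ⟯ Cₛ^∞⟮𝓘(ℝ, E); F, V⟯ where
  bracket := A.bracket
  anchor := A.anchorDeriv
  bracket_self := A.bracket_self
  jacobi := A.jacobi
  leibniz X f Y := by ext x; exact A.leibniz X f Y x
  anchor_bracket X Y f := by ext x; exact A.anchor_bracket X Y f x

end LieAlgebroid

section Frames

variable [FiniteDimensional ℝ E] [T2Space M] [IsManifold 𝓘(ℝ, E) ∞ M]

theorem exists_bump (x : M) {U : Set M} (hU : U ∈ 𝓝 x) :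
    ∃ θ : C^∞⟮𝓘(ℝ, E), M; ℝ⟯, (∀ᶠ y in 𝓝 x, θ y = 1) ∧ tsupport θ ⊆ U := by
  obtain ⟨f, -, hf⟩ := (SmoothBumpFunction.nhds_basis_tsupport (I := 𝓘(ℝ, E)) x).mem_iff.1 hU
  exact ⟨⟨f, f.contMDiff⟩, f.eventuallyEq_one, hf⟩

/-- A local frame, cut off by a function `χ` supported in a trivialising open set. -/
theorem exists_cutoff_frame [ContMDiffVectorBundle ∞ F V 𝓘(ℝ, E)] [FiniteDimensional ℝ F]
    {n : ℕ} (b : Module.Basis (Fin n) ℝ F) (x : M) (χ : C^∞⟮𝓘(ℝ, E), M; ℝ⟯)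
    (hχ : tsupport χ ⊆ (trivializationAt F V x).baseSet) :
    ∃ S : Fin n → Cₛ^∞⟮𝓘(ℝ, E); F, V⟯, (∀ y, χ y = 0 → ∀ i, S i y = 0) ∧
      ∀ y, χ y ≠ 0 → LinearIndependent ℝ (fun i => S i y) ∧
        Submodule.span ℝ (Set.range fun i => S i y) = ⊤ := by
  set e := trivializationAt F V x
  refine ⟨fun i => ⟨fun y => χ y • e.localFrame b i y, ?_⟩, ?_, ?_⟩
  · exact ContMDiffOn.smul_section_of_tsupport (u := e.baseSet) χ.contMDiff.contMDiffOn
      e.open_baseSet hχ (e.contMDiffOn_localFrame_baseSet ∞ b i)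
  · intro y hy i
    change χ y • e.localFrame b i y = 0
    rw [hy, zero_smul]
  · intro y hy
    have hyb : y ∈ e.baseSet := hχ (subset_tsupport _ hy)
    let c : Module.Basis (Fin n) ℝ (V y) :=
      (e.basisAt b hyb).unitsSMul (fun _ => Units.mk0 (χ y) hy)
    have hc : ∀ i, c i = χ y • e.localFrame b i y := fun i => by
      rw [e.localFrame_apply_of_mem_baseSet b hyb, Module.Basis.unitsSMul_apply]
      rfl
    have hc' : ⇑c = fun i => χ y • e.localFrame b i y := funext hc
    exact ⟨hc' ▸ c.linearIndependent, hc' ▸ c.span_eq⟩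

theorem exists_section_eq [ContMDiffVectorBundle ∞ F V 𝓘(ℝ, E)] [FiniteDimensional ℝ F]
    (x : M) (v : V x) : ∃ s : Cₛ^∞⟮𝓘(ℝ, E); F, V⟯, s x = v := by
  obtain ⟨χ, h1, h2⟩ := exists_bump (E := E) x ((trivializationAt F V x).open_baseSet.mem_nhds
    (FiberBundle.mem_baseSet_trivializationAt' x))
  obtain ⟨S, -, hS⟩ := exists_cutoff_frame (E := E) (V := V) (Module.finBasis ℝ F) x χ h2
  have hv : v ∈ Submodule.span ℝ (Set.range fun i => S i x) := by
    rw [(hS x (by rw [h1.self_of_nhds]; exact one_ne_zero)).2]; trivial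
  obtain ⟨c, hc⟩ := (Submodule.mem_span_range_iff_exists_fun ℝ).1 hv
  refine ⟨∑ i, c i • S i, ?_⟩
  rw [← hc]
  exact map_sum (⟨⟨fun s => s x, rfl⟩, fun _ _ => rfl⟩ : Cₛ^∞⟮𝓘(ℝ, E); F, V⟯ →+ V x) _ _

end Frames

section DualPairing

variable {F' : Type*} [NormedAddCommGroup F'] [NormedSpace ℝ F']
  {W : M → Type*} [TopologicalSpace (TotalSpace F' W)] [∀ x, AddCommGroup (W x)]
  [∀ x, Module ℝ (W x)] [∀ x, TopologicalSpace (W x)] [FiberBundle F' W] [VectorBundle ℝ F' W]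

variable (E F V F' W) in
/-- A duality between the vector bundles `V` and `W` over `M`, that is, an identification of `W` with
the dual bundle of `V` (and of `V` with the dual bundle of `W`): a smooth bilinear pairing of the
fibres which is nondegenerate on each fibre. Smoothness means that the pairing of two smooth sections
is a smooth function. -/
structure DualPairing where
  pairing : ∀ x, W x →ₗ[ℝ] V x →ₗ[ℝ] ℝ
  nondegenerate : ∀ x, (pairing x).Nondegenerate
  contMDiff_pairing : ∀ (ξ : Cₛ^∞⟮𝓘(ℝ, E); F', W⟯) (X : Cₛ^∞⟮𝓘(ℝ, E); F, V⟯),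
    ContMDiff 𝓘(ℝ, E) 𝓘(ℝ, ℝ) ∞ (fun x => pairing x (ξ x) (X x))

namespace DualPairing
variable (κ : DualPairing E F V F' W)

/-- The same duality, with the two bundles exchanged. -/
def flip : DualPairing E F' W F V where
  pairing x := (κ.pairing x).flip
  nondegenerate x := ⟨(κ.nondegenerate x).2, (κ.nondegenerate x).1⟩
  contMDiff_pairing ξ X := κ.contMDiff_pairing X ξ

/-- The pairing of smooth sections, with values in the smooth functions. -/
noncomputable def onSections : Cₛ^∞⟮𝓘(ℝ, E); F', W⟯ →ₗ[C^∞⟮𝓘(ℝ, E), M; ℝ⟯]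
    Cₛ^∞⟮𝓘(ℝ, E); F, V⟯ →ₗ[C^∞⟮𝓘(ℝ, E), M; ℝ⟯] C^∞⟮𝓘(ℝ, E), M; ℝ⟯ :=
  LinearMap.mk₂ _ (fun ξ X => ⟨fun x => κ.pairing x (ξ x) (X x), κ.contMDiff_pairing ξ X⟩)
    (fun ξ η X => by ext x; exact LinearMap.map_add₂ (κ.pairing x) (ξ x) (η x) (X x))
    (fun f ξ X => by ext x; exact LinearMap.map_smul₂ (κ.pairing x) (f x) (ξ x) (X x))
    (fun ξ X Y => by ext x; exact map_add (κ.pairing x (ξ x)) (X x) (Y x))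
    (fun f ξ X => by ext x; exact map_smul (κ.pairing x (ξ x)) (f x) (X x))

theorem onSections_apply (ξ : Cₛ^∞⟮𝓘(ℝ, E); F', W⟯) (X : Cₛ^∞⟮𝓘(ℝ, E); F, V⟯) (x : M) :
    κ.onSections ξ X x = κ.pairing x (ξ x) (X x) := rfl

variable [FiniteDimensional ℝ E] [T2Space M] [IsManifold 𝓘(ℝ, E) ∞ M]
  [FiniteDimensional ℝ F] [ContMDiffVectorBundle ∞ F V 𝓘(ℝ, E)]
  [FiniteDimensional ℝ F'] [ContMDiffVectorBundle ∞ F' W 𝓘(ℝ, E)]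

theorem finrank_eq (κ : DualPairing E F V F' W) (x : M) : Module.finrank ℝ F' = Module.finrank ℝ F := by
  have e := (trivializationAt F V x).linearEquivAt (R := ℝ) x
    (FiberBundle.mem_baseSet_trivializationAt' x)
  have e' := (trivializationAt F' W x).linearEquivAt (R := ℝ) x
    (FiberBundle.mem_baseSet_trivializationAt' x)
  have : FiniteDimensional ℝ (V x) := e.symm.finiteDimensional
  have : FiniteDimensional ℝ (W x) := e'.symm.finiteDimensional
  rw [← e.finrank_eq, ← e'.finrank_eq]
  apply le_antisymm
  · exact (LinearMap.finrank_le_finrank_of_injective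
      (LinearMap.ker_eq_bot.1 (LinearMap.separatingLeft_iff_ker_eq_bot.1
        (κ.nondegenerate x).1))).trans Subspace.dual_finrank_eq.le
  · exact (LinearMap.finrank_le_finrank_of_injective
      (LinearMap.ker_eq_bot.1 (LinearMap.separatingRight_iff_flip_ker_eq_bot.1
        (κ.nondegenerate x).2))).trans Subspace.dual_finrank_eq.le

theorem section_ext {ξ η : Cₛ^∞⟮𝓘(ℝ, E); F', W⟯}
    (h : ∀ X : Cₛ^∞⟮𝓘(ℝ, E); F, V⟯, κ.onSections ξ X = κ.onSections η X) : ξ = η := by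
  ext x
  refine sub_eq_zero.1 ((κ.nondegenerate x).1 _ fun v => ?_)
  obtain ⟨X, rfl⟩ := exists_section_eq (E := E) (F := F) x v
  have := congrArg (fun f : C^∞⟮𝓘(ℝ, E), M; ℝ⟯ => f x) (h X)
  simp only [onSections_apply] at this
  rw [map_sub, LinearMap.sub_apply, this, sub_self]

theorem exists_dualFrame (x : M) : ∃ g h : C^∞⟮𝓘(ℝ, E), M; ℝ⟯, h x = 1 ∧ h * g = h ∧
    Nonempty (LieRinehartStr.DualFrame κ.onSections g) := by
  classical
  have hU : (trivializationAt F V x).baseSet ∩ (trivializationAt F' W x).baseSet ∈ 𝓝 x :=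
    Filter.inter_mem
      ((trivializationAt F V x).open_baseSet.mem_nhds (FiberBundle.mem_baseSet_trivializationAt' x))
      ((trivializationAt F' W x).open_baseSet.mem_nhds (FiberBundle.mem_baseSet_trivializationAt' x))
  obtain ⟨χ, hχ1, hχ⟩ := exists_bump (E := E) x hU
  obtain ⟨n, hn⟩ : ∃ n, Module.finrank ℝ F = n := ⟨_, rfl⟩
  obtain ⟨S, hS0, hS⟩ := exists_cutoff_frame (E := E) (V := V)
    (Module.finBasisOfFinrankEq ℝ F hn) x χ
    (hχ.trans Set.inter_subset_left)
  obtain ⟨T, hT0, hT⟩ := exists_cutoff_frame (E := E) (V := W)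
    (Module.finBasisOfFinrankEq ℝ F' ((κ.finrank_eq x).trans hn)) x χ (hχ.trans Set.inter_subset_right)
  let K : Matrix (Fin n) (Fin n) C^∞⟮𝓘(ℝ, E), M; ℝ⟯ := Matrix.of fun j l => κ.onSections (T j) (S l)
  have hev : ∀ y, K.det y = Matrix.det (Matrix.of fun j l => κ.pairing y (T j y) (S l y)) :=
    fun y => by
      have := RingHom.map_det (ContMDiffMap.evalRingHom (I := 𝓘(ℝ, E)) (n := ∞) y) K
      exact this
  have hdet : ∀ y, χ y ≠ 0 → K.det y ≠ 0 := by
    intro y hy h0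
    rw [hev, ← Matrix.exists_mulVec_eq_zero_iff] at h0
    obtain ⟨v, hv, hKv⟩ := h0
    apply hv
    have h1 : ∑ l, v l • S l y = 0 := by
      refine (κ.nondegenerate y).2 _ fun ζ => ?_
      have hζ : ζ ∈ Submodule.span ℝ (Set.range fun i => T i y) := by
        rw [(hT y hy).2]; trivial
      induction hζ using Submodule.span_induction with
      | mem z hz =>
        obtain ⟨j, rfl⟩ := hz
        have := congrFun hKv j
        simp only [Matrix.mulVec, dotProduct, Matrix.of_apply, Pi.zero_apply] at this
        rw [map_sum, ← this]
        exact Finset.sum_congr rfl fun l _ => by rw [map_smul, smul_eq_mul, mul_comm]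
      | zero => simp
      | add a b _ _ ha hb => rw [map_add, LinearMap.add_apply, ha, hb, add_zero]
      | smul c a _ ha => rw [map_smul, LinearMap.smul_apply, ha, smul_zero]
    exact funext fun l => Fintype.linearIndependent_iff.1 (hS y hy).1 v h1 l
  -- the unnormalised frame
  let ε : Fin n → Cₛ^∞⟮𝓘(ℝ, E); F', W⟯ := fun i => ∑ j, K.adjugate i j • T j
  have hεS : ∀ i l, κ.onSections (ε i) (S l) = if i = l then K.det else 0 := by
    intro i l
    have h1 : κ.onSections (ε i) (S l) = (K.adjugate * K) i l := by
      simp only [ε, map_sum, LinearMap.sum_apply, map_smul, LinearMap.smul_apply, smul_eq_mul,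
        Matrix.mul_apply]
      rfl
    rw [h1, Matrix.adjugate_mul, Matrix.smul_apply, Matrix.one_apply]
    simp
  have hleft : ∀ X : Cₛ^∞⟮𝓘(ℝ, E); F, V⟯, ∀ y, χ y ≠ 0 →
      K.det y • X y = ∑ i, κ.onSections (ε i) X y • S i y := by
    intro X y hy
    have hX : X y ∈ Submodule.span ℝ (Set.range fun i => S i y) := by
      rw [(hS y hy).2]; trivial
    obtain ⟨c, hc⟩ := (Submodule.mem_span_range_iff_exists_fun ℝ).1 hX
    have h1 : ∀ i, κ.onSections (ε i) X y = K.det y * c i := by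
      intro i
      rw [onSections_apply, ← hc, map_sum]
      have h2 : ∀ l, κ.pairing y (ε i y) (c l • S l y) = if i = l then K.det y * c l else 0 := by
        intro l
        have := congrArg (fun f : C^∞⟮𝓘(ℝ, E), M; ℝ⟯ => f y) (hεS i l)
        simp only [onSections_apply] at this
        rw [map_smul, this]
        split_ifs with h
        · exact mul_comm _ _
        · exact mul_zero _
      rw [Finset.sum_congr rfl fun l _ => h2 l]
      simp
    simp_rw [h1, mul_smul]
    rw [← Finset.smul_sum, hc]
  -- normalisation
  have hx : χ x ≠ 0 := by rw [hχ1.self_of_nhds]; exact one_ne_zero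
  have hopen : {y | χ y ≠ 0} ∈ 𝓝 x :=
    (isOpen_ne.preimage χ.contMDiff.continuous).mem_nhds hx
  obtain ⟨θ, hθ1, hθ⟩ := exists_bump (E := E) x hopen
  obtain ⟨h, hh1, hh⟩ := exists_bump (E := E) x hθ1
  let ψ : C^∞⟮𝓘(ℝ, E), M; ℝ⟯ := ⟨fun y => θ y * (K.det y)⁻¹, by
    refine contMDiff_of_tsupport fun y hy => ?_
    have hy' : χ y ≠ 0 := hθ ((tsupport_mul_subset_left) hy)
    exact θ.contMDiff.contMDiffAt.mul
      ((K.det.contMDiff.contMDiffAt).inv₀ (hdet y hy'))⟩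
  have hL : ∀ X : Cₛ^∞⟮𝓘(ℝ, E); F, V⟯, θ • X = ∑ i, κ.onSections (ε i) X • ψ • S i := by
    intro X
    ext y
    have h1 : (∑ i, κ.onSections (ε i) X • ψ • S i) y =
        ∑ i, κ.onSections (ε i) X y • ψ y • S i y :=
      map_sum (⟨⟨fun s => s y, rfl⟩, fun _ _ => rfl⟩ : Cₛ^∞⟮𝓘(ℝ, E); F, V⟯ →+ V y) _ _
    rw [h1, section_smul_apply]
    simp_rw [smul_comm _ (ψ y)]
    rw [← Finset.smul_sum]
    by_cases hy : χ y = 0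
    · have hθy : θ y = 0 := by
        by_contra h0
        exact hθ (subset_tsupport _ h0) hy
      have hψ : ψ y = 0 := by
        change θ y * _ = 0
        rw [hθy, zero_mul]
      rw [hθy, hψ, zero_smul, zero_smul]
    · rw [← hleft X y hy, smul_smul]
      congr 1
      change _ = θ y * (K.det y)⁻¹ * _
      rw [mul_assoc, inv_mul_cancel₀ (hdet y hy), mul_one]
  refine ⟨θ, h, hh1.self_of_nhds, ?_, ⟨⟨n, fun i => ψ • S i, ε, hL, fun ξ => ?_⟩⟩⟩
  · ext y
    by_cases hy : h y = 0
    · change h y * _ = h y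
      rw [hy, zero_mul]
    · have : θ y = 1 := hh (subset_tsupport _ hy)
      change h y * θ y = h y
      rw [this, mul_one]
  · refine κ.section_ext fun X => ?_
    rw [map_smul, LinearMap.smul_apply, ← map_smul, hL X, map_sum, map_sum, LinearMap.sum_apply]
    refine Finset.sum_congr rfl fun i _ => ?_
    rw [map_smul, map_smul (κ.onSections), LinearMap.smul_apply, smul_eq_mul, smul_eq_mul, mul_comm]

end DualPairing
end DualPairing
end Geometry

section LieBialgebroid

open LieRinehartStr

variable {E : Type*} [NormedAddCommGroup E] [NormedSpace ℝ E] [FiniteDimensional ℝ E]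
  {M : Type*} [TopologicalSpace M] [ChartedSpace E M] [IsManifold 𝓘(ℝ, E) ∞ M] [T2Space M]
  {F : Type*} [NormedAddCommGroup F] [NormedSpace ℝ F] [FiniteDimensional ℝ F]
  {V : M → Type*} [TopologicalSpace (TotalSpace F V)] [∀ x, AddCommGroup (V x)]
  [∀ x, Module ℝ (V x)] [∀ x, TopologicalSpace (V x)] [FiberBundle F V] [VectorBundle ℝ F V]
  [ContMDiffVectorBundle ∞ F V 𝓘(ℝ, E)]
  {F' : Type*} [NormedAddCommGroup F'] [NormedSpace ℝ F'] [FiniteDimensional ℝ F']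
  {W : M → Type*} [TopologicalSpace (TotalSpace F' W)] [∀ x, AddCommGroup (W x)]
  [∀ x, Module ℝ (W x)] [∀ x, TopologicalSpace (W x)] [FiberBundle F' W] [VectorBundle ℝ F' W]
  [ContMDiffVectorBundle ∞ F' W 𝓘(ℝ, E)]

variable (E F' W) in
/-- `Γ(⋀ᵏ V)`, for a bundle `V` whose dual is `W`: the alternating `k`-forms on `Γ(W)` that are
multilinear over the smooth functions. -/
abbrev Multisection (k : ℕ) : Type _ :=
  Cₛ^∞⟮𝓘(ℝ, E); F', W⟯ [⋀^Fin k]→ₗ[C^∞⟮𝓘(ℝ, E), M; ℝ⟯] C^∞⟮𝓘(ℝ, E), M; ℝ⟯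

/-- The element `u` of the exterior algebra of `Γ(V)` over the smooth functions coincides with the
multisection `P` of degree `k` near `x`: its component of degree `k` agrees with `P`, and its other
components vanish, wherever some smooth function `h` with `h x ≠ 0` does not vanish. -/
def RepresentsAt (κ : DualPairing E F V F' W) (x : M) {k : ℕ} (P : Multisection E F' W k)
    (u : ExteriorAlgebra C^∞⟮𝓘(ℝ, E), M; ℝ⟯ Cₛ^∞⟮𝓘(ℝ, E); F, V⟯) : Prop :=
  ∃ h : C^∞⟮𝓘(ℝ, E), M; ℝ⟯, h x ≠ 0 ∧ h • toForm κ.onSections k u = h • P ∧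
    ∀ n, n ≠ k → h • toForm κ.onSections n u = 0

theorem exists_representsAt (κ : DualPairing E F V F' W) (x : M) {k : ℕ}
    (P : Multisection E F' W k) : ∃ u, RepresentsAt κ x P u := by
  obtain ⟨g, h, hx, hg, ⟨D⟩⟩ := κ.exists_dualFrame x
  obtain ⟨u, hu, hu'⟩ := exists_representative D P
  have hpow : ∀ m : ℕ, h * g ^ m = h := fun m => by
    induction m with
    | zero => rw [pow_zero, mul_one]
    | succ m ih => rw [pow_succ, ← mul_assoc, ih, hg]
  exact ⟨u, h, by rw [hx]; exact one_ne_zero, by rw [hu, smul_smul, hpow],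
    fun n hn => by rw [hu' n hn, smul_zero]⟩

theorem RepresentsAt.eventually {κ : DualPairing E F V F' W} {x : M} {k : ℕ}
    {P : Multisection E F' W k} {u} (hu : RepresentsAt κ x P u) :
    ∀ᶠ y in 𝓝 x, RepresentsAt κ y P u := by
  obtain ⟨h, hx, h1, h2⟩ := hu
  filter_upwards [(isOpen_ne.preimage h.contMDiff.continuous).mem_nhds hx] with y hy
  exact ⟨h, hy, h1, h2⟩

theorem RepresentsAt.exists_smul_eq {κ : DualPairing E F V F' W} {x : M} {k : ℕ}
    {P : Multisection E F' W k} {u u'} (hu : RepresentsAt κ x P u) (hu' : RepresentsAt κ x P u') :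
    ∃ r : C^∞⟮𝓘(ℝ, E), M; ℝ⟯, r x ≠ 0 ∧ r • (u - u') = 0 := by
  obtain ⟨h, hx, h1, h2⟩ := hu
  obtain ⟨h', hx', h1', h2'⟩ := hu'
  obtain ⟨g, t, ht, htg, ⟨D⟩⟩ := κ.exists_dualFrame x
  have hgx : g x ≠ 0 := by
    intro h0
    have := congrArg (fun f : C^∞⟮𝓘(ℝ, E), M; ℝ⟯ => f x) htg
    change t x * g x = t x at this
    rw [h0, ht, mul_zero] at this
    exact zero_ne_one this
  obtain ⟨N, hN⟩ := exists_pow_smul_eq_zero (h := h * h') (u := u - u') D fun n => by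
    rw [map_sub, smul_sub]
    by_cases hn : n = k
    · subst hn
      rw [mul_comm, mul_smul, h1, mul_comm, mul_smul, h1', smul_comm, sub_self]
    · rw [mul_comm, mul_smul, h2 n hn, mul_comm, mul_smul, h2' n hn, smul_zero, smul_zero, sub_zero]
  refine ⟨_, ?_, hN⟩
  change (g ^ N) x * (h x * h' x) ≠ 0
  rw [ContMDiffMap.coe_pow]
  exact mul_ne_zero (pow_ne_zero _ hgx) (mul_ne_zero hx hx')

theorem eval_eq_of_smul_sub_eq_zero (κ : DualPairing E F V F' W) {x : M}
    {r : C^∞⟮𝓘(ℝ, E), M; ℝ⟯} (hr : r x ≠ 0)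
    {w w' : ExteriorAlgebra C^∞⟮𝓘(ℝ, E), M; ℝ⟯ Cₛ^∞⟮𝓘(ℝ, E); F, V⟯} (h : r • (w - w') = 0)
    (n : ℕ) (ξ : Fin n → Cₛ^∞⟮𝓘(ℝ, E); F', W⟯) :
    toForm κ.onSections n w ξ x = toForm κ.onSections n w' ξ x := by
  have h1 : toForm κ.onSections n (r • (w - w')) ξ x = 0 := by rw [h, map_zero]; rfl
  rw [map_smul, map_sub] at h1
  change r x * (toForm κ.onSections n w ξ x - toForm κ.onSections n w' ξ x) = 0 at h1
  exact sub_eq_zero.1 ((mul_eq_zero.1 h1).resolve_left hr)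

/-- The value of the Schouten bracket at `x` depends only on the multisections near `x`. -/
theorem schoutenAlg_wellDefined (A : LieAlgebroid E F V) (κ : DualPairing E F V F' W) {x : M}
    {p q : ℕ} {P : Multisection E F' W p} {Q : Multisection E F' W q} {u u' v v'}
    (hu : RepresentsAt κ x P u) (hu' : RepresentsAt κ x P u')
    (hv : RepresentsAt κ x Q v) (hv' : RepresentsAt κ x Q v')
    (n : ℕ) (ξ : Fin n → Cₛ^∞⟮𝓘(ℝ, E); F', W⟯) :
    toForm κ.onSections n (A.toLieRinehart.schoutenAlg u v) ξ x =
      toForm κ.onSections n (A.toLieRinehart.schoutenAlg u' v') ξ x := by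
  obtain ⟨r, hr, hr0⟩ := hu.exists_smul_eq hu'
  obtain ⟨s, hs, hs0⟩ := hv.exists_smul_eq hv'
  have h1 := A.toLieRinehart.schoutenAlg_local_left hr0 v
  have h2 := A.toLieRinehart.schoutenAlg_local_right hs0 u'
  have h3 := A.toLieRinehart.schoutenAlg_add_left (u - u') u' v
  have h4 := A.toLieRinehart.schoutenAlg_add_right u' (v - v') v'
  rw [sub_add_cancel] at h3 h4
  rw [← sub_eq_iff_eq_add] at h3 h4
  rw [← h3] at h1
  rw [← h4] at h2
  exact (eval_eq_of_smul_sub_eq_zero κ (mul_ne_zero hr hr) h1 n ξ).trans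
    (eval_eq_of_smul_sub_eq_zero κ (mul_ne_zero hs hs) h2 n ξ)

/-- The Schouten bracket on `Γ(⋀ V)` extending the Lie algebroid structure `A` on `V`. Its value at
`x` is that of the bracket of any two elements of the exterior algebra of `Γ(V)` which represent `P`
and `Q` near `x` (see `schouten_apply`). The component of degree `n` of `[P, Q]` is
`schouten A κ P Q n`; for `P`, `Q` of degrees `p`, `q` it is zero unless `n + 1 = p + q`. -/
noncomputable def schouten (A : LieAlgebroid E F V) (κ : DualPairing E F V F' W) {p q : ℕ}
    (P : Multisection E F' W p) (Q : Multisection E F' W q) (n : ℕ) : Multisection E F' W n where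
  toFun ξ := ⟨fun x => toForm κ.onSections n (A.toLieRinehart.schoutenAlg
      (exists_representsAt κ x P).choose (exists_representsAt κ x Q).choose) ξ x, fun x => by
    have hu := (exists_representsAt κ x P).choose_spec
    have hv := (exists_representsAt κ x Q).choose_spec
    refine (toForm κ.onSections n (A.toLieRinehart.schoutenAlg
      (exists_representsAt κ x P).choose (exists_representsAt κ x Q).choose)
      ξ).contMDiff.contMDiffAt.congr_of_eventuallyEq ?_
    filter_upwards [hu.eventually, hv.eventually] with y hy hy'
    exact schoutenAlg_wellDefined A κ (exists_representsAt κ y P).choose_spec hy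
      (exists_representsAt κ y Q).choose_spec hy' n ξ⟩
  map_update_add' ξ i a b := by
    ext x
    have h₀ := congrArg (fun f : C^∞⟮𝓘(ℝ, E), M; ℝ⟯ => f x)
      ((toForm κ.onSections n (A.toLieRinehart.schoutenAlg (exists_representsAt κ x P).choose
        (exists_representsAt κ x Q).choose)).map_update_add' ξ i a b)
    exact h₀
  map_update_smul' ξ i f a := by
    ext x
    have h₀ := congrArg (fun f : C^∞⟮𝓘(ℝ, E), M; ℝ⟯ => f x)
      ((toForm κ.onSections n (A.toLieRinehart.schoutenAlg (exists_representsAt κ x P).choose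
        (exists_representsAt κ x Q).choose)).map_update_smul' ξ i f a)
    exact h₀
  map_eq_zero_of_eq' ξ i j h hij := by
    ext x
    have h₀ := congrArg (fun f : C^∞⟮𝓘(ℝ, E), M; ℝ⟯ => f x)
      ((toForm κ.onSections n (A.toLieRinehart.schoutenAlg (exists_representsAt κ x P).choose
        (exists_representsAt κ x Q).choose)).map_eq_zero_of_eq' ξ i j h hij)
    exact h₀

theorem schouten_apply (A : LieAlgebroid E F V) (κ : DualPairing E F V F' W) {x : M}
    {p q : ℕ} {P : Multisection E F' W p} {Q : Multisection E F' W q} {u v}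
    (hu : RepresentsAt κ x P u) (hv : RepresentsAt κ x Q v)
    (n : ℕ) (ξ : Fin n → Cₛ^∞⟮𝓘(ℝ, E); F', W⟯) :
    schouten A κ P Q n ξ x = toForm κ.onSections n (A.toLieRinehart.schoutenAlg u v) ξ x :=
  schoutenAlg_wellDefined A κ (exists_representsAt κ x P).choose_spec hu
    (exists_representsAt κ x Q).choose_spec hv n ξ

/-- The differential of an element `∑ₙ Tₙ` of `⨁ₙ Γ(⋀ⁿ V)` which comes from the Lie algebroid
structure `B` on the dual `W` of `V`. -/
noncomputable def LieAlgebroid.totalDifferential (B : LieAlgebroid E F' W)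
    (T : ∀ n, Multisection E F' W n) : ∀ n, Multisection E F' W n
  | 0 => 0
  | n + 1 => B.toLieRinehart.differential (T n)

/-- `(V, W)` is a Lie bialgebroid, where `W` is regarded as the dual of `V` through `κ`: the
differential `d_*` on `Γ(⋀ V)` coming from the structure `B` on `W` is a derivation of the Schouten
bracket on `Γ(⋀ V)` that extends the structure `A` on `V`, that is,
`d_*[P, Q] = [d_* P, Q] + (-1)^{p-1} [P, d_* Q]` for `P ∈ Γ(⋀ᵖ V)` and `Q ∈ Γ(⋀^q V)`. -/
def IsLieBialgebroid (A : LieAlgebroid E F V) (B : LieAlgebroid E F' W)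
    (κ : DualPairing E F V F' W) : Prop :=
  ∀ (p q : ℕ) (P : Multisection E F' W p) (Q : Multisection E F' W q),
    B.totalDifferential (schouten A κ P Q) =
      schouten A κ (B.toLieRinehart.differential P) Q +
        (-1 : ℤ) ^ (p + 1) • schouten A κ P (B.toLieRinehart.differential Q)

end LieBialgebroid

set_option linter.unusedSectionVars false

/-! Let a, b be the anchors of the structures `A` on V and `B` on W, let d and d_* be the
differentials coming from `A` and `B`, and write L_X, L_ξ for the Lie derivatives, also on the dual
bundles. The differential and the Schouten bracket both obey graded Leibniz rules, so the derivation
property holds for all multisections as soon as it holds for functions and sections. There it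
amounts to three identities between functions, collected in `IsCompatible`: a(d_*f)g + a(d_*g)f = 0;
the rule for d_*(a(X)f), paired with ξ; and d_*[X, Y] = L_X d_*Y - L_Y d_*X, evaluated on (ξ, η).
The theorem is that these three together are symmetric in the two structures (`IsCompatible.symm`).

The first is symmetric because b(df)g = ⟨df, d_*g⟩ = a(d_*g)f. By Cartan's formula for d_*X, the
second becomes b(ξ)a(X)f - a(X)b(ξ)f + b(L_X ξ)f - a(L_ξ X)f = -a(d_*⟨ξ, X⟩)f. Exchanging the
structures changes the sign of the left side, and that of the right side by the first identity. When
the third and its mirror image are expanded by Cartan's formula, they differ by a signed sum of four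
instances of the second and two of the first.

The rest of the work is to pass between multisections, which are alternating forms, and the exterior
algebra of the module of sections, in which the Schouten bracket is computed. The two are compared
only near a point, so d_* on the exterior algebra is treated as a relation that holds up to a factor
not vanishing there (`IsDifferentialNear`). Local dual frames make it total and single-valued up to
such factors. Cartan's formula i_ξ d_* = L_ξ - d_* i_ξ gives its Leibniz rule by induction on the
degree (`differential_toForm_ι_mul`, `IsDifferentialNear.mul`), and `IsCompatibleNear.schoutenAlg`
extends the derivation property from generators to everything. The two directions of the equivalence
with `IsCompatible` are `IsLieBialgebroid.isCompatible` and `isLieBialgebroid_of_isCompatible`. -/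

namespace LieRinehartStr

open ExteriorAlgebra

/-! ### Grade involution, contractions and derivations of an exterior algebra -/

section Exterior

variable {R L : Type*} [CommRing R] [AddCommGroup L] [Module R L]

theorem exterior_induction {C : ExteriorAlgebra R L → Prop} (u : ExteriorAlgebra R L)
    (algebraMap : ∀ r : R, C (algebraMap R _ r)) (add : ∀ u v, C u → C v → C (u + v))
    (ι_mul : ∀ X w, C w → C (ι R X * w)) : C u :=
  CliffordAlgebra.left_induction (0 : QuadraticForm R L) (P := C) algebraMap add
    (fun w X h => ι_mul X w h) u

/-- The grade involution `u ↦ (-1)^{|u|} u`. -/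
noncomputable def gradeInv : ExteriorAlgebra R L →ₐ[R] ExteriorAlgebra R L :=
  CliffordAlgebra.involute

theorem gradeInv_ι (X : L) : gradeInv (ι R X) = -ι R X := CliffordAlgebra.involute_ι _

theorem gradeInv_algebraMap (r : R) :
    gradeInv (algebraMap R (ExteriorAlgebra R L) r) = algebraMap R _ r := AlgHom.commutes _ _

theorem gradeInv_gradeInv (u : ExteriorAlgebra R L) : gradeInv (gradeInv u) = u :=
  CliffordAlgebra.involute_involute u

theorem gradeInv_ι_mul (X : L) (u : ExteriorAlgebra R L) :
    gradeInv (ι R X * u) = -(ι R X * gradeInv u) := by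
  rw [map_mul, gradeInv_ι, neg_mul]

theorem ι_mul_gradeInv (X : L) (u : ExteriorAlgebra R L) :
    ι R X * u = gradeInv u * ι R X := ι_mul_eq X u

theorem gradeInv_mul_ι (X : L) (u : ExteriorAlgebra R L) :
    gradeInv u * ι R X = ι R X * u := (ι_mul_eq X u).symm

theorem mul_ι (X : L) (u : ExteriorAlgebra R L) :
    u * ι R X = ι R X * gradeInv u := by
  rw [ι_mul_gradeInv, gradeInv_gradeInv]

theorem ι_mul_ι_swap (X Y : L) : ι R X * ι R Y = -(ι R Y * ι R X) :=
  eq_neg_of_add_eq_zero_left (ι_add_mul_swap X Y)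

/-- Contraction with a linear form. -/
noncomputable def contr (φ : Module.Dual R L) : ExteriorAlgebra R L →ₗ[R] ExteriorAlgebra R L :=
  CliffordAlgebra.contractLeft φ

theorem contr_ι_mul (φ : Module.Dual R L) (X : L) (u : ExteriorAlgebra R L) :
    contr φ (ι R X * u) = φ X • u - ι R X * contr φ u :=
  CliffordAlgebra.contractLeft_ι_mul _ _ _

theorem contr_algebraMap (φ : Module.Dual R L) (r : R) :
    contr φ (algebraMap R (ExteriorAlgebra R L) r) = 0 :=
  CliffordAlgebra.contractLeft_algebraMap _ _ _

theorem contr_ι (φ : Module.Dual R L) (X : L) :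
    contr φ (ι R X) = algebraMap R (ExteriorAlgebra R L) (φ X) :=
  CliffordAlgebra.contractLeft_ι _ _ _

theorem contr_gradeInv (φ : Module.Dual R L) (u : ExteriorAlgebra R L) :
    contr φ (gradeInv u) = -gradeInv (contr φ u) := by
  induction u using exterior_induction with
  | algebraMap r => rw [gradeInv_algebraMap, contr_algebraMap, map_zero, neg_zero]
  | add u v hu hv => rw [map_add, map_add, map_add, map_add, hu, hv]; abel
  | ι_mul X w h =>
    rw [gradeInv_ι_mul, map_neg, contr_ι_mul, contr_ι_mul, h, map_sub, map_smul, gradeInv_ι_mul]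
    simp

theorem contr_mul (φ : Module.Dual R L) (u v : ExteriorAlgebra R L) :
    contr φ (u * v) = contr φ u * v + gradeInv u * contr φ v := by
  induction u using exterior_induction with
  | algebraMap r =>
    rw [gradeInv_algebraMap, contr_algebraMap, zero_mul, zero_add, ← Algebra.smul_def, map_smul,
      Algebra.smul_def]
  | add u v hu hv => rw [add_mul, map_add, map_add, map_add, hu, hv]; noncomm_ring
  | ι_mul X w h =>
    rw [mul_assoc, contr_ι_mul, h, contr_ι_mul, gradeInv_ι_mul, sub_mul, smul_mul_assoc]
    noncomm_ring

/-- The `R`-span of the products of two sections. -/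
def bivectors (R L : Type*) [CommRing R] [AddCommGroup L] [Module R L] :
    Submodule R (ExteriorAlgebra R L) :=
  Submodule.span R (Set.range fun p : L × L => ι R p.1 * ι R p.2)

theorem bivectors_induction {C : ExteriorAlgebra R L → Prop} {w : ExteriorAlgebra R L}
    (hw : w ∈ bivectors R L) (ι_mul_ι : ∀ X Y : L, C (ι R X * ι R Y))
    (add : ∀ u v, C u → C v → C (u + v))
    (smul : ∀ (f : R), ∀ u ∈ bivectors R L, C u → C (f • u)) : C w := by
  induction hw using Submodule.span_induction with
  | mem x hx => obtain ⟨p, rfl⟩ := hx; exact ι_mul_ι _ _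
  | zero => simpa using ι_mul_ι 0 0
  | add x y _ _ hx hy => exact add _ _ hx hy
  | smul f x h hx => exact smul _ _ h hx

theorem gradeInv_bivector {w : ExteriorAlgebra R L} (hw : w ∈ bivectors R L) :
    gradeInv w = w := by
  refine bivectors_induction (C := fun w => gradeInv w = w) hw (fun X Y => ?_)
    (fun u v hu hv => ?_) (fun f u _ hu => ?_)
  · rw [gradeInv_ι_mul, gradeInv_ι]; noncomm_ring
  · rw [map_add, hu, hv]
  · rw [map_smul, hu]

/-- Moving two sections past `u` applies the grade involution twice, so the signs cancel. -/
theorem bivector_mul_comm {w : ExteriorAlgebra R L} (hw : w ∈ bivectors R L)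
    (u : ExteriorAlgebra R L) : w * u = u * w := by
  refine bivectors_induction (C := fun w => w * u = u * w) hw (fun X Y => ?_)
    (fun v v' hv hv' => ?_) (fun f v _ hv => ?_)
  · rw [mul_assoc, ι_mul_gradeInv Y, ← mul_assoc, ι_mul_gradeInv X, gradeInv_gradeInv, mul_assoc]
  · rw [add_mul, mul_add, hv, hv']
  · rw [smul_mul_assoc, mul_smul_comm, hv]

/-- On X ∧ Y the contraction is φ(X) Y - φ(Y) X. Knowing that it is a section allows identities for
it to be tested by pairing with the dual module. -/
theorem contr_bivector {w : ExteriorAlgebra R L} (hw : w ∈ bivectors R L) (φ : Module.Dual R L) :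
    ∃ Z : L, contr φ w = ι R Z := by
  refine bivectors_induction (C := fun w => ∃ Z : L, contr φ w = ι R Z) hw (fun X Y => ?_)
    ?_ ?_
  · refine ⟨φ X • Y - φ Y • X, ?_⟩
    rw [contr_ι_mul, contr_ι, map_sub, map_smul, map_smul, Algebra.smul_def (φ Y),
      Algebra.commutes]
  · rintro u v ⟨Z, hZ⟩ ⟨Z', hZ'⟩
    exact ⟨Z + Z', by rw [map_add, map_add, hZ, hZ']⟩
  · rintro f u - ⟨Z, hZ⟩
    exact ⟨f • Z, by rw [map_smul, map_smul, hZ]⟩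

/-! ### Evaluation of the exterior algebra on the dual module -/

section Forms

variable {L' : Type*} [AddCommGroup L'] [Module R L'] (β : L' →ₗ[R] L →ₗ[R] R)

/-- The antiderivation rule, applied factor by factor, produces the signs of the Laplace expansion
of a determinant; this is what `toForm_succ` needs. -/
theorem contr_ιMulti (φ : Module.Dual R L) (k : ℕ) (X : Fin (k + 1) → L) :
    contr φ (ιMulti R (k + 1) X) =
      ∑ i : Fin (k + 1), ((-1 : R) ^ (i : ℕ) * φ (X i)) • ιMulti R k (X ∘ i.succAbove) := by
  induction k with
  | zero =>
    rw [ιMulti_succ_apply, contr_ι_mul, ιMulti_zero_apply, ← map_one (algebraMap R _),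
      contr_algebraMap]
    simp
  | succ k ih =>
    rw [ιMulti_succ_apply, contr_ι_mul, ih, Fin.sum_univ_succ (n := k + 1), Finset.mul_sum,
      sub_eq_add_neg, ← Finset.sum_neg_distrib]
    congr 1
    · simp only [Fin.val_zero, pow_zero, one_mul]
      rfl
    · refine Finset.sum_congr rfl fun i _ => ?_
      rw [ιMulti_succ_apply, mul_smul_comm, ← neg_smul]
      congr 1
      · simp [Matrix.vecTail, pow_succ]
      · congr 2
        ext j
        simp [Matrix.vecTail]

theorem span_ιMulti_induction {C : ExteriorAlgebra R L → Prop} (u : ExteriorAlgebra R L)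
    (ιMulti : ∀ n (X : Fin n → L), C (ιMulti R n X)) (add : ∀ u v, C u → C v → C (u + v))
    (smul : ∀ (f : R) u, C u → C (f • u)) : C u := by
  have hu : u ∈ Submodule.span R
      (Set.range fun x : Σ n, (Fin n → L) => ExteriorAlgebra.ιMulti R x.1 x.2) := by
    rw [ιMulti_span]; trivial
  induction hu using Submodule.span_induction with
  | mem x hx => obtain ⟨⟨n, X⟩, rfl⟩ := hx; exact ιMulti _ _
  | zero => simpa using smul 0 _ (ιMulti 0 ![])
  | add x y _ _ hx hy => exact add _ _ hx hy
  | smul f x _ hx => exact smul _ _ hx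

/-- On a product of k + 1 sections this is the Laplace expansion of det ⟨ξ_b, X_a⟩ along the column
b = 0. It makes induction on the number of arguments possible, with contraction as the inductive
step. -/
theorem toForm_succ (k : ℕ) (u : ExteriorAlgebra R L) (ξ : Fin (k + 1) → L') :
    toForm β (k + 1) u ξ = toForm β k (contr (β (ξ 0)) u) (Fin.tail ξ) := by
  induction u using span_ιMulti_induction with
  | ιMulti n X =>
    rcases n with _ | n
    · rw [toForm_ιMulti_of_ne β (by omega), ιMulti_zero_apply,
        ← map_one (algebraMap R (ExteriorAlgebra R L)), contr_algebraMap, map_zero]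
      rfl
    · rw [contr_ιMulti, map_sum, altSum_apply]
      simp only [map_smul, AlternatingMap.smul_apply]
      by_cases h : n = k
      · subst h
        simp only [toForm_ιMulti]
        rw [Matrix.det_succ_column_zero]
        refine Finset.sum_congr rfl fun i _ => ?_
        rfl
      · rw [toForm_ιMulti_of_ne β (by omega)]
        simp only [toForm_ιMulti_of_ne β h]
        simp
  | add u v hu hv =>
    simp only [map_add, AlternatingMap.add_apply, hu, hv]
  | smul f u hu => simp only [map_smul, AlternatingMap.smul_apply, hu]

theorem toForm_cons (k : ℕ) (u : ExteriorAlgebra R L) (ξ : L') (ζ : Fin k → L') :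
    toForm β (k + 1) u (Fin.cons ξ ζ) = toForm β k (contr (β ξ) u) ζ := by
  rw [toForm_succ, Fin.cons_zero, Fin.tail_cons]

theorem toForm_zero_algebraMap (f : R) (ξ : Fin 0 → L') :
    toForm β 0 (algebraMap R _ f) ξ = f := by
  have h : algebraMap R (ExteriorAlgebra R L) f = f • ιMulti R 0 ![] := by
    rw [ιMulti_zero_apply, Algebra.smul_def, mul_one]
  rw [h, map_smul, AlternatingMap.smul_apply, toForm_ιMulti]
  simp

theorem toForm_algebraMap_of_ne {k : ℕ} (hk : k ≠ 0) (f : R) :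
    toForm β k (algebraMap R _ f) = 0 := by
  have h : algebraMap R (ExteriorAlgebra R L) f = f • ιMulti R 0 ![] := by
    rw [ιMulti_zero_apply, Algebra.smul_def, mul_one]
  rw [h, map_smul, toForm_ιMulti_of_ne β hk.symm, smul_zero]

theorem toForm_zero_ι_mul (X : L) (u : ExteriorAlgebra R L) : toForm β 0 (ι R X * u) = 0 := by
  induction u using span_ιMulti_induction with
  | ιMulti n Y =>
    have h : ι R X * ιMulti R n Y = ιMulti R (n + 1) (Matrix.vecCons X Y) := by
      rw [ιMulti_succ_apply]; rfl
    rw [h, toForm_ιMulti_of_ne β (by omega)]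
  | add u v hu hv => rw [mul_add, map_add, hu, hv, add_zero]
  | smul f u hu => rw [mul_smul_comm, map_smul, hu, smul_zero]

theorem toForm_ι_eq (X : L) : ι R X = ιMulti R 1 ![X] := by
  rw [ιMulti_succ_apply, ιMulti_zero_apply, mul_one]; rfl

theorem toForm_one_ι (X : L) (ξ : Fin 1 → L') : toForm β 1 (ι R X) ξ = β (ξ 0) X := by
  rw [toForm_succ, contr_ι, toForm_zero_algebraMap]

theorem toForm_ι_of_ne {k : ℕ} (hk : k ≠ 1) (X : L) : toForm β k (ι R X) = 0 := by
  rw [toForm_ι_eq, toForm_ιMulti_of_ne β hk.symm]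

/-- Contractions anticommute with the grade involution, so each of the k arguments contributes one
sign. -/
theorem toForm_gradeInv (k : ℕ) (u : ExteriorAlgebra R L) :
    toForm β k (gradeInv u) = (-1 : R) ^ k • toForm β k u := by
  induction k generalizing u with
  | zero =>
    induction u using exterior_induction with
    | algebraMap r => rw [gradeInv_algebraMap, pow_zero, one_smul]
    | add u v hu hv => rw [map_add, map_add, map_add, hu, hv, smul_add]
    | ι_mul X w h =>
      rw [gradeInv_ι_mul, map_neg, toForm_zero_ι_mul, toForm_zero_ι_mul, neg_zero, smul_zero]
  | succ k ih =>
    ext ξ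
    rw [AlternatingMap.smul_apply, toForm_succ, toForm_succ, contr_gradeInv, map_neg, ih,
      AlternatingMap.neg_apply, AlternatingMap.smul_apply, pow_succ]
    simp

theorem toForm_gradeInv_of_odd {k : ℕ} (hk : Odd k) (u : ExteriorAlgebra R L) :
    toForm β k (gradeInv u) = -toForm β k u := by
  ext ξ
  rw [toForm_gradeInv, hk.neg_one_pow, AlternatingMap.smul_apply, AlternatingMap.neg_apply,
    neg_one_smul]

end Forms

/-- `D` is the derivation of the exterior algebra which extends the derivation `δ` of the ring of
functions and the map `τ` of the sections. -/
structure IsDerivationOver (δ : R → R) (τ : L → L)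
    (D : ExteriorAlgebra R L → ExteriorAlgebra R L) : Prop where
  algebraMap : ∀ f, D (algebraMap R _ f) = algebraMap R _ (δ f)
  add : ∀ u v, D (u + v) = D u + D v
  ι_mul : ∀ X u, D (ι R X * u) = ι R (τ X) * u + ι R X * D u

namespace IsDerivationOver

variable {δ : R → R} {τ : L → L} {D : ExteriorAlgebra R L → ExteriorAlgebra R L}

theorem zero (h : IsDerivationOver δ τ D) : D 0 = 0 := by simpa using h.add 0 0

theorem neg (h : IsDerivationOver δ τ D) (u : ExteriorAlgebra R L) : D (-u) = -D u := by
  have := h.add u (-u)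
  rw [add_neg_cancel, h.zero] at this
  exact eq_neg_of_add_eq_zero_right this.symm

theorem sub (h : IsDerivationOver δ τ D) (u v : ExteriorAlgebra R L) : D (u - v) = D u - D v := by
  rw [sub_eq_add_neg, h.add, h.neg, sub_eq_add_neg]

theorem ι (h : IsDerivationOver δ τ D) (h1 : δ 1 = 0) (X : L) :
    D (ExteriorAlgebra.ι R X) = ExteriorAlgebra.ι R (τ X) := by
  have := h.ι_mul X 1
  have h2 := h.algebraMap 1
  rw [h1, map_one, map_zero] at h2
  rwa [h2, mul_one, mul_one, mul_zero, add_zero] at this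

theorem mul (h : IsDerivationOver δ τ D) (hδ : ∀ f g, δ (f * g) = f * δ g + g * δ f)
    (u v : ExteriorAlgebra R L) : D (u * v) = D u * v + u * D v := by
  induction u using exterior_induction generalizing v with
  | algebraMap f =>
    induction v using exterior_induction with
    | algebraMap g =>
      rw [← map_mul, h.algebraMap, h.algebraMap, h.algebraMap, hδ, map_add, map_mul, map_mul,
        ← Algebra.commutes g, add_comm]
    | add v v' hv hv' => rw [mul_add, h.add, hv, hv', h.add]; noncomm_ring
    | ι_mul X w hw =>
      rw [h.algebraMap] at hw ⊢
      rw [← Algebra.smul_def, ← Algebra.smul_def, ← Algebra.smul_def] at hw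
      rw [← Algebra.smul_def, ← Algebra.smul_def, ← Algebra.smul_def, ← mul_smul_comm, h.ι_mul, hw,
        h.ι_mul]
      simp only [smul_add, mul_add, mul_smul_comm]
      abel
  | add u u' hu hu' => rw [add_mul, h.add, hu, hu', h.add]; noncomm_ring
  | ι_mul X w hw => rw [mul_assoc, h.ι_mul, hw, h.ι_mul]; noncomm_ring

theorem smul (h : IsDerivationOver δ τ D) (hδ : ∀ f g, δ (f * g) = f * δ g + g * δ f)
    (f : R) (u : ExteriorAlgebra R L) : D (f • u) = f • D u + δ f • u := by
  rw [Algebra.smul_def, h.mul hδ, h.algebraMap, ← Algebra.smul_def, ← Algebra.smul_def, add_comm]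

/-- The commutator of a derivation with a contraction is again a contraction, along the derivative ψ
= δ ∘ φ - φ ∘ τ of the linear form φ. -/
theorem contr (h : IsDerivationOver δ τ D) (hδ : ∀ f g, δ (f * g) = f * δ g + g * δ f)
    {φ ψ : Module.Dual R L} (hψ : ∀ X, ψ X = δ (φ X) - φ (τ X)) (u : ExteriorAlgebra R L) :
    LieRinehartStr.contr φ (D u) =
      D (LieRinehartStr.contr φ u) - LieRinehartStr.contr ψ u := by
  induction u using exterior_induction with
  | algebraMap f =>
    rw [h.algebraMap, contr_algebraMap, contr_algebraMap, contr_algebraMap, h.zero, sub_zero]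
  | add u v hu hv => rw [h.add, map_add, map_add, map_add, h.add, hu, hv]; abel
  | ι_mul X w hw =>
    rw [h.ι_mul, map_add, contr_ι_mul, contr_ι_mul, contr_ι_mul, contr_ι_mul, h.sub, h.smul hδ,
      h.ι_mul, hw, hψ, sub_smul]
    noncomm_ring

/-- The map τ' is dual to τ in the sense that the pairing satisfies the Leibniz rule; contracting
with the first argument and commuting by `IsDerivationOver.contr` propagates that rule to forms of
any degree. It serves both for L_X, through `A`, and for L_ξ, through `B`. -/
theorem toForm (h : IsDerivationOver δ τ D) (hδ : ∀ f g, δ (f * g) = f * δ g + g * δ f)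
    {L' : Type*} [AddCommGroup L'] [Module R L'] (β : L' →ₗ[R] L →ₗ[R] R) {τ' : L' → L'}
    (hτ : ∀ ξ X, β (τ' ξ) X = δ (β ξ X) - β ξ (τ X)) (k : ℕ) (u : ExteriorAlgebra R L)
    (ξ : Fin k → L') :
    toForm β k (D u) ξ = δ (toForm β k u ξ) -
      ∑ j, toForm β k u (Function.update ξ j (τ' (ξ j))) := by
  induction k generalizing u with
  | zero =>
    rw [Fin.sum_univ_zero, sub_zero]
    induction u using exterior_induction with
    | algebraMap f => rw [h.algebraMap, toForm_zero_algebraMap, toForm_zero_algebraMap]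
    | add u v hu hv =>
      -- `δ` is a bare function; its additivity is read off from that of `D` on scalars, which embed
      -- injectively in the exterior algebra.
      have hadd : ∀ f g : R, δ (f + g) = δ f + δ g := fun f g => by
        have h1 := h.add (Algebra.algebraMap R (ExteriorAlgebra R L) f) (Algebra.algebraMap R (ExteriorAlgebra R L) g)
        rw [← map_add, h.algebraMap, h.algebraMap, h.algebraMap, ← map_add] at h1
        exact algebraMap_leftInverse L |>.injective h1
      rw [h.add, map_add, map_add, AlternatingMap.add_apply, AlternatingMap.add_apply, hadd, hu, hv]
    | ι_mul X w hw =>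
      rw [h.ι_mul, map_add, toForm_zero_ι_mul, toForm_zero_ι_mul, toForm_zero_ι_mul, add_zero]
      have h1 : δ 0 = 0 := by simpa using hδ 0 0
      exact h1.symm
  | succ k ih =>
    rw [toForm_succ, h.contr hδ (hτ (ξ 0)), map_sub, AlternatingMap.sub_apply, ih, toForm_succ,
      Fin.sum_univ_succ, toForm_succ, Function.update_self, Fin.tail_update_zero]
    simp only [toForm_succ, ne_eq, (Fin.succ_ne_zero _).symm, not_false_eq_true,
      Function.update_of_ne, Fin.tail_update_succ]
    rw [sub_sub]
    exact congrArg _ (add_comm _ _)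

end IsDerivationOver

end Exterior

/-! ### Skew-symmetry and Leibniz rules of the Schouten bracket -/

section Schouten

variable {R L : Type*} [CommRing R] [Algebra ℝ R] [AddCommGroup L] [Module ℝ L] [Module R L]
  (A : LieRinehartStr R L)

theorem anchor_mul (X : L) (f g : R) :
    A.anchor X (f * g) = f * A.anchor X g + g * A.anchor X f := by
  rw [Derivation.leibniz, smul_eq_mul, smul_eq_mul]

theorem isDerivationOver_lieDeriv (X : L) :
    IsDerivationOver (A.anchor X) (A.bracket X) (A.lieDeriv X) where
  algebraMap f := A.lieDeriv_algebraMap X f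
  add _ _ := twistExt_add _ _ _
  ι_mul Y u := A.lieDeriv_ι_mul X Y u

theorem lieDeriv_mul (X : L) (u v : ExteriorAlgebra R L) :
    A.lieDeriv X (u * v) = A.lieDeriv X u * v + u * A.lieDeriv X v :=
  (A.isDerivationOver_lieDeriv X).mul (A.anchor_mul X) u v

theorem lieDeriv_ι (X Y : L) : A.lieDeriv X (ι R Y) = ι R (A.bracket X Y) :=
  (A.isDerivationOver_lieDeriv X).ι (A.anchor X).map_one_eq_zero Y

theorem fnBracket_eq (f : R) (u : ExteriorAlgebra R L) : A.fnBracket f u = -contr (A.d₀ f) u := rfl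

theorem schoutenAlg_ι (X : L) (v : ExteriorAlgebra R L) :
    A.schoutenAlg (ι R X) v = A.lieDeriv X v := twistExt_ι _ _

theorem schoutenAlg_ι_mul' (X : L) (u v : ExteriorAlgebra R L) :
    A.schoutenAlg (ι R X * u) v =
      ι R X * A.schoutenAlg u v + gradeInv u * A.lieDeriv X v := A.schoutenAlg_ι_mul X u v

theorem schoutenAlg_zero_left (v : ExteriorAlgebra R L) : A.schoutenAlg 0 v = 0 := by
  simpa using A.schoutenAlg_add_left 0 0 v

theorem schoutenAlg_zero_right (v : ExteriorAlgebra R L) : A.schoutenAlg v 0 = 0 := by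
  simpa using A.schoutenAlg_add_right v 0 0

theorem schoutenAlg_neg_left (u v : ExteriorAlgebra R L) :
    A.schoutenAlg (-u) v = -A.schoutenAlg u v := by
  have := A.schoutenAlg_add_left u (-u) v
  rw [add_neg_cancel, schoutenAlg_zero_left] at this
  exact eq_neg_of_add_eq_zero_right this.symm

theorem schoutenAlg_neg_right (u v : ExteriorAlgebra R L) :
    A.schoutenAlg u (-v) = -A.schoutenAlg u v := by
  have := A.schoutenAlg_add_right u v (-v)
  rw [add_neg_cancel, schoutenAlg_zero_right] at this
  exact eq_neg_of_add_eq_zero_right this.symm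

theorem schoutenAlg_sub_left (u u' v : ExteriorAlgebra R L) :
    A.schoutenAlg (u - u') v = A.schoutenAlg u v - A.schoutenAlg u' v := by
  rw [sub_eq_add_neg, schoutenAlg_add_left, schoutenAlg_neg_left, sub_eq_add_neg]

theorem schoutenAlg_sub_right (u v v' : ExteriorAlgebra R L) :
    A.schoutenAlg u (v - v') = A.schoutenAlg u v - A.schoutenAlg u v' := by
  rw [sub_eq_add_neg, schoutenAlg_add_right, schoutenAlg_neg_right, sub_eq_add_neg]

/-- The graded Leibniz rule in the second argument. -/
theorem schoutenAlg_mul_ι (u : ExteriorAlgebra R L) (Y : L) (w : ExteriorAlgebra R L) :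
    A.schoutenAlg u (ι R Y * w) =
      A.schoutenAlg u (ι R Y) * w - ι R Y * A.schoutenAlg (gradeInv u) w := by
  induction u using exterior_induction with
  | algebraMap f =>
    rw [gradeInv_algebraMap, schoutenAlg_algebraMap, schoutenAlg_algebraMap,
      schoutenAlg_algebraMap, fnBracket_ι_mul, A.fnBracket_eq f (ι R Y), contr_ι, neg_mul, ← Algebra.smul_def,
      d₀_apply]
  | add u v hu hv =>
    rw [map_add, schoutenAlg_add_left, schoutenAlg_add_left, schoutenAlg_add_left, hu, hv]
    noncomm_ring
  | ι_mul X u h =>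
    rw [gradeInv_ι_mul, schoutenAlg_neg_left, schoutenAlg_ι_mul', schoutenAlg_ι_mul',
      schoutenAlg_ι_mul', h, lieDeriv_ι_mul, lieDeriv_ι, gradeInv_gradeInv]
    simp only [mul_add, mul_sub, add_mul, mul_neg, sub_neg_eq_add, ← mul_assoc, gradeInv_mul_ι,
      ι_mul_ι_swap X Y]
    noncomm_ring

/-- An instance of graded skew-symmetry: with an argument of degree one, the sign (-1)^{(p-1)(q-1)}
is trivial. -/
theorem schoutenAlg_ι_right (u : ExteriorAlgebra R L) (Y : L) :
    A.schoutenAlg u (ι R Y) = -A.lieDeriv Y u := by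
  induction u using exterior_induction with
  | algebraMap f =>
    rw [schoutenAlg_algebraMap, fnBracket_eq, contr_ι, lieDeriv_algebraMap, d₀_apply]
  | add u v hu hv =>
    rw [schoutenAlg_add_left, hu, hv, (A.isDerivationOver_lieDeriv Y).add]
    abel
  | ι_mul X u h =>
    rw [schoutenAlg_ι_mul', h, lieDeriv_ι, lieDeriv_ι_mul, gradeInv_mul_ι, A.bracket_neg X Y,
      map_neg]
    noncomm_ring

/-- Graded skew-symmetry against an argument of degree zero has the sign (-1)^p, which the grade
involution supplies without `u` being homogeneous. -/
theorem schoutenAlg_algebraMap_right (u : ExteriorAlgebra R L) (f : R) :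
    A.schoutenAlg u (algebraMap R _ f) = A.fnBracket f (gradeInv u) := by
  induction u using exterior_induction with
  | algebraMap g =>
    rw [schoutenAlg_algebraMap, gradeInv_algebraMap, fnBracket_algebraMap, fnBracket_algebraMap]
  | add u v hu hv => rw [schoutenAlg_add_left, hu, hv, map_add, fnBracket_add]
  | ι_mul X u h =>
    rw [schoutenAlg_ι_mul', h, lieDeriv_algebraMap, gradeInv_ι_mul, fnBracket_eq, fnBracket_eq,
      map_neg, contr_ι_mul, d₀_apply, ← Algebra.commutes, ← Algebra.smul_def]
    noncomm_ring

/-- A bivector is even, so the Leibniz rule in the first argument has no signs here. A scalar factor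
f on the bivector adds a term with [f, v] to each side, and the two match because bivectors are
central. -/
theorem schoutenAlg_bivector_mul {w : ExteriorAlgebra R L} (hw : w ∈ bivectors R L)
    (u v : ExteriorAlgebra R L) :
    A.schoutenAlg (w * u) v = w * A.schoutenAlg u v + u * A.schoutenAlg w v := by
  refine bivectors_induction (C := fun w => A.schoutenAlg (w * u) v =
    w * A.schoutenAlg u v + u * A.schoutenAlg w v) hw (fun X Y => ?_) (fun x y hx hy => ?_)
    (fun f x hx' hx => ?_)
  · have h1 : ∀ (Z : L) (a : ExteriorAlgebra R L),
        u * (ι R Z * a) = ι R Z * (gradeInv u * a) := fun Z a => by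
      rw [← mul_assoc, mul_ι, mul_assoc]
    rw [mul_assoc, schoutenAlg_ι_mul', schoutenAlg_ι_mul', schoutenAlg_ι_mul', schoutenAlg_ι,
      gradeInv_ι_mul, gradeInv_ι]
    simp only [mul_add, neg_mul, mul_neg, h1, mul_assoc]
    abel
  · rw [add_mul, schoutenAlg_add_left, schoutenAlg_add_left, hx, hy]
    noncomm_ring
  · rw [smul_mul_assoc, schoutenAlg_smul_left, schoutenAlg_smul_left, hx]
    have h1 := bivector_mul_comm hx' (u * A.fnBracket f v)
    have h2 := bivector_mul_comm hx' (A.fnBracket f v)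
    rw [mul_assoc] at h1
    simp only [smul_add, mul_add, smul_mul_assoc, mul_smul_comm, mul_assoc, h1, h2]
    abel

end Schouten

end LieRinehartStr

namespace LieRinehartStr

open ExteriorAlgebra

/-! ### Cartan's formula and locality for the differential -/

section Cartan

variable {R L : Type*} [CommRing R] [Algebra ℝ R] [AddCommGroup L] [Module ℝ L] [Module R L]
  [IsScalarTower ℝ R L] (A : LieRinehartStr R L) {k : ℕ}

theorem differential_eq (P : L [⋀^Fin k]→ₗ[R] R) (ξ : Fin (k + 1) → L) :
    A.differential P ξ =
      ∑ i : Fin (k + 1), (-1 : ℤ) ^ (i : ℕ) • A.anchor (ξ i) (P (i.removeNth ξ)) -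
      (1 / 2 : ℝ) • ∑ i : Fin (k + 1), (-1 : ℤ) ^ (i : ℕ) •
        A.bracketForm P (ξ i) (i.removeNth ξ) := by
  refine (A.differentialReal_apply P ξ).trans ?_
  simp only [bracketForm_apply]

theorem differential_add (P Q : L [⋀^Fin k]→ₗ[R] R) :
    A.differential (P + Q) = A.differential P + A.differential Q := by
  ext ξ
  rw [AlternatingMap.add_apply]
  simp only [differential_eq, bracketForm_apply, AlternatingMap.add_apply, map_add,
    smul_add, Finset.sum_add_distrib]
  abel

theorem differential_zero : A.differential (0 : L [⋀^Fin k]→ₗ[R] R) = 0 := by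
  simpa using A.differential_add (0 : L [⋀^Fin k]→ₗ[R] R) 0

theorem differential_neg (P : L [⋀^Fin k]→ₗ[R] R) :
    A.differential (-P) = -A.differential P := by
  have := A.differential_add P (-P)
  rw [add_neg_cancel, differential_zero] at this
  exact eq_neg_of_add_eq_zero_right this.symm

theorem differential_sub (P Q : L [⋀^Fin k]→ₗ[R] R) :
    A.differential (P - Q) = A.differential P - A.differential Q := by
  rw [sub_eq_add_neg, differential_add, differential_neg, sub_eq_add_neg]

theorem differential_cons_zero (P : L [⋀^Fin 0]→ₗ[R] R) (X : L) (ζ : Fin 0 → L) :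
    A.differential P (Fin.cons X ζ) = A.anchor X (P ζ) := by
  rw [differential_apply_zero, Subsingleton.elim ζ ![]]
  rfl

/-- Cartan's formula `i_X d = L_X - d i_X`. -/
theorem differential_cons (P : L [⋀^Fin (k + 1)]→ₗ[R] R) (X : L) (ζ : Fin (k + 1) → L) :
    A.differential P (Fin.cons X ζ) =
      A.anchor X (P ζ) - A.bracketForm P X ζ - A.differential (P.curryLeft X) ζ := by
  have hr : ∀ i : Fin (k + 1), i.succ.removeNth (Fin.cons X ζ : Fin (k + 2) → L) =
      Fin.cons X (i.removeNth ζ) := fun i => by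
    ext j
    refine Fin.cases ?_ (fun j => ?_) j
    · simp [Fin.removeNth]
    · simp [Fin.removeNth]
  -- The bracket of ζᵢ with X is split off from the brackets with the other entries; moving it from
  -- the front into slot i gives the sign (-1)^i.
  have hb : ∀ i : Fin (k + 1), A.bracketForm P (ζ i) (Fin.cons X (i.removeNth ζ)) =
      A.bracketForm (P.curryLeft X) (ζ i) (i.removeNth ζ) -
        (-1 : ℤ) ^ (i : ℕ) • P (Function.update ζ i (A.bracket X (ζ i))) := fun i => by
    have h3 : Function.update ζ i (A.bracket X (ζ i)) =
      i.insertNth (A.bracket X (ζ i)) (i.removeNth ζ) := by simp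
    have h5 : P (Fin.cons (-A.bracket X (ζ i)) (i.removeNth ζ)) =
        -P (Fin.cons (A.bracket X (ζ i)) (i.removeNth ζ)) := by
      simpa using P.map_update_neg (Fin.cons (A.bracket X (ζ i)) (i.removeNth ζ)) 0
        (A.bracket X (ζ i))
    rw [h3, P.neg_one_pow_smul_map_insertNth, bracketForm_apply, bracketForm_apply,
      Fin.sum_univ_succ, Fin.cons_zero, Fin.update_cons_zero, A.bracket_neg (ζ i) X, h5,
      sub_eq_add_neg, add_comm]
    congr 1
    refine Finset.sum_congr rfl fun j _ => ?_
    rw [Fin.cons_succ, ← Fin.cons_update]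
    rfl
  rw [differential_eq, differential_eq, Fin.sum_univ_succ, Fin.sum_univ_succ (n := k + 1)]
  simp only [hr, hb, Fin.cons_zero, Fin.cons_succ, Fin.val_zero, pow_zero, one_smul, Fin.val_succ,
    Fin.removeNth_zero, Fin.tail_cons, AlternatingMap.curryLeft_apply_apply]
  have hs : ∑ i : Fin (k + 1), (-1 : ℤ) ^ ((i : ℕ) + 1) • (A.bracketForm (P.curryLeft X) (ζ i)
        (i.removeNth ζ) - (-1 : ℤ) ^ (i : ℕ) • P (Function.update ζ i (A.bracket X (ζ i)))) =
      -∑ i : Fin (k + 1), (-1 : ℤ) ^ (i : ℕ) • A.bracketForm (P.curryLeft X) (ζ i)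
        (i.removeNth ζ) + A.bracketForm P X ζ := by
    rw [bracketForm_apply, ← Finset.sum_neg_distrib, ← Finset.sum_add_distrib]
    refine Finset.sum_congr rfl fun i _ => ?_
    rw [pow_succ, mul_neg_one, neg_smul, smul_sub, smul_smul, ← mul_pow]
    simp
    abel
  have ha : ∑ i : Fin (k + 1), (-1 : ℤ) ^ ((i : ℕ) + 1) •
        A.anchor (ζ i) (P (Fin.cons X (i.removeNth ζ))) =
      -∑ i : Fin (k + 1), (-1 : ℤ) ^ (i : ℕ) •
        A.anchor (ζ i) (P (Matrix.vecCons X (i.removeNth ζ))) := by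
    rw [← Finset.sum_neg_distrib]
    refine Finset.sum_congr rfl fun i _ => ?_
    rw [pow_succ, mul_neg_one, neg_smul]
    rfl
  rw [hs, ha]
  -- The sum over ordered pairs meets each bracket of X with ζᵢ twice, once with X taken out and
  -- once with ζᵢ taken out. These are the two halves.
  have h7 : A.bracketForm P X ζ =
      (1 / 2 : ℝ) • A.bracketForm P X ζ + (1 / 2 : ℝ) • A.bracketForm P X ζ := by
    rw [← add_smul]; norm_num
  simp only [smul_add, smul_neg]
  linear_combination h7

/-- The differential is a local operator. -/
theorem differential_local {h : R} {P : L [⋀^Fin k]→ₗ[R] R} (hP : h • P = 0) :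
    (h * h) • A.differential P = 0 := by
  -- Differentiating h f = 0 gives h a(X)f = -f a(X)h, and a further factor h kills the right-hand
  -- side. This is the origin of the square.
  have key : ∀ (X : L) (f : R), h * f = 0 → h * h * A.anchor X f = 0 := fun X f hf => by
    have h1 := A.anchor_mul X h f
    rw [hf, map_zero] at h1
    linear_combination -h * h1 - A.anchor X h * hf
  induction k with
  | zero =>
    ext ξ
    rw [← Fin.cons_self_tail ξ, AlternatingMap.smul_apply, differential_cons_zero]
    exact key _ _ (congrArg (fun Q : L [⋀^Fin 0]→ₗ[R] R => Q (Fin.tail ξ)) hP)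
  | succ k ih =>
    ext ξ
    have hP' : ∀ ζ, h * P ζ = 0 := fun ζ =>
      congrArg (fun Q : L [⋀^Fin (k + 1)]→ₗ[R] R => Q ζ) hP
    have h1 : (h * h) • A.differential (P.curryLeft (ξ 0)) = 0 := ih (by
      ext ζ
      exact hP' _)
    have h2 := congrArg (fun Q : L [⋀^Fin (k + 1)]→ₗ[R] R => Q (Fin.tail ξ)) h1
    simp only [AlternatingMap.smul_apply, AlternatingMap.zero_apply, smul_eq_mul] at h2
    rw [← Fin.cons_self_tail ξ, AlternatingMap.smul_apply, differential_cons, smul_eq_mul, mul_sub,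
      mul_sub, h2, key _ _ (hP' _), bracketForm_apply, Finset.mul_sum]
    simp [mul_assoc, hP']

theorem differential_eq_of_smul_eq {h : R} {P Q : L [⋀^Fin k]→ₗ[R] R} (hP : h • P = h • Q) :
    (h * h) • A.differential P = (h * h) • A.differential Q := by
  have := A.differential_local (h := h) (P := P - Q) (by rw [smul_sub, hP, sub_self])
  rwa [differential_sub, smul_sub, sub_eq_zero] at this

end Cartan

/-! ### Lie derivatives of the dual bundle and the differential of a product -/

section Dual

variable {R L L' : Type*} [CommRing R] [Algebra ℝ R] [AddCommGroup L] [Module R L]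
  [AddCommGroup L'] [Module ℝ L'] [Module R L'] [IsScalarTower ℝ R L']
  (B : LieRinehartStr R L') {β : L' →ₗ[R] L →ₗ[R] R} (hβ : Function.Bijective β.flip)

/-- The section which represents a linear form on the dual module. -/
noncomputable def dualSection (φ : Module.Dual R L') : L := (Equiv.ofBijective _ hβ).symm φ

theorem dualSection_apply (φ : Module.Dual R L') (ξ : L') : β ξ (dualSection hβ φ) = φ ξ :=
  congrArg (fun ψ : Module.Dual R L' => ψ ξ) ((Equiv.ofBijective _ hβ).apply_symm_apply φ)

/-- The differential `d_* f` of a function as a section of the dual bundle. -/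
noncomputable def coDiff (f : R) : L := dualSection hβ (B.d₀ f)

theorem coDiff_apply (f : R) (ξ : L') : β ξ (B.coDiff hβ f) = B.anchor ξ f :=
  dualSection_apply hβ _ ξ

/-- The Lie derivative `L_ξ X` of a section of the dual bundle. -/
noncomputable def coLie (ξ : L') (X : L) : L := dualSection hβ
  { toFun := fun η => B.anchor ξ (β η X) - β (B.bracket ξ η) X
    map_add' := fun η ζ => by simp only [map_add, LinearMap.add_apply]; ring
    map_smul' := fun f η => by
      simp only [map_smul, LinearMap.smul_apply, B.leibniz, map_add, LinearMap.add_apply,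
        smul_eq_mul, B.anchor_mul, RingHom.id_apply]
      ring }

theorem coLie_apply (ξ : L') (X : L) (η : L') :
    β η (B.coLie hβ ξ X) = B.anchor ξ (β η X) - β (B.bracket ξ η) X :=
  dualSection_apply hβ _ η

theorem eq_of_pairing_eq (hβ : Function.Bijective β.flip) {X Y : L} (h : ∀ ξ, β ξ X = β ξ Y) : X = Y :=
  hβ.1 (LinearMap.ext h)

/-- The values of the Lie derivative `L_ξ` on functions and on sections of the dual bundle. -/
noncomputable def coLieTwist (ξ : L') : TwistData R L where
  c f := algebraMap R _ (B.anchor ξ f)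
  c' X := ι R (B.coLie hβ ξ X)
  c_add f g := by simp
  c_mul f g := by
    rw [Derivation.leibniz, map_add, smul_eq_mul, smul_eq_mul, map_mul, map_mul,
      Algebra.smul_def, Algebra.smul_def]
  c'_add X Y := by
    rw [← map_add]
    congr 1
    refine eq_of_pairing_eq hβ fun η => ?_
    simp only [coLie_apply, map_add]
    ring
  c'_smul f X := by
    rw [← Algebra.commutes, ← Algebra.smul_def, ← map_smul, ← map_smul, ← map_add]
    congr 1
    refine eq_of_pairing_eq hβ fun η => ?_
    simp only [coLie_apply, map_add, map_smul, smul_eq_mul, B.anchor_mul]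
    ring

/-- The Lie derivative `L_ξ` on the exterior algebra of the dual bundle. -/
noncomputable def coLieDeriv (ξ : L') (u : ExteriorAlgebra R L) : ExteriorAlgebra R L :=
  twistExt (B.coLieTwist hβ ξ) u

theorem isDerivationOver_coLieDeriv (ξ : L') :
    IsDerivationOver (B.anchor ξ) (B.coLie hβ ξ) (B.coLieDeriv hβ ξ) where
  algebraMap _ := twistExt_algebraMap _ _
  add _ _ := twistExt_add _ _ _
  ι_mul X u := by
    rw [coLieDeriv, twistExt_ι_mul, add_comm, ι_mul_eq (B.coLie hβ ξ X)]; rfl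

/-- `coLie` is dual to the bracket under the pairing, so the general formula for derivations
applies. Its right-hand side is the Lie derivative term in `differential_cons`. -/
theorem toForm_coLieDeriv (k : ℕ) (ξ : L') (u : ExteriorAlgebra R L) (ζ : Fin k → L') :
    toForm β k (B.coLieDeriv hβ ξ u) ζ =
      B.anchor ξ (toForm β k u ζ) - B.bracketForm (toForm β k u) ξ ζ := by
  rw [bracketForm_apply]
  exact (B.isDerivationOver_coLieDeriv hβ ξ).toForm (B.anchor_mul ξ) β
    (fun η X => by rw [coLie_apply]; ring) k u ζ

theorem toForm_curryLeft (k : ℕ) (u : ExteriorAlgebra R L) (ξ : L') :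
    (toForm β (k + 1) u).curryLeft ξ = toForm β k (contr (β ξ) u) := by
  ext ζ
  exact toForm_cons β k u ξ ζ

theorem differential_toForm_zero (ξ : L') (u : ExteriorAlgebra R L) (ζ : Fin 0 → L') :
    B.differential (toForm β 0 u) (Fin.cons ξ ζ) = toForm β 0 (B.coLieDeriv hβ ξ u) ζ := by
  rw [differential_cons_zero, toForm_coLieDeriv, bracketForm_apply]
  simp

/-- Cartan's formula, with L_ξ and i_ξ now acting on the exterior algebra. As L_ξ is a derivation
there, this recursion in the degree replaces the Koszul sum when differentials of products are
computed. -/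
theorem differential_toForm_succ (k : ℕ) (ξ : L') (u : ExteriorAlgebra R L)
    (ζ : Fin (k + 1) → L') :
    B.differential (toForm β (k + 1) u) (Fin.cons ξ ζ) =
      toForm β (k + 1) (B.coLieDeriv hβ ξ u) ζ -
        B.differential (toForm β k (contr (β ξ) u)) ζ := by
  rw [differential_cons, toForm_coLieDeriv, toForm_curryLeft]

/-- `d(f u) = f du + df ∧ u`. -/
theorem differential_toForm_smul (k : ℕ) (f : R) (u : ExteriorAlgebra R L) :
    B.differential (toForm β k (f • u)) =
      f • B.differential (toForm β k u) + toForm β (k + 1) (ι R (B.coDiff hβ f) * u) := by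
  induction k generalizing u with
  | zero =>
    ext ξ
    rw [← Fin.cons_self_tail ξ, AlternatingMap.add_apply, AlternatingMap.smul_apply,
      differential_toForm_zero B hβ, differential_toForm_zero B hβ,
      (B.isDerivationOver_coLieDeriv hβ _).smul (B.anchor_mul _), toForm_cons, contr_ι_mul, map_sub,
      toForm_zero_ι_mul, sub_zero, coDiff_apply, map_add, map_smul, map_smul]
    rfl
  | succ k ih =>
    ext ξ
    rw [← Fin.cons_self_tail ξ, AlternatingMap.add_apply, AlternatingMap.smul_apply,
      differential_toForm_succ B hβ, differential_toForm_succ B hβ,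
      (B.isDerivationOver_coLieDeriv hβ _).smul (B.anchor_mul _), toForm_cons, contr_ι_mul, map_sub,
      coDiff_apply, map_add, map_smul, map_smul, map_smul, ih]
    simp only [AlternatingMap.add_apply, AlternatingMap.sub_apply, AlternatingMap.smul_apply,
      smul_eq_mul]
    ring

/-- `w` represents `h dX`, up to the factor `h`. -/
theorem differential_toForm_ι_mul {h : R} {X : L} {w : ExteriorAlgebra R L}
    (hw : w ∈ bivectors R L)
    (hwX : ∀ ξ, h • contr (β ξ) w = h • (ι R (B.coLie hβ ξ X) - ι R (B.coDiff hβ (β ξ X))))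
    (k : ℕ) {v v' : ExteriorAlgebra R L} (h0 : h • toForm β 0 v' = 0)
    (hv : ∀ j, h • toForm β (j + 1) v' = h • B.differential (toForm β j v)) :
    h • B.differential (toForm β k (ι R X * v)) =
      h • toForm β (k + 1) (w * v - ι R X * v') := by
  -- The two sides of the claim are compared after contraction with ξ. Hypothesis `hwX` then
  -- replaces i_ξ w by L_ξ X - d⟨ξ, X⟩, which is Cartan's formula for dX.
  have hc : ∀ ξ, contr (β ξ) (w * v - ι R X * v') = contr (β ξ) w * v + w * contr (β ξ) v -
      (β ξ X • v' - ι R X * contr (β ξ) v') := fun ξ => by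
    rw [map_sub, contr_mul, contr_ι_mul, gradeInv_bivector hw]
  have hc' : ∀ ξ, h • (contr (β ξ) w * v) =
      h • ((ι R (B.coLie hβ ξ X) - ι R (B.coDiff hβ (β ξ X))) * v) := fun ξ => by
    rw [← smul_mul_assoc, hwX, smul_mul_assoc]
  have hwz : ∀ (u : ExteriorAlgebra R L), toForm β 0 (w * u) = 0 := fun u => by
    refine bivectors_induction (C := fun w => toForm β 0 (w * u) = 0) hw (fun X Y => ?_)
      (fun a b ha hb => ?_) (fun f a _ ha => ?_)
    · rw [mul_assoc, toForm_zero_ι_mul]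
    · rw [add_mul, map_add, ha, hb, add_zero]
    · rw [smul_mul_assoc, map_smul, ha, smul_zero]
  induction k generalizing v v' with
  | zero =>
    ext ξ
    rw [toForm_zero_ι_mul, differential_zero, smul_zero, ← Fin.cons_self_tail ξ,
      AlternatingMap.smul_apply, toForm_cons, ← AlternatingMap.smul_apply, ← map_smul, hc, smul_sub,
      smul_add, hc', smul_sub]
    rw [sub_mul]
    simp only [map_sub, map_add, map_smul, toForm_zero_ι_mul, hwz, smul_comm h, h0]
    simp
  | succ k ih =>
    ext ξ
    rw [← Fin.cons_self_tail ξ, AlternatingMap.smul_apply, AlternatingMap.smul_apply,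
      differential_toForm_succ B hβ, toForm_cons, contr_ι_mul, map_sub, differential_sub,
      differential_toForm_smul B hβ, (B.isDerivationOver_coLieDeriv hβ _).ι_mul]
    generalize ξ 0 = η
    generalize Fin.tail ξ = ζ
    -- By Cartan's formula L_η v - i_η v' represents the differential of i_η v, so the induction
    -- hypothesis applies to X ∧ i_η v.
    have h1 := ih (v := contr (β η) v) (v' := B.coLieDeriv hβ η v - contr (β η) v')
      (by
        ext ζ
        have h2 := congrArg (fun P : L' [⋀^Fin 1]→ₗ[R] R => P (Fin.cons η ζ)) (hv 0)
        simp only [AlternatingMap.smul_apply, toForm_cons, differential_toForm_zero B hβ] at h2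
        simp only [map_sub, smul_sub, AlternatingMap.smul_apply, AlternatingMap.sub_apply, h2]
        simp)
      (fun j => by
        ext ζ
        have h2 := congrArg (fun P : L' [⋀^Fin (j + 2)]→ₗ[R] R => P (Fin.cons η ζ)) (hv (j + 1))
        simp only [AlternatingMap.smul_apply, toForm_cons, differential_toForm_succ B hβ] at h2
        simp only [map_sub, smul_sub, AlternatingMap.smul_apply, AlternatingMap.sub_apply, h2]
        simp)
      (fun ξ => by rw [map_sub, contr_mul, contr_ι_mul, gradeInv_bivector hw])
      (fun ξ => by rw [← smul_mul_assoc, hwX, smul_mul_assoc])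
    have h1' := congrArg (fun P : L' [⋀^Fin (k + 1)]→ₗ[R] R => P ζ) h1
    have h3 := congrArg (fun P : L' [⋀^Fin (k + 1)]→ₗ[R] R => P ζ) (hv k)
    have h4 := congrArg (fun u => toForm β (k + 1) u ζ) (hc' η)
    rw [hc]
    simp only [map_sub, map_add, map_smul, mul_sub, sub_mul, AlternatingMap.smul_apply,
      AlternatingMap.sub_apply, AlternatingMap.add_apply, smul_eq_mul] at h1' h3 h4 ⊢
    linear_combination h1' + β η X * h3 - h4

end Dual

end LieRinehartStr

namespace LieRinehartStr

open ExteriorAlgebra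

/-! ### The differential on the exterior algebra, up to a multiplicative set of functions -/

section Near

variable {R L L' : Type*} [CommRing R] [Algebra ℝ R] [AddCommGroup L] [Module R L]
  [AddCommGroup L'] [Module ℝ L'] [Module R L'] [IsScalarTower ℝ R L']
  {B : LieRinehartStr R L'} {β : L' →ₗ[R] L →ₗ[R] R} {S : Submonoid R}

/-- `u'` represents the differential of `u`, up to a factor in `S`. -/
def IsDifferentialNear (B : LieRinehartStr R L') (β : L' →ₗ[R] L →ₗ[R] R) (S : Submonoid R)
    (u u' : ExteriorAlgebra R L) : Prop :=
  ∃ h ∈ S, h • toForm β 0 u' = 0 ∧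
    ∀ k, h • toForm β (k + 1) u' = h • B.differential (toForm β k u)

/-- There is a pair of dual frames, up to a factor which is `1` up to a factor in `S`. -/
def HasDualFrameNear (β : L' →ₗ[R] L →ₗ[R] R) (S : Submonoid R) : Prop :=
  ∃ g, ∃ h ∈ S, h * g = h ∧ Nonempty (DualFrame β g)

theorem mul_pow_eq {g h : R} (hg : h * g = h) (m : ℕ) : h * g ^ m = h := by
  induction m with
  | zero => rw [pow_zero, mul_one]
  | succ m ih => rw [pow_succ, ← mul_assoc, ih, hg]

theorem IsDifferentialNear.congr {u a b : ExteriorAlgebra R L} (ha : IsDifferentialNear B β S u a)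
    {t : R} (ht : t ∈ S) (hab : t • (a - b) = 0) : IsDifferentialNear B β S u b := by
  obtain ⟨h, hS, h0, h1⟩ := ha
  have key : ∀ k, t • toForm β k b = t • toForm β k a := fun k => by
    have := congrArg (toForm β k) hab
    rw [map_zero, map_smul, map_sub, smul_sub, sub_eq_zero] at this
    exact this.symm
  refine ⟨h * t, S.mul_mem hS ht, ?_, fun k => ?_⟩
  · rw [mul_smul, key, smul_comm, h0, smul_zero]
  · rw [mul_smul, key, smul_comm, h1, smul_comm, mul_smul]

/-- A cut-off dual frame recovers an element of the exterior algebra from its forms up to a power of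
g, and h * g = h absorbs that power. -/
theorem IsDifferentialNear.unique (hF : HasDualFrameNear β S) {u a b : ExteriorAlgebra R L}
    (ha : IsDifferentialNear B β S u a) (hb : IsDifferentialNear B β S u b) :
    ∃ t ∈ S, t • (a - b) = 0 := by
  obtain ⟨h, hS, h0, h1⟩ := ha
  obtain ⟨h', hS', h0', h1'⟩ := hb
  obtain ⟨g, t, ht, hg, ⟨D⟩⟩ := hF
  obtain ⟨N, hN⟩ := exists_pow_smul_eq_zero (h := h * h') (u := a - b) D fun n => by
    rw [map_sub, smul_sub, mul_smul, mul_smul]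
    rcases n with _ | n
    · rw [smul_comm, h0, h0', smul_zero, smul_zero, sub_zero]
    · rw [smul_comm, h1, h1', smul_comm, sub_self]
  refine ⟨t * (h * h'), S.mul_mem ht (S.mul_mem hS hS'), ?_⟩
  rw [← mul_pow_eq hg N, mul_assoc, mul_smul, hN, smul_zero]

theorem IsDifferentialNear.add {u u' v v' : ExteriorAlgebra R L}
    (hu : IsDifferentialNear B β S u u') (hv : IsDifferentialNear B β S v v') :
    IsDifferentialNear B β S (u + v) (u' + v') := by
  obtain ⟨h, hS, h0, h1⟩ := hu
  obtain ⟨t, tS, t0, t1⟩ := hv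
  refine ⟨h * t, S.mul_mem hS tS, ?_, fun k => ?_⟩
  · rw [map_add, smul_add, mul_smul, mul_smul, t0, smul_comm, h0, smul_zero, smul_zero, add_zero]
  · rw [map_add, map_add, differential_add, smul_add, smul_add, mul_smul, mul_smul, t1, smul_comm,
      h1, mul_smul, mul_smul, smul_comm t h]

theorem IsDifferentialNear.neg {u u' : ExteriorAlgebra R L}
    (hu : IsDifferentialNear B β S u u') : IsDifferentialNear B β S (-u) (-u') := by
  obtain ⟨h, hS, h0, h1⟩ := hu
  refine ⟨h, hS, ?_, fun k => ?_⟩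
  · rw [map_neg, smul_neg, h0, neg_zero]
  · rw [map_neg, map_neg, differential_neg, smul_neg, smul_neg, h1]

theorem IsDifferentialNear.sub {u u' v v' : ExteriorAlgebra R L}
    (hu : IsDifferentialNear B β S u u') (hv : IsDifferentialNear B β S v v') :
    IsDifferentialNear B β S (u - v) (u' - v') := by
  rw [sub_eq_add_neg, sub_eq_add_neg]
  exact hu.add hv.neg

theorem isDifferentialNear_algebraMap (hβ : Function.Bijective β.flip) (f : R) :
    IsDifferentialNear B β S (algebraMap R _ f) (ι R (B.coDiff hβ f)) := by
  refine ⟨1, S.one_mem, ?_, fun k => ?_⟩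
  · rw [toForm_ι_of_ne β (by decide), smul_zero]
  · rcases k with _ | k
    · congr 1
      ext ξ
      rw [toForm_one_ι, coDiff_apply, differential_apply_zero, toForm_zero_algebraMap]
    · rw [toForm_ι_of_ne β (by omega), toForm_algebraMap_of_ne β (by omega), differential_zero]

/-- The contraction of a bivector is a section, so both sides are determined by their pairings with
every η. For these the claim is Cartan's formula for dX in degree two. -/
theorem IsDifferentialNear.contr_bivector (hβ : Function.Bijective β.flip) {X : L}
    {w : ExteriorAlgebra R L} (hw : w ∈ bivectors R L) {h : R}
    (hX : h • toForm β 2 w = h • B.differential (toForm β 1 (ι R X))) (ξ : L') :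
    h • contr (β ξ) w = h • (ι R (B.coLie hβ ξ X) - ι R (B.coDiff hβ (β ξ X))) := by
  obtain ⟨Z, hZ⟩ := LieRinehartStr.contr_bivector hw (β ξ)
  rw [hZ, ← map_sub, ← map_smul, ← map_smul]
  congr 1
  refine eq_of_pairing_eq hβ fun η => ?_
  have h1 := congrArg (fun P : L' [⋀^Fin 2]→ₗ[R] R => P (Fin.cons ξ ![η])) hX
  simp only [AlternatingMap.smul_apply] at h1
  rw [toForm_cons, hZ, toForm_one_ι, differential_toForm_succ B hβ, contr_ι,
    (B.isDerivationOver_coLieDeriv hβ ξ).ι (B.anchor ξ).map_one_eq_zero, toForm_one_ι,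
    differential_apply_zero, toForm_zero_algebraMap] at h1
  rw [map_smul, map_smul, map_sub, coDiff_apply]
  exact h1

theorem IsDifferentialNear.ι_mul (hβ : Function.Bijective β.flip) {X : L}
    {w v v' : ExteriorAlgebra R L} (hw : w ∈ bivectors R L)
    (hX : IsDifferentialNear B β S (ι R X) w) (hv : IsDifferentialNear B β S v v') :
    IsDifferentialNear B β S (ι R X * v) (w * v - ι R X * v') := by
  obtain ⟨h, hS, h0, h1⟩ := hX
  obtain ⟨t, tS, t0, t1⟩ := hv
  have hwz : toForm β 0 (w * v) = 0 := by
    refine bivectors_induction (C := fun w => toForm β 0 (w * v) = 0) hw (fun X Y => ?_)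
      (fun a b ha hb => ?_) (fun f a _ ha => ?_)
    · rw [mul_assoc, toForm_zero_ι_mul]
    · rw [add_mul, map_add, ha, hb, add_zero]
    · rw [smul_mul_assoc, map_smul, ha, smul_zero]
  refine ⟨h * t, S.mul_mem hS tS, ?_, fun k => ?_⟩
  · rw [map_sub, hwz, toForm_zero_ι_mul, sub_zero, smul_zero]
  · refine (differential_toForm_ι_mul B hβ hw
      (IsDifferentialNear.contr_bivector hβ hw ?_) k ?_ fun j => ?_).symm
    · rw [mul_smul, smul_comm, h1, smul_comm, mul_smul]
    · rw [mul_smul, t0, smul_zero]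
    · rw [mul_smul, t1, mul_smul]

/-- The witness is 1/2 ∑ P(εᵢ, εⱼ) eᵢ ∧ eⱼ, as in `exists_representative`; what is added is that it
lies in the span of products of two sections. -/
theorem exists_bivector_toForm {g : R} (D : DualFrame β g) (P : L' [⋀^Fin 2]→ₗ[R] R) :
    ∃ w ∈ bivectors R L, toForm β 2 w = g ^ 2 • P ∧ ∀ n, n ≠ 2 → toForm β n w = 0 := by
  refine ⟨algebraMap ℝ R (Nat.factorial 2 : ℝ)⁻¹ • ∑ i : Fin 2 → Fin D.n,
    P (D.ε ∘ i) • ιMulti R 2 (D.e ∘ i), ?_, ?_, fun n hn => ?_⟩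
  · refine Submodule.smul_mem _ _ (Submodule.sum_mem _ fun i _ => Submodule.smul_mem _ _ ?_)
    rw [ιMulti_succ_apply, ιMulti_succ_apply, ιMulti_zero_apply, mul_one]
    exact Submodule.subset_span ⟨(_, _), rfl⟩
  · have h1 : algebraMap ℝ R (Nat.factorial 2 : ℝ)⁻¹ * (Nat.factorial 2 : R) = 1 := by
      rw [← map_natCast (algebraMap ℝ R), ← map_mul, inv_mul_cancel₀, map_one]
      exact_mod_cast Nat.factorial_ne_zero 2
    rw [map_smul, map_sum]
    simp_rw [map_smul]
    rw [toForm_sum_smul, smul_smul, ← mul_assoc, h1, one_mul]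
  · rw [map_smul, map_sum]
    simp_rw [map_smul, toForm_ιMulti_of_ne β (Ne.symm hn)]
    simp

theorem exists_bivector_differential (hF : HasDualFrameNear β S) (X : L) :
    ∃ w ∈ bivectors R L, ∃ h ∈ S, h • toForm β 2 w = h • B.differential (toForm β 1 (ι R X)) ∧
      ∀ n, n ≠ 2 → toForm β n w = 0 := by
  obtain ⟨g, h, hS, hg, ⟨D⟩⟩ := hF
  obtain ⟨w, hw, h2, h0⟩ := exists_bivector_toForm D (B.differential (toForm β 1 (ι R X)))
  exact ⟨w, hw, h, hS, by rw [h2, smul_smul, mul_pow_eq hg], h0⟩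

theorem isDifferentialNear_ι {X : L} {w : ExteriorAlgebra R L} {h : R} (hS : h ∈ S)
    (h2 : h • toForm β 2 w = h • B.differential (toForm β 1 (ι R X)))
    (h0 : ∀ n, n ≠ 2 → toForm β n w = 0) : IsDifferentialNear B β S (ι R X) w := by
  refine ⟨h, hS, by rw [h0 0 (by decide), smul_zero], fun k => ?_⟩
  by_cases hk : k = 1
  · subst hk; exact h2
  · rw [h0 _ (by omega), toForm_ι_of_ne β hk, differential_zero]

theorem exists_isDifferentialNear_ι (hF : HasDualFrameNear β S) (X : L) :
    ∃ w ∈ bivectors R L, IsDifferentialNear B β S (ι R X) w := by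
  obtain ⟨w, hw, h, hS, h2, h0⟩ := exists_bivector_differential (B := B) hF X
  exact ⟨w, hw, isDifferentialNear_ι hS h2 h0⟩

/-- The Leibniz rule reduces existence to generators. The frame is needed for sections only: on
functions, d_*f is already a section. -/
theorem exists_isDifferentialNear (hβ : Function.Bijective β.flip) (hF : HasDualFrameNear β S)
    (u : ExteriorAlgebra R L) : ∃ u', IsDifferentialNear B β S u u' := by
  induction u using exterior_induction with
  | algebraMap f => exact ⟨_, isDifferentialNear_algebraMap hβ f⟩
  | add u v hu hv =>
    obtain ⟨u', hu⟩ := hu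
    obtain ⟨v', hv⟩ := hv
    exact ⟨_, hu.add hv⟩
  | ι_mul X v hv =>
    obtain ⟨v', hv⟩ := hv
    obtain ⟨w, hw, hX⟩ := exists_isDifferentialNear_ι (B := B) hF X
    exact ⟨_, hX.ι_mul hβ hw hv⟩

/-- The differential raises the degree by one, so it anticommutes with the grade involution. -/
theorem IsDifferentialNear.gradeInv (hβ : Function.Bijective β.flip) (hF : HasDualFrameNear β S)
    {u u' : ExteriorAlgebra R L} (hu : IsDifferentialNear B β S u u') :
    IsDifferentialNear B β S (gradeInv u) (-LieRinehartStr.gradeInv u') := by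
  -- Representatives of a differential agree up to a factor in `S`, so one convenient
  -- representative, built along the induction, is enough. The rules for products and brackets below
  -- use the same reduction.
  suffices h : ∃ u'', IsDifferentialNear B β S u u'' ∧
      IsDifferentialNear B β S (LieRinehartStr.gradeInv u) (-LieRinehartStr.gradeInv u'') by
    obtain ⟨u'', h1, h2⟩ := h
    obtain ⟨t, ht, h3⟩ := h1.unique hF hu
    refine h2.congr ht ?_
    rw [neg_sub_neg, ← map_sub, ← map_smul, ← neg_sub, smul_neg, h3, neg_zero, map_zero]
  clear hu
  induction u using exterior_induction with
  | algebraMap f =>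
    refine ⟨_, isDifferentialNear_algebraMap hβ f, ?_⟩
    rw [gradeInv_algebraMap, gradeInv_ι, neg_neg]
    exact isDifferentialNear_algebraMap hβ f
  | add u v hu hv =>
    obtain ⟨u'', h1, h2⟩ := hu
    obtain ⟨v'', h3, h4⟩ := hv
    refine ⟨_, h1.add h3, ?_⟩
    rw [map_add, map_add, neg_add]
    exact h2.add h4
  | ι_mul X v hv =>
    obtain ⟨v'', h1, h2⟩ := hv
    obtain ⟨w, hw, hX⟩ := exists_isDifferentialNear_ι (B := B) hF X
    refine ⟨_, hX.ι_mul hβ hw h1, ?_⟩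
    rw [gradeInv_ι_mul]
    convert (hX.ι_mul hβ hw h2).neg using 1
    rw [map_sub, map_mul, gradeInv_bivector hw, gradeInv_ι_mul, mul_neg]

/-- Induction on the first factor: a scalar is d(fv) = f dv + df ∧ v, and each further section is
one use of `IsDifferentialNear.ι_mul`. -/
theorem IsDifferentialNear.mul (hβ : Function.Bijective β.flip) (hF : HasDualFrameNear β S)
    {u u' v v' : ExteriorAlgebra R L} (hu : IsDifferentialNear B β S u u')
    (hv : IsDifferentialNear B β S v v') :
    IsDifferentialNear B β S (u * v) (u' * v + LieRinehartStr.gradeInv u * v') := by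
  suffices h : ∀ v v', IsDifferentialNear B β S v v' → ∃ u'', IsDifferentialNear B β S u u'' ∧
      IsDifferentialNear B β S (u * v) (u'' * v + LieRinehartStr.gradeInv u * v') by
    obtain ⟨u'', h1, h2⟩ := h v v' hv
    obtain ⟨t, ht, h3⟩ := h1.unique hF hu
    refine h2.congr ht ?_
    rw [add_sub_add_right_eq_sub, ← sub_mul, ← smul_mul_assoc, h3, zero_mul]
  clear hv hu u'
  intro v v' hv
  induction u using exterior_induction generalizing v v' with
  | algebraMap f =>
    refine ⟨_, isDifferentialNear_algebraMap hβ f, ?_⟩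
    obtain ⟨h, hS, h0, h1⟩ := hv
    rw [gradeInv_algebraMap, ← Algebra.smul_def, ← Algebra.smul_def]
    refine ⟨h, hS, ?_, fun k => ?_⟩
    · rw [map_add, map_smul, toForm_zero_ι_mul, zero_add, smul_comm, h0, smul_zero]
    · rw [differential_toForm_smul B hβ, map_add, map_smul, smul_add, smul_comm h f, h1, smul_add,
        smul_comm h f]
      exact add_comm _ _
  | add u₁ u₂ hu₁ hu₂ =>
    obtain ⟨a, h1, h2⟩ := hu₁ v v' hv
    obtain ⟨b, h3, h4⟩ := hu₂ v v' hv
    refine ⟨_, h1.add h3, ?_⟩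
    convert h2.add h4 using 1 <;> rw [add_mul]
    rw [map_add]
    noncomm_ring
  | ι_mul X u hu =>
    obtain ⟨a, h1, h2⟩ := hu v v' hv
    obtain ⟨w, hw, hX⟩ := exists_isDifferentialNear_ι (B := B) hF X
    refine ⟨_, hX.ι_mul hβ hw h1, ?_⟩
    rw [mul_assoc, gradeInv_ι_mul]
    convert hX.ι_mul hβ hw h2 using 1
    noncomm_ring

end Near

/-! ### The derivation property: from generators to the whole exterior algebra -/

section Derivation

variable {R L L' : Type*} [CommRing R] [Algebra ℝ R] [AddCommGroup L] [Module ℝ L] [Module R L]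
  [AddCommGroup L'] [Module ℝ L'] [Module R L'] [IsScalarTower ℝ R L']
  {A : LieRinehartStr R L} {B : LieRinehartStr R L'} {β : L' →ₗ[R] L →ₗ[R] R} {S : Submonoid R}

/-- The differential is a derivation of the Schouten bracket of functions and sections. -/
structure IsCompatibleNear (A : LieRinehartStr R L) (B : LieRinehartStr R L')
    (β : L' →ₗ[R] L →ₗ[R] R) (hβ : Function.Bijective β.flip) (S : Submonoid R) : Prop where
  fn_fn : ∀ f g, A.anchor (B.coDiff hβ f) g + A.anchor (B.coDiff hβ g) f = 0
  section_fn : ∀ (X : L) (w : ExteriorAlgebra R L) (f : R), w ∈ bivectors R L →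
    IsDifferentialNear B β S (ι R X) w → IsDifferentialNear B β S (algebraMap R _ (A.anchor X f))
      (A.lieDeriv X (ι R (B.coDiff hβ f)) + A.fnBracket f w)
  section_section : ∀ (X Y : L) (w w' : ExteriorAlgebra R L), w ∈ bivectors R L →
    w' ∈ bivectors R L → IsDifferentialNear B β S (ι R X) w → IsDifferentialNear B β S (ι R Y) w' →
    IsDifferentialNear B β S (ι R (A.bracket X Y)) (A.lieDeriv X w' - A.lieDeriv Y w)

theorem smul_schoutenAlg_sub_left {t : R} {u u' : ExteriorAlgebra R L} (h : t • (u - u') = 0)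
    (v : ExteriorAlgebra R L) : (t * t) • (A.schoutenAlg u v - A.schoutenAlg u' v) = 0 := by
  rw [← schoutenAlg_sub_left]
  exact A.schoutenAlg_local_left h v

theorem smul_schoutenAlg_sub_right {t : R} {v v' : ExteriorAlgebra R L} (h : t • (v - v') = 0)
    (u : ExteriorAlgebra R L) : (t * t) • (A.schoutenAlg u v - A.schoutenAlg u v') = 0 := by
  rw [← schoutenAlg_sub_right]
  exact A.schoutenAlg_local_right h u

/-- Both sides obey the same Leibniz rule in `v`. The field `section_fn` starts the induction, and
`section_section` accounts for each further section factor. -/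
theorem IsCompatibleNear.lieDeriv {hβ : Function.Bijective β.flip}
    (hc : IsCompatibleNear A B β hβ S) (hF : HasDualFrameNear β S) {X : L}
    {w v v' : ExteriorAlgebra R L} (hw : w ∈ bivectors R L)
    (hX : IsDifferentialNear B β S (ι R X) w) (hv : IsDifferentialNear B β S v v') :
    IsDifferentialNear B β S (A.lieDeriv X v) (A.schoutenAlg w v + A.lieDeriv X v') := by
  suffices h : ∃ v'', IsDifferentialNear B β S v v'' ∧
      IsDifferentialNear B β S (A.lieDeriv X v) (A.schoutenAlg w v + A.lieDeriv X v'') by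
    obtain ⟨v'', h1, h2⟩ := h
    obtain ⟨t, ht, h3⟩ := h1.unique hF hv
    refine h2.congr (S.mul_mem ht ht) ?_
    rw [add_sub_add_left_eq_sub, ← schoutenAlg_ι, ← schoutenAlg_ι]
    exact smul_schoutenAlg_sub_right h3 _
  clear hv v'
  induction v using exterior_induction with
  | algebraMap f =>
    refine ⟨_, isDifferentialNear_algebraMap hβ f, ?_⟩
    rw [lieDeriv_algebraMap, schoutenAlg_algebraMap_right, gradeInv_bivector hw, add_comm]
    exact hc.section_fn X w f hw hX
  | add u v hu hv =>
    obtain ⟨a, h1, h2⟩ := hu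
    obtain ⟨b, h3, h4⟩ := hv
    refine ⟨_, h1.add h3, ?_⟩
    rw [(A.isDerivationOver_lieDeriv X).add, (A.isDerivationOver_lieDeriv X).add,
      schoutenAlg_add_right, add_add_add_comm]
    exact h2.add h4
  | ι_mul Y v hv =>
    obtain ⟨v', h1, h2⟩ := hv
    obtain ⟨y, hy, hY⟩ := exists_isDifferentialNear_ι (B := B) hF Y
    refine ⟨_, hY.ι_mul hβ hy h1, ?_⟩
    rw [lieDeriv_ι_mul]
    convert ((hc.section_section X Y w y hw hy hX hY).mul hβ hF h1).add (hY.ι_mul hβ hy h2) using 1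
    rw [(A.isDerivationOver_lieDeriv X).sub, lieDeriv_mul, lieDeriv_ι_mul, schoutenAlg_mul_ι,
      schoutenAlg_ι_right, gradeInv_bivector hw, gradeInv_ι]
    noncomm_ring

/-- The derivation rule in degree p = 0, whence the sign. The field `fn_fn` starts the induction on
`v`; each section factor Y uses `section_fn`, because [f, Y ∧ v] contains the term -(a(Y)f) v. -/
theorem IsCompatibleNear.fnBracket {hβ : Function.Bijective β.flip}
    (hc : IsCompatibleNear A B β hβ S) (hF : HasDualFrameNear β S) (f : R)
    {v v' : ExteriorAlgebra R L} (hv : IsDifferentialNear B β S v v') :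
    IsDifferentialNear B β S (A.fnBracket f v)
      (A.lieDeriv (B.coDiff hβ f) v - A.fnBracket f v') := by
  suffices h : ∃ v'', IsDifferentialNear B β S v v'' ∧
      IsDifferentialNear B β S (A.fnBracket f v)
        (A.lieDeriv (B.coDiff hβ f) v - A.fnBracket f v'') by
    obtain ⟨v'', h1, h2⟩ := h
    obtain ⟨t, ht, h3⟩ := h1.unique hF hv
    refine h2.congr ht ?_
    rw [sub_sub_sub_cancel_left, fnBracket_eq, fnBracket_eq, neg_sub_neg, ← map_sub, ← map_smul, h3,
      map_zero]
  clear hv v'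
  induction v using exterior_induction with
  | algebraMap g =>
    refine ⟨_, isDifferentialNear_algebraMap hβ g, ?_⟩
    rw [fnBracket_algebraMap, fnBracket_eq, contr_ι, lieDeriv_algebraMap, sub_neg_eq_add, ← map_add,
      d₀_apply, hc.fn_fn, map_zero]
    simpa using (isDifferentialNear_algebraMap (B := B) (S := S) hβ 0).sub
      (isDifferentialNear_algebraMap hβ 0)
  | add u v hu hv =>
    obtain ⟨a, h1, h2⟩ := hu
    obtain ⟨b, h3, h4⟩ := hv
    refine ⟨_, h1.add h3, ?_⟩
    convert h2.add h4 using 1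
    · exact A.fnBracket_add _ _ _
    · rw [(A.isDerivationOver_lieDeriv _).add, fnBracket_add]
      abel
  | ι_mul Y v hv =>
    obtain ⟨v', h1, h2⟩ := hv
    obtain ⟨y, hy, hY⟩ := exists_isDifferentialNear_ι (B := B) hF Y
    refine ⟨_, hY.ι_mul hβ hy h1, ?_⟩
    rw [fnBracket_ι_mul, Algebra.smul_def]
    convert ((hc.section_fn Y y f hy hY).mul hβ hF h1).neg.sub (hY.ι_mul hβ hy h2) using 1
    rw [gradeInv_algebraMap, lieDeriv_ι_mul, lieDeriv_ι, A.bracket_neg Y, fnBracket_eq,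
      fnBracket_eq, fnBracket_eq, fnBracket_eq, map_sub, contr_mul, contr_ι_mul,
      gradeInv_bivector hy, Algebra.smul_def, map_neg, d₀_apply]
    noncomm_ring

/-- The differential is a derivation of the Schouten bracket if it is one on the generators. -/
theorem IsCompatibleNear.schoutenAlg {hβ : Function.Bijective β.flip}
    (hc : IsCompatibleNear A B β hβ S) (hF : HasDualFrameNear β S)
    {u u' v v' : ExteriorAlgebra R L} (hu : IsDifferentialNear B β S u u')
    (hv : IsDifferentialNear B β S v v') :
    IsDifferentialNear B β S (A.schoutenAlg u v)
      (A.schoutenAlg u' v - A.schoutenAlg (gradeInv u) v') := by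
  -- On elements of degree p, minus the grade involution is the sign (-1)^{p-1}; written in this way
  -- the rule makes sense for inhomogeneous `u`.
  suffices h : ∃ u'', IsDifferentialNear B β S u u'' ∧ IsDifferentialNear B β S (A.schoutenAlg u v)
      (A.schoutenAlg u'' v - A.schoutenAlg (gradeInv u) v') by
    obtain ⟨u'', h1, h2⟩ := h
    obtain ⟨t, ht, h3⟩ := h1.unique hF hu
    refine h2.congr (S.mul_mem ht ht) ?_
    rw [sub_sub_sub_cancel_right]
    exact smul_schoutenAlg_sub_left h3 _
  clear hu u'
  induction u using exterior_induction with
  | algebraMap f =>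
    refine ⟨_, isDifferentialNear_algebraMap hβ f, ?_⟩
    rw [gradeInv_algebraMap, schoutenAlg_ι]
    convert hc.fnBracket hF f hv using 1
    · exact A.schoutenAlg_algebraMap _ _
    · rw [schoutenAlg_algebraMap]
  | add u₁ u₂ hu₁ hu₂ =>
    obtain ⟨a, h1, h2⟩ := hu₁
    obtain ⟨b, h3, h4⟩ := hu₂
    refine ⟨_, h1.add h3, ?_⟩
    rw [map_add, schoutenAlg_add_left, schoutenAlg_add_left, schoutenAlg_add_left,
      add_sub_add_comm]
    exact h2.add h4
  | ι_mul X u hu =>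
    obtain ⟨u', h1, h2⟩ := hu
    obtain ⟨w, hw, hX⟩ := exists_isDifferentialNear_ι (B := B) hF X
    refine ⟨_, hX.ι_mul hβ hw h1, ?_⟩
    -- Of the two terms of the Leibniz rule, X ∧ [u, v] is differentiated by the induction
    -- hypothesis and the product with [X, v] by `IsCompatibleNear.lieDeriv`.
    rw [schoutenAlg_ι_mul']
    convert (hX.ι_mul hβ hw h2).add ((h1.gradeInv hβ hF).mul hβ hF (hc.lieDeriv hF hw hX hv))
      using 1
    rw [schoutenAlg_sub_left, schoutenAlg_bivector_mul A hw, schoutenAlg_ι_mul', gradeInv_ι_mul,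
      schoutenAlg_neg_left, schoutenAlg_ι_mul', gradeInv_gradeInv]
    noncomm_ring

end Derivation

end LieRinehartStr

namespace LieRinehartStr

open ExteriorAlgebra

/-! ### The compatibility identities and their symmetry -/

section Compatible

variable {R L L' : Type*} [CommRing R] [Algebra ℝ R] [AddCommGroup L] [Module ℝ L] [Module R L]
  [IsScalarTower ℝ R L] [AddCommGroup L'] [Module ℝ L'] [Module R L'] [IsScalarTower ℝ R L']

/-- The value `dX(ξ, η)` of the differential of a section of the dual bundle. -/
def extDeriv (B : LieRinehartStr R L') (β : L' →ₗ[R] L →ₗ[R] R) (X : L) (ξ η : L') : R :=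
  B.anchor ξ (β η X) - B.anchor η (β ξ X) - β (B.bracket ξ η) X

/-- The derivation property of the differential on functions and sections, as identities between
functions. The pairing `β'` is `β`, with its arguments exchanged. -/
structure IsCompatible (A : LieRinehartStr R L) (B : LieRinehartStr R L')
    {β : L' →ₗ[R] L →ₗ[R] R} {β' : L →ₗ[R] L' →ₗ[R] R} (hβ : Function.Bijective β.flip)
    (hβ' : Function.Bijective β'.flip) : Prop where
  fn_fn : ∀ f g, A.anchor (B.coDiff hβ f) g + A.anchor (B.coDiff hβ g) f = 0
  section_fn : ∀ X f ξ, B.anchor ξ (A.anchor X f) = A.anchor X (B.anchor ξ f) -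
    B.anchor (A.coLie hβ' X ξ) f - extDeriv B β X (A.coDiff hβ' f) ξ
  section_section : ∀ X Y ξ η, extDeriv B β (A.bracket X Y) ξ η =
    (A.anchor X (extDeriv B β Y ξ η) - extDeriv B β Y (A.coLie hβ' X ξ) η -
      extDeriv B β Y ξ (A.coLie hβ' X η)) -
    (A.anchor Y (extDeriv B β X ξ η) - extDeriv B β X (A.coLie hβ' Y ξ) η -
      extDeriv B β X ξ (A.coLie hβ' Y η))

variable {A : LieRinehartStr R L} {B : LieRinehartStr R L'} {β : L' →ₗ[R] L →ₗ[R] R}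
  {β' : L →ₗ[R] L' →ₗ[R] R} {S : Submonoid R}

/-- Cartan's formula with the Lie derivative along the second argument; `extDeriv_eq'` has it along
the first. Having both allows `IsCompatible.symm` to avoid Lie derivatives along a section that is
itself a Lie derivative. -/
theorem extDeriv_eq (hβ : Function.Bijective β.flip) (X : L) (ξ η : L') :
    extDeriv B β X ξ η = B.anchor ξ (β η X) - β ξ (B.coLie hβ η X) := by
  rw [extDeriv, coLie_apply, B.bracket_neg ξ η, map_neg, LinearMap.neg_apply]
  ring

theorem extDeriv_eq' (hβ : Function.Bijective β.flip) (X : L) (ξ η : L') :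
    extDeriv B β X ξ η = β η (B.coLie hβ ξ X) - B.anchor η (β ξ X) := by
  rw [extDeriv, coLie_apply]
  ring

/-- The compatibility of the two structures is symmetric. -/
theorem IsCompatible.symm {hβ : Function.Bijective β.flip} {hβ' : Function.Bijective β'.flip}
    (hββ' : ∀ X ξ, β' X ξ = β ξ X) (hc : IsCompatible A B hβ hβ') : IsCompatible B A hβ' hβ := by
  have hL : ∀ X ξ Y, β (A.coLie hβ' X ξ) Y = A.anchor X (β ξ Y) - β ξ (A.bracket X Y) :=
    fun X ξ Y => by rw [← hββ', coLie_apply, hββ', hββ']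
  -- Both sides are ⟨df, d_*g⟩.
  have hsw : ∀ f g, B.anchor (A.coDiff hβ' f) g = A.anchor (B.coDiff hβ g) f := fun f g => by
    rw [← A.coDiff_apply hβ', hββ', B.coDiff_apply]
  -- The balanced form of `section_fn`: exchanging the structures changes the sign of the left-hand
  -- side, and, by `fn_fn`, of the right-hand side too.
  have hsf : ∀ X f ξ, B.anchor ξ (A.anchor X f) - A.anchor X (B.anchor ξ f) +
      B.anchor (A.coLie hβ' X ξ) f - A.anchor (B.coLie hβ ξ X) f =
        -A.anchor (B.coDiff hβ (β ξ X)) f := fun X f ξ => by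
    have h := hc.section_fn X f ξ
    rw [extDeriv_eq hβ, ← hββ' _ (A.coDiff hβ' f), coDiff_apply, hsw] at h
    linear_combination h
  refine ⟨fun f g => ?_, fun ξ f X => ?_, fun ξ η X Y => ?_⟩
  · have h := hc.fn_fn f g
    rw [hsw, hsw]
    linear_combination h
  · have h := hsf X f ξ
    have h1 := hc.fn_fn (β ξ X) f
    rw [extDeriv_eq hβ', hββ', hββ', coDiff_apply]
    linear_combination -h + h1
  · have h := hc.section_section X Y ξ η
    -- The third identity and its mirror image differ in the order of mixed terms such as
    -- a(X)b(ξ)⟨η, Y⟩. There is one such commutation for each choice of a section among X, Y and one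
    -- among ξ, η. The right-hand sides that arise cancel in pairs: `h1` with `h4` by `h5`, and `h2`
    -- with `h3` by `h6`.
    have h1 := hsf X (β η Y) ξ
    have h2 := hsf X (β ξ Y) η
    have h3 := hsf Y (β η X) ξ
    have h4 := hsf Y (β ξ X) η
    have h5 := hc.fn_fn (β ξ X) (β η Y)
    have h6 := hc.fn_fn (β ξ Y) (β η X)
    rw [extDeriv_eq hβ Y (A.coLie hβ' X ξ), extDeriv_eq' hβ Y ξ (A.coLie hβ' X η),
      extDeriv_eq hβ X (A.coLie hβ' Y ξ), extDeriv_eq' hβ X ξ (A.coLie hβ' Y η)] at h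
    rw [extDeriv_eq hβ' η (B.coLie hβ ξ X), extDeriv_eq' hβ' η X (B.coLie hβ ξ Y),
      extDeriv_eq hβ' ξ (B.coLie hβ η X), extDeriv_eq' hβ' ξ X (B.coLie hβ η Y)]
    simp only [extDeriv, map_sub, hββ'] at h ⊢
    linear_combination h - h1 + h2 + h3 - h4 + h5 - h6

end Compatible
end LieRinehartStr

namespace LieRinehartStr

open ExteriorAlgebra

/-! ### From the identities between functions to the exterior algebra -/

section Evaluation

variable {R L L' : Type*} [CommRing R] [Algebra ℝ R] [AddCommGroup L] [Module ℝ L] [Module R L]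
  [IsScalarTower ℝ R L] [AddCommGroup L'] [Module ℝ L'] [Module R L'] [IsScalarTower ℝ R L']
  {A : LieRinehartStr R L} {B : LieRinehartStr R L'} {β : L' →ₗ[R] L →ₗ[R] R}
  {β' : L →ₗ[R] L' →ₗ[R] R} {S : Submonoid R}

theorem anchor_eq_of_mul_eq (X : L) {h f g : R} (hfg : h * f = h * g) :
    h * h * A.anchor X f = h * h * A.anchor X g := by
  have h1 := A.anchor_mul X h f
  have h2 := A.anchor_mul X h g
  rw [hfg] at h1
  linear_combination h * h2 - h * h1 - A.anchor X h * hfg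

theorem differential_toForm_ι (hβ : Function.Bijective β.flip) (X : L) (ξ η : L') :
    B.differential (toForm β 1 (ι R X)) ![ξ, η] = extDeriv B β X ξ η := by
  refine (differential_toForm_succ B hβ 0 ξ (ι R X) ![η]).trans ?_
  rw [(B.isDerivationOver_coLieDeriv hβ ξ).ι (B.anchor ξ).map_one_eq_zero, toForm_one_ι, contr_ι,
    differential_apply_zero, toForm_zero_algebraMap, extDeriv_eq' hβ]
  rfl

theorem toForm_lieDeriv (hβ' : Function.Bijective β'.flip) (hββ' : ∀ X ξ, β' X ξ = β ξ X) (k : ℕ)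
    (X : L) (u : ExteriorAlgebra R L) (ξ : Fin k → L') :
    toForm β k (A.lieDeriv X u) ξ = A.anchor X (toForm β k u ξ) -
      ∑ j, toForm β k u (Function.update ξ j (A.coLie hβ' X (ξ j))) :=
  (A.isDerivationOver_lieDeriv X).toForm (A.anchor_mul X) β
    (fun ξ Y => by rw [← hββ', coLie_apply, hββ', hββ']) k u ξ

theorem smul_toForm_lieDeriv_eq_zero (hβ' : Function.Bijective β'.flip)
    (hββ' : ∀ X ξ, β' X ξ = β ξ X) {k : ℕ} {u : ExteriorAlgebra R L} {h : R}
    (hu : h • toForm β k u = 0) (X : L) : (h * h) • toForm β k (A.lieDeriv X u) = 0 := by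
  have h0 : ∀ ξ, h * toForm β k u ξ = 0 := fun ξ =>
    congrArg (fun P : L' [⋀^Fin k]→ₗ[R] R => P ξ) hu
  ext ξ
  have h1 := anchor_eq_of_mul_eq (A := A) X ((h0 ξ).trans (mul_zero h).symm)
  rw [AlternatingMap.smul_apply, toForm_lieDeriv hβ' hββ', smul_eq_mul, mul_sub, h1,
    Finset.mul_sum]
  simp [mul_assoc, h0]

/-- The form of `w` may be replaced by dY after multiplication by h, also under the anchor:
differentiating the equality of the multiples costs one more factor h. -/
theorem smul_toForm_two_lieDeriv (hβ : Function.Bijective β.flip)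
    (hβ' : Function.Bijective β'.flip) (hββ' : ∀ X ξ, β' X ξ = β ξ X) {Y : L}
    {w : ExteriorAlgebra R L} {h : R}
    (hw : h • toForm β 2 w = h • B.differential (toForm β 1 (ι R Y))) (X : L) (ξ η : L') :
    h * h * toForm β 2 (A.lieDeriv X w) ![ξ, η] = h * h * (A.anchor X (extDeriv B β Y ξ η) -
      extDeriv B β Y (A.coLie hβ' X ξ) η - extDeriv B β Y ξ (A.coLie hβ' X η)) := by
  have h0 : ∀ ξ η, h * toForm β 2 w ![ξ, η] = h * extDeriv B β Y ξ η := fun ξ η => by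
    rw [← differential_toForm_ι hβ]
    exact congrArg (fun P : L' [⋀^Fin 2]→ₗ[R] R => P ![ξ, η]) hw
  have h1 := anchor_eq_of_mul_eq (A := A) X (h0 ξ η)
  have e0 : Function.update ![ξ, η] 0 (A.coLie hβ' X ξ) = ![A.coLie hβ' X ξ, η] := by
    ext i; fin_cases i <;> rfl
  have e1 : Function.update ![ξ, η] 1 (A.coLie hβ' X η) = ![ξ, A.coLie hβ' X η] := by
    ext i; fin_cases i <;> rfl
  rw [toForm_lieDeriv hβ' hββ', Fin.sum_univ_two]
  simp only [Matrix.cons_val_zero, Matrix.cons_val_one, e0, e1]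
  linear_combination h1 - h * h0 (A.coLie hβ' X ξ) η - h * h0 ξ (A.coLie hβ' X η)

/-- The bracket with f is minus the contraction with df, and contraction fills the first argument.
-/
theorem toForm_fnBracket (hβ' : Function.Bijective β'.flip) (hββ' : ∀ X ξ, β' X ξ = β ξ X)
    (k : ℕ) (f : R) (u : ExteriorAlgebra R L) (ζ : Fin k → L') :
    toForm β k (A.fnBracket f u) ζ = -toForm β (k + 1) u (Fin.cons (A.coDiff hβ' f) ζ) := by
  have h1 : A.d₀ f = β (A.coDiff hβ' f) := by
    ext X
    rw [← hββ', coDiff_apply, d₀_apply]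
  rw [fnBracket_eq, h1, map_neg, toForm_cons]
  rfl

theorem toForm_one_lieDeriv_coDiff (hβ : Function.Bijective β.flip)
    (hβ' : Function.Bijective β'.flip) (hββ' : ∀ X ξ, β' X ξ = β ξ X) (X : L) (f : R) (ξ : L') :
    toForm β 1 (A.lieDeriv X (ι R (B.coDiff hβ f))) ![ξ] =
      A.anchor X (B.anchor ξ f) - B.anchor (A.coLie hβ' X ξ) f := by
  rw [toForm_lieDeriv hβ' hββ', Fin.sum_univ_one, toForm_one_ι, toForm_one_ι, coDiff_apply,
    coDiff_apply]
  rfl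

theorem smul_toForm_one_bracket (hβ : Function.Bijective β.flip)
    (hβ' : Function.Bijective β'.flip) (hββ' : ∀ X ξ, β' X ξ = β ξ X) {X : L}
    {w : ExteriorAlgebra R L} {h : R}
    (hw : h • toForm β 2 w = h • B.differential (toForm β 1 (ι R X))) (f : R) (ξ : L') :
    h * toForm β 1 (A.lieDeriv X (ι R (B.coDiff hβ f)) + A.fnBracket f w) ![ξ] =
      h * (A.anchor X (B.anchor ξ f) - B.anchor (A.coLie hβ' X ξ) f -
        extDeriv B β X (A.coDiff hβ' f) ξ) := by
  have h0 : h * toForm β 2 w (Fin.cons (A.coDiff hβ' f) ![ξ]) =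
      h * extDeriv B β X (A.coDiff hβ' f) ξ := by
    rw [← differential_toForm_ι hβ]
    exact congrArg (fun P : L' [⋀^Fin 2]→ₗ[R] R => P ![A.coDiff hβ' f, ξ]) hw
  rw [map_add, AlternatingMap.add_apply, toForm_one_lieDeriv_coDiff hβ hβ' hββ',
    toForm_fnBracket hβ' hββ']
  linear_combination -h0

theorem IsDifferentialNear.toForm_ι {X : L} {w : ExteriorAlgebra R L}
    (hX : IsDifferentialNear B β S (ι R X) w) :
    ∃ h ∈ S, h • toForm β 2 w = h • B.differential (toForm β 1 (ι R X)) ∧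
      ∀ n, n ≠ 2 → h • toForm β n w = 0 := by
  obtain ⟨h, hS, h0, h1⟩ := hX
  refine ⟨h, hS, h1 1, fun n hn => ?_⟩
  rcases n with _ | n
  · exact h0
  · rw [h1, toForm_ι_of_ne β (by omega), differential_zero, smul_zero]

/-- The function identities settle the component in the expected degree. Since `IsDifferentialNear`
concerns every degree, the other components must also be shown to vanish up to a factor. -/
theorem IsCompatible.near {hβ : Function.Bijective β.flip} {hβ' : Function.Bijective β'.flip}
    (hββ' : ∀ X ξ, β' X ξ = β ξ X) (hc : IsCompatible A B hβ hβ') :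
    IsCompatibleNear A B β hβ S where
  fn_fn := hc.fn_fn
  section_fn X w f hw hX := by
    obtain ⟨h, hS, h2, h0⟩ := hX.toForm_ι
    have hz : ∀ k, k ≠ 1 →
        h • toForm β k (A.lieDeriv X (ι R (B.coDiff hβ f)) + A.fnBracket f w) = 0 := fun k hk => by
      ext ζ
      have h1 := congrArg (fun P : L' [⋀^Fin (k + 1)]→ₗ[R] R => P (Fin.cons (A.coDiff hβ' f) ζ))
        (h0 (k + 1) (by omega))
      simp only [AlternatingMap.smul_apply, AlternatingMap.zero_apply, smul_eq_mul] at h1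
      rw [lieDeriv_ι, map_add, toForm_ι_of_ne β hk, zero_add, AlternatingMap.smul_apply,
        toForm_fnBracket hβ' hββ', smul_eq_mul, mul_neg, h1]
      simp
    refine ⟨h, hS, hz 0 (by decide), fun k => ?_⟩
    rcases k with _ | k
    · ext ξ
      obtain ⟨η, rfl⟩ : ∃ η, ξ = ![η] := ⟨ξ 0, by ext i; fin_cases i; rfl⟩
      rw [AlternatingMap.smul_apply, AlternatingMap.smul_apply, differential_apply_zero,
        toForm_zero_algebraMap, smul_eq_mul, smul_eq_mul]
      refine (smul_toForm_one_bracket hβ hβ' hββ' h2 f η).trans ?_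
      rw [← hc.section_fn]
      rfl
    · rw [hz _ (by omega), toForm_algebraMap_of_ne β (by omega), differential_zero, smul_zero]
  section_section X Y w w' hw hw' hX hY := by
    obtain ⟨h, hS, h2, h0⟩ := hX.toForm_ι
    obtain ⟨t, tS, t2, t0⟩ := hY.toForm_ι
    have hz : ∀ k, k ≠ 2 →
        (h * h * (t * t)) • toForm β k (A.lieDeriv X w' - A.lieDeriv Y w) = 0 := fun k hk => by
      rw [map_sub, smul_sub, mul_smul, smul_toForm_lieDeriv_eq_zero hβ' hββ' (t0 k hk),
        mul_comm (h * h), mul_smul (t * t), smul_toForm_lieDeriv_eq_zero hβ' hββ' (h0 k hk),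
        smul_zero, smul_zero, sub_zero]
    refine ⟨h * h * (t * t), S.mul_mem (S.mul_mem hS hS) (S.mul_mem tS tS), hz 0 (by decide),
      fun k => ?_⟩
    by_cases hk : k = 1
    · subst hk
      ext ξ
      obtain ⟨η, ζ, rfl⟩ : ∃ η ζ, ξ = ![η, ζ] := ⟨ξ 0, ξ 1, by ext i; fin_cases i <;> rfl⟩
      have e1 := smul_toForm_two_lieDeriv (A := A) hβ hβ' hββ' h2 Y η ζ
      have e2 := smul_toForm_two_lieDeriv (A := A) hβ hβ' hββ' t2 X η ζ
      rw [AlternatingMap.smul_apply, AlternatingMap.smul_apply, differential_toForm_ι hβ,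
        hc.section_section, map_sub, AlternatingMap.sub_apply, smul_eq_mul, smul_eq_mul]
      linear_combination h * h * e2 - t * t * e1
    · rw [hz _ (by omega), toForm_ι_of_ne β hk, differential_zero, smul_zero]

end Evaluation
end LieRinehartStr

/-! ### Lie bialgebroids on a manifold -/

section LieBialgebroid

open LieRinehartStr

variable {E : Type*} [NormedAddCommGroup E] [NormedSpace ℝ E] [FiniteDimensional ℝ E]
  {M : Type*} [TopologicalSpace M] [ChartedSpace E M] [IsManifold 𝓘(ℝ, E) ∞ M] [T2Space M]
  {F : Type*} [NormedAddCommGroup F] [NormedSpace ℝ F] [FiniteDimensional ℝ F]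
  {V : M → Type*} [TopologicalSpace (TotalSpace F V)] [∀ x, AddCommGroup (V x)]
  [∀ x, Module ℝ (V x)] [∀ x, TopologicalSpace (V x)] [FiberBundle F V] [VectorBundle ℝ F V]
  [ContMDiffVectorBundle ∞ F V 𝓘(ℝ, E)]
  {F' : Type*} [NormedAddCommGroup F'] [NormedSpace ℝ F'] [FiniteDimensional ℝ F']
  {W : M → Type*} [TopologicalSpace (TotalSpace F' W)] [∀ x, AddCommGroup (W x)]
  [∀ x, Module ℝ (W x)] [∀ x, TopologicalSpace (W x)] [FiberBundle F' W] [VectorBundle ℝ F' W]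
  [ContMDiffVectorBundle ∞ F' W 𝓘(ℝ, E)]

namespace DualPairing

theorem flip_onSections (κ : DualPairing E F V F' W) (X : Cₛ^∞⟮𝓘(ℝ, E); F, V⟯)
    (ξ : Cₛ^∞⟮𝓘(ℝ, E); F', W⟯) : κ.flip.onSections X ξ = κ.onSections ξ X := rfl

/-- Two elements of the fibre agree if they have the same pairing with all sections. -/
theorem fiber_ext (κ : DualPairing E F V F' W) {x : M} {a b : W x}
    (h : ∀ X : Cₛ^∞⟮𝓘(ℝ, E); F, V⟯, κ.pairing x a (X x) = κ.pairing x b (X x)) : a = b := by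
  refine sub_eq_zero.1 ((κ.nondegenerate x).1 _ fun v => ?_)
  obtain ⟨X, rfl⟩ := exists_section_eq (E := E) (F := F) x v
  rw [map_sub, LinearMap.sub_apply, h, sub_self]

/-- A linear form on the sections is represented, near every point, by a section of the dual
bundle. -/
theorem exists_section_near (κ : DualPairing E F V F' W)
    (φ : Module.Dual C^∞⟮𝓘(ℝ, E), M; ℝ⟯ Cₛ^∞⟮𝓘(ℝ, E); F, V⟯) (x : M) :
    ∃ σ : Cₛ^∞⟮𝓘(ℝ, E); F', W⟯, ∀ᶠ y in 𝓝 x, ∀ X, κ.pairing y (σ y) (X y) = φ X y := by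
  obtain ⟨g, h, hx, hg, ⟨D⟩⟩ := κ.exists_dualFrame x
  -- The expansion of φ in the dual frame represents g φ, and g = 1 wherever h does not vanish.
  refine ⟨∑ i, φ (D.e i) • D.ε i, ?_⟩
  have hx' : h x ≠ 0 := by rw [hx]; exact one_ne_zero
  filter_upwards [(isOpen_ne.preimage h.contMDiff.continuous).mem_nhds hx'] with y hy X
  have h1 : κ.onSections (∑ i, φ (D.e i) • D.ε i) X = g * φ X := by
    rw [← smul_eq_mul, ← map_smul, D.left X, map_sum, map_sum, LinearMap.sum_apply]
    refine Finset.sum_congr rfl fun i _ => ?_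
    rw [map_smul, map_smul, LinearMap.smul_apply, smul_eq_mul, smul_eq_mul, mul_comm]
  have h2 := congrArg (fun f : C^∞⟮𝓘(ℝ, E), M; ℝ⟯ => f y) h1
  have h3 := congrArg (fun f : C^∞⟮𝓘(ℝ, E), M; ℝ⟯ => f y) hg
  change h y * g y = h y at h3
  have h4 : g y = 1 := mul_left_cancel₀ hy (h3.trans (mul_one _).symm)
  refine h2.trans ?_
  change g y * φ X y = φ X y
  rw [h4, one_mul]

/-- Local representatives of φ have equal values wherever they represent it, by fibrewise
nondegeneracy, so they glue: the section takes at x the value of the representative chosen at x.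
This is what makes d_*f and L_ξ X global sections. -/
theorem onSections_bijective (κ : DualPairing E F V F' W) :
    Function.Bijective κ.onSections := by
  refine ⟨fun ξ η h => κ.section_ext fun X => by rw [h], fun φ => ?_⟩
  choose σ hσ using κ.exists_section_near φ
  refine ⟨⟨fun x => σ x x, fun x => ?_⟩, ?_⟩
  · refine (σ x).contMDiff.contMDiffAt.congr_of_eventuallyEq ?_
    filter_upwards [hσ x] with y hy
    refine congrArg (TotalSpace.mk' F' y) (κ.fiber_ext fun X => ?_)
    rw [hy X, (hσ y).self_of_nhds X]
  · ext X x
    exact (hσ x).self_of_nhds X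

theorem onSections_flip_bijective (κ : DualPairing E F V F' W) :
    Function.Bijective κ.onSections.flip := κ.flip.onSections_bijective

end DualPairing

/-- The functions which do not vanish at `x`. -/
def nonvanishingAt (E : Type*) [NormedAddCommGroup E] [NormedSpace ℝ E] {M : Type*}
    [TopologicalSpace M] [ChartedSpace E M] (x : M) : Submonoid C^∞⟮𝓘(ℝ, E), M; ℝ⟯ where
  carrier := {h | h x ≠ 0}
  one_mem' := one_ne_zero
  mul_mem' := fun {a b} (ha : a x ≠ 0) (hb : b x ≠ 0) => mul_ne_zero ha hb

theorem eval_eq_of_mul_eq {x : M} {h f g : C^∞⟮𝓘(ℝ, E), M; ℝ⟯} (hx : h x ≠ 0)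
    (hfg : h * f = h * g) : f x = g x :=
  mul_left_cancel₀ hx (congrArg (fun f : C^∞⟮𝓘(ℝ, E), M; ℝ⟯ => f x) hfg)

variable {A : LieAlgebroid E F V} {B : LieAlgebroid E F' W} {κ : DualPairing E F V F' W}

theorem DualPairing.hasDualFrameNear (κ : DualPairing E F V F' W) (x : M) :
    HasDualFrameNear κ.onSections (nonvanishingAt E x) := by
  obtain ⟨g, h, hx, hg, hD⟩ := κ.exists_dualFrame x
  exact ⟨g, h, by change h x ≠ 0; rw [hx]; exact one_ne_zero, hg, hD⟩

/-- The differential is local, so it may be computed from a representative near x, at the cost of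
squaring the factor h. -/
theorem RepresentsAt.differential {x : M} {k : ℕ} {P : Multisection E F' W k} {u u'}
    (hu : RepresentsAt κ x P u)
    (hu' : IsDifferentialNear B.toLieRinehart κ.onSections (nonvanishingAt E x) u u') :
    RepresentsAt κ x (B.toLieRinehart.differential P) u' := by
  obtain ⟨h, hx, h1, h2⟩ := hu
  obtain ⟨t, tx, t0, t1⟩ := hu'
  refine ⟨h * h * t, mul_ne_zero (mul_ne_zero hx hx) tx, ?_, fun n hn => ?_⟩
  · rw [mul_smul, t1, smul_comm, B.toLieRinehart.differential_eq_of_smul_eq h1, smul_smul,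
      mul_comm]
  · rcases n with _ | n
    · rw [mul_smul, t0, smul_zero]
    · rw [mul_smul, t1, smul_comm, B.toLieRinehart.differential_local (h2 n (by omega)), smul_zero]

theorem zsmul_multisection_apply (m : ℤ) {k : ℕ} (P : Multisection E F' W k)
    (ξ : Fin k → Cₛ^∞⟮𝓘(ℝ, E); F', W⟯) (x : M) : (m • P) ξ x = m • P ξ x :=
  map_zsmul (⟨⟨fun P => P ξ x, rfl⟩, fun _ _ => rfl⟩ : Multisection E F' W k →+ ℝ) m P

theorem representsAt_toForm (κ : DualPairing E F V F' W) {k : ℕ} {u}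
    (hu : ∀ n, n ≠ k → toForm κ.onSections n u = 0) (x : M) :
    RepresentsAt κ x (toForm κ.onSections k u) u :=
  ⟨1, one_ne_zero, rfl, fun n hn => by rw [hu n hn, smul_zero]⟩

theorem schouten_toForm {p q : ℕ} {u v} (hu : ∀ n, n ≠ p → toForm κ.onSections n u = 0)
    (hv : ∀ n, n ≠ q → toForm κ.onSections n v = 0) :
    schouten A κ (toForm κ.onSections p u) (toForm κ.onSections q v) =
      fun n => toForm κ.onSections n (A.toLieRinehart.schoutenAlg u v) := by
  ext n ξ x
  exact schouten_apply A κ (representsAt_toForm κ hu x) (representsAt_toForm κ hv x) n ξ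

/-- A homogeneous element of the exterior algebra represents its form at every point with the factor
1, so the bracket on the left is the algebraic one globally. Only the differentials on the right
need representatives near x. -/
theorem IsLieBialgebroid.eval (hAB : IsLieBialgebroid A B κ) {p q : ℕ} {u v u' v'}
    (hu : ∀ n, n ≠ p → toForm κ.onSections n u = 0)
    (hv : ∀ n, n ≠ q → toForm κ.onSections n v = 0) {x : M}
    (hu' : IsDifferentialNear B.toLieRinehart κ.onSections (nonvanishingAt E x) u u')
    (hv' : IsDifferentialNear B.toLieRinehart κ.onSections (nonvanishingAt E x) v v')
    (n : ℕ) (ξ : Fin n → Cₛ^∞⟮𝓘(ℝ, E); F', W⟯) :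
    B.totalDifferential
        (fun n => toForm κ.onSections n (A.toLieRinehart.schoutenAlg u v)) n ξ x =
      toForm κ.onSections n (A.toLieRinehart.schoutenAlg u' v) ξ x +
        (-1 : ℤ) ^ (p + 1) • toForm κ.onSections n (A.toLieRinehart.schoutenAlg u v') ξ x := by
  have hu₀ := representsAt_toForm κ hu x
  have hv₀ := representsAt_toForm κ hv x
  have h := hAB p q (toForm κ.onSections p u) (toForm κ.onSections q v)
  rw [schouten_toForm hu hv] at h
  rw [h, ← schouten_apply A κ (hu₀.differential hu') hv₀,
    ← schouten_apply A κ hu₀ (hv₀.differential hv'), ← zsmul_multisection_apply]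
  rfl

/-- The three identities are the cases (p, q) = (0, 0), (1, 0) and (1, 1) of the derivation
property, each evaluated in degree p + q. -/
theorem IsLieBialgebroid.isCompatible (hAB : IsLieBialgebroid A B κ) :
    IsCompatible A.toLieRinehart B.toLieRinehart κ.onSections_flip_bijective
      κ.flip.onSections_flip_bijective := by
  have hββ' := κ.flip_onSections
  have hι := fun (X : Cₛ^∞⟮𝓘(ℝ, E); F, V⟯) n (hn : n ≠ 1) => toForm_ι_of_ne κ.onSections hn X
  have hfn := fun (f : C^∞⟮𝓘(ℝ, E), M; ℝ⟯) n (hn : n ≠ 0) =>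
    toForm_algebraMap_of_ne κ.onSections hn f
  have hd := fun (x : M) (f : C^∞⟮𝓘(ℝ, E), M; ℝ⟯) => isDifferentialNear_algebraMap
    (B := B.toLieRinehart) (S := nonvanishingAt E x) κ.onSections_flip_bijective f
  refine ⟨fun f g => ?_, fun X f ξ => ?_, fun X Y ξ η => ?_⟩
  · ext x
    have h := hAB.eval (hfn f) (hfn g) (hd x f) (hd x g) 0 ![]
    rw [schoutenAlg_ι, lieDeriv_algebraMap, toForm_zero_algebraMap, schoutenAlg_ι_right,
      lieDeriv_algebraMap, map_neg, AlternatingMap.neg_apply, toForm_zero_algebraMap] at h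
    -- The left-hand side is the component of degree 0 of a differential, which is zero by
    -- definition.
    change (0 : ℝ) = _ + _ • -_ at h
    rw [zero_add, pow_one, neg_smul, one_smul, neg_neg] at h
    exact h.symm
  · ext x
    obtain ⟨w, hw, t, tS, t2, t0⟩ := exists_bivector_differential (B := B.toLieRinehart)
      (κ.hasDualFrameNear x) X
    have h := hAB.eval (hι X) (hfn f) (isDifferentialNear_ι tS t2 t0) (hd x f) 1 ![ξ]
    rw [A.toLieRinehart.schoutenAlg_algebraMap_right w, gradeInv_bivector hw, schoutenAlg_ι, schoutenAlg_ι,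
      lieDeriv_algebraMap] at h
    have h1 := eval_eq_of_mul_eq tS (smul_toForm_one_bracket (A := A.toLieRinehart)
      κ.onSections_flip_bijective κ.flip.onSections_flip_bijective hββ' t2 f ξ)
    rw [← h1]
    refine Eq.trans ?_ (h.trans ?_)
    · change _ = B.toLieRinehart.differential (toForm κ.onSections 0 _) ![ξ] x
      rw [differential_apply_zero, toForm_zero_algebraMap]
      rfl
    · rw [map_add, add_comm]
      norm_num
  · ext x
    obtain ⟨w, hw, t, tS, t2, t0⟩ := exists_bivector_differential (B := B.toLieRinehart)
      (κ.hasDualFrameNear x) X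
    obtain ⟨w', hw', s, sS, s2, s0⟩ := exists_bivector_differential (B := B.toLieRinehart)
      (κ.hasDualFrameNear x) Y
    have h := hAB.eval (hι X) (hι Y) (isDifferentialNear_ι tS t2 t0)
      (isDifferentialNear_ι sS s2 s0) 2 ![ξ, η]
    have h1 := eval_eq_of_mul_eq (mul_ne_zero tS tS) (smul_toForm_two_lieDeriv
      (A := A.toLieRinehart) κ.onSections_flip_bijective κ.flip.onSections_flip_bijective hββ' t2
      Y ξ η)
    have h2 := eval_eq_of_mul_eq (mul_ne_zero sS sS) (smul_toForm_two_lieDeriv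
      (A := A.toLieRinehart) κ.onSections_flip_bijective κ.flip.onSections_flip_bijective hββ' s2
      X ξ η)
    rw [schoutenAlg_ι, lieDeriv_ι, schoutenAlg_ι, schoutenAlg_ι_right, h2, map_neg] at h
    refine Eq.trans ?_ (h.trans ?_)
    · rw [← differential_toForm_ι κ.onSections_flip_bijective]
      rfl
    · change -(toForm κ.onSections 2 _ ![ξ, η] x) + _ = _
      rw [h1]
      norm_num
      ring

/-- A bump function supported where P and Q agree turns equality near x into equality of multiples,
the form in which the locality of the differential is available. -/
theorem smul_eq_of_eventually_eq {x : M} {k : ℕ} {P Q : Multisection E F' W k}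
    (h : ∀ᶠ y in 𝓝 x, ∀ ξ, P ξ y = Q ξ y) :
    ∃ t : C^∞⟮𝓘(ℝ, E), M; ℝ⟯, t x ≠ 0 ∧ t • P = t • Q := by
  obtain ⟨t, ht, hU⟩ := exists_bump (E := E) x h
  refine ⟨t, by rw [ht.self_of_nhds]; exact one_ne_zero, ?_⟩
  ext ξ y
  change t y * P ξ y = t y * Q ξ y
  by_cases hy : t y = 0
  · rw [hy, zero_mul, zero_mul]
  · rw [hU (subset_tsupport _ hy) ξ]

/-- The grade involution of `u` still represents P when p is even, and its negative does when p is
odd. This recovers the sign of the definition from the one in `IsCompatibleNear.schoutenAlg`. -/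
theorem schouten_gradeInv {x : M} {p q : ℕ} {P : Multisection E F' W p}
    {Q : Multisection E F' W q} {u v} (hu : RepresentsAt κ x P u) (hv : RepresentsAt κ x Q v)
    (n : ℕ) (ξ : Fin n → Cₛ^∞⟮𝓘(ℝ, E); F', W⟯) :
    toForm κ.onSections n (A.toLieRinehart.schoutenAlg (gradeInv u) v) ξ x =
      (-1 : ℤ) ^ p • schouten A κ P Q n ξ x := by
  obtain ⟨h, hx, h1, h2⟩ := hu
  rcases p.even_or_odd with hp | hp
  · have hu' : RepresentsAt κ x P (gradeInv u) :=
      ⟨h, hx, by rw [toForm_gradeInv, hp.neg_one_pow, one_smul, h1],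
        fun n hn => by rw [toForm_gradeInv, smul_comm, h2 n hn, smul_zero]⟩
    rw [hp.neg_one_pow, one_smul, schouten_apply A κ hu' hv]
  · have hu' : RepresentsAt κ x P (-gradeInv u) :=
      ⟨h, hx, by rw [map_neg, toForm_gradeInv_of_odd _ hp, neg_neg, h1],
        fun n hn => by
          rw [map_neg, toForm_gradeInv, smul_neg, smul_comm, h2 n hn, smul_zero, neg_zero]⟩
    rw [hp.neg_one_pow, neg_one_smul, schouten_apply A κ hu' hv, schoutenAlg_neg_left, map_neg]
    exact (neg_neg _).symm

/-- Both sides are compared at a point x, near which P, Q and their differentials are represented in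
the exterior algebra; there the claim is `IsCompatibleNear.schoutenAlg`. -/
theorem isLieBialgebroid_of_isCompatible
    (hc : IsCompatible A.toLieRinehart B.toLieRinehart κ.onSections_flip_bijective
      κ.flip.onSections_flip_bijective) : IsLieBialgebroid A B κ := by
  intro p q P Q
  ext n ξ x
  obtain ⟨u, hu⟩ := exists_representsAt κ x P
  obtain ⟨v, hv⟩ := exists_representsAt κ x Q
  have hF := κ.hasDualFrameNear x
  obtain ⟨u', hu'⟩ := exists_isDifferentialNear (B := B.toLieRinehart)
    κ.onSections_flip_bijective hF u
  obtain ⟨v', hv'⟩ := exists_isDifferentialNear (B := B.toLieRinehart)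
    κ.onSections_flip_bijective hF v
  obtain ⟨h, hx, h0, h1⟩ := (hc.near κ.flip_onSections).schoutenAlg hF hu' hv'
  have hR : toForm κ.onSections n (A.toLieRinehart.schoutenAlg u' v -
      A.toLieRinehart.schoutenAlg (gradeInv u) v') ξ x =
      (schouten A κ (B.toLieRinehart.differential P) Q +
        (-1 : ℤ) ^ (p + 1) • schouten A κ P (B.toLieRinehart.differential Q)) n ξ x := by
    rw [map_sub, Pi.add_apply, Pi.smul_apply]
    change toForm κ.onSections n (A.toLieRinehart.schoutenAlg u' v) ξ x -
      toForm κ.onSections n (A.toLieRinehart.schoutenAlg (gradeInv u) v') ξ x =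
      schouten A κ (B.toLieRinehart.differential P) Q n ξ x +
        ((-1 : ℤ) ^ (p + 1) • schouten A κ P (B.toLieRinehart.differential Q) n) ξ x
    rw [zsmul_multisection_apply, schouten_gradeInv hu (hv.differential hv'),
      ← schouten_apply A κ (hu.differential hu') hv, pow_succ, mul_neg_one, neg_smul,
      sub_eq_add_neg]
  rw [← hR]
  -- In degree 0 the total differential is zero by definition, which is the first condition in
  -- `IsDifferentialNear`.
  rcases n with _ | n
  · exact (eval_eq_of_mul_eq hx ((congrArg (fun T : Multisection E F' W 0 => T ξ) h0).trans
      (mul_zero h).symm)).symm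
  -- The elements `u` and `v` were chosen at x, so [P, Q] is the form of their bracket only near x;
  -- locality of the differential makes this sufficient.
  · obtain ⟨t, tx, ht⟩ := smul_eq_of_eventually_eq (x := x) (P := schouten A κ P Q n)
      (Q := toForm κ.onSections n (A.toLieRinehart.schoutenAlg u v)) (by
        filter_upwards [hu.eventually, hv.eventually] with y hy hy' ξ
        exact schouten_apply A κ hy hy' n ξ)
    have h2 := B.toLieRinehart.differential_eq_of_smul_eq ht
    refine (eval_eq_of_mul_eq (mul_ne_zero tx tx)
      (congrArg (fun T : Multisection E F' W (n + 1) => T ξ) h2)).trans ?_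
    exact (eval_eq_of_mul_eq hx (congrArg (fun T : Multisection E F' W (n + 1) => T ξ)
      (h1 n))).symm

end LieBialgebroid

theorem corollary2p7
    {E : Type*} [NormedAddCommGroup E] [NormedSpace ℝ E] [FiniteDimensional ℝ E]
    {M : Type*} [TopologicalSpace M] [ChartedSpace E M] [IsManifold 𝓘(ℝ, E) ∞ M] [T2Space M]
    {F : Type*} [NormedAddCommGroup F] [NormedSpace ℝ F] [FiniteDimensional ℝ F]
    {V : M → Type*} [TopologicalSpace (TotalSpace F V)] [∀ x, AddCommGroup (V x)]
    [∀ x, Module ℝ (V x)] [∀ x, TopologicalSpace (V x)] [FiberBundle F V] [VectorBundle ℝ F V]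
    [ContMDiffVectorBundle ∞ F V 𝓘(ℝ, E)]
    {F' : Type*} [NormedAddCommGroup F'] [NormedSpace ℝ F'] [FiniteDimensional ℝ F']
    {W : M → Type*} [TopologicalSpace (TotalSpace F' W)] [∀ x, AddCommGroup (W x)]
    [∀ x, Module ℝ (W x)] [∀ x, TopologicalSpace (W x)] [FiberBundle F' W] [VectorBundle ℝ F' W]
    [ContMDiffVectorBundle ∞ F' W 𝓘(ℝ, E)]
    (A : LieAlgebroid E F V) (B : LieAlgebroid E F' W) (κ : DualPairing E F V F' W)
    (h : IsLieBialgebroid A B κ) : IsLieBialgebroid B A κ.flip :=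
  -- Flipping `κ` twice gives `κ` back by definition, so the compatibility with the two pairings
  -- exchanged has the required type.
  isLieBialgebroid_of_isCompatible (h.isCompatible.symm κ.flip_onSections)
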